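/- **Conventions.** A \emph{plane straight-line (PSL) graph} is a graph on a finite vertex set $V\subset\mathbb R^2$ with pairwise distinct $x$-coordinates, pairwise distinct $y$-coordinates and no three collinear points, whose edges, drawn as straight segments, have pairwise disjoint relative interiors. It is \emph{maximal} if no edge can be added; it is then a triangulation of the convex hull of $V$. The north-, south-, east- and west-degree of a vertex $v$ are the numbers of edges $uv$ with $u$ strictly above, below, to the right of, to the left of $v$. A \emph{cardinal signature} $\sigma$ on $V$ prescribes these four degrees for each $v\in V$. A \emph{realization} of $\sigma$ is a PSL graph on $V$ with signature $\sigma$. An edge is \emph{forced} by $\sigma$ if every realization of $\sigma$ contains it. **Frame graphs.** Let $w,h\ge 1$. A \emph{frame graph} $F$ is a PSL graph obtained by placing the following graph in the plane. Take the grid graph of $w\times h$ square cells, subdivide each edge by three vertices, and call the resulting paths $\alpha_0,\dots,\alpha_w$ (vertical, from west to east) and $\beta_0,\dots,\beta_h$ (horizontal, from south to north). Each cell may be given up to two isolated vertices $p$, $q$. Add a cone vertex $c$ joined to all vertices of $\alpha_0$ and of $\beta_0$. Write the boundary cycle of a cell counterclockwise as $v_0,\bar v_1,\dots,\bar v_7,v_8,v_7,\dots,v_1$,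 with north-east, north-west, south-west and south-east corners $v_0,\bar v_4,v_8,v_4$. The placement has to satisfy: * in each cell, the order by increasing $x$-coordinate is $\bar v_4,\bar v_5,\bar v_6,\bar v_7,v_8,p,\bar v_3,\bar v_2,\bar v_1,v_0,v_1,v_2,v_3,q,v_7,v_6,v_5,v_4$ and the order by increasing $y$-coordinate is $v_4,v_5,v_6,v_7,v_8,q,v_3,v_2,v_1,v_0,\bar v_1,\bar v_2,\bar v_3,p,\bar v_7,\bar v_6,\bar v_5,\bar v_4$ (omitting $p$ or $q$ if absent); $p$ lies south-west of the segment $\bar v_3\bar v_7$ and $q$ lies south-west of the segment $v_3v_7$; * every edge of $\alpha_i$ is an edge of the convex hull of the set of all vertices that are not east of the southmost vertex of $\alpha_i$, and every edge of $\beta_j$ is an edge of the convex hull of the set of all vertices that are not north of the westmost vertex of $\beta_j$; * $c$ lies strictly south and strictly west of all other vertices. **Gadgets and the constructed signature.** A \emph{gadget} for a cell is a graph $U$ on the vertices of the cell (including $p,q$ if present) whose edges are coloured black, light red, dark red, light blue or dark blue, such that for each choice of a shade $r$ of red and a shade $b$ of blue the black, $r$-red and $b$-blue edges form a triangulation of the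 cell (a noncrossing graph on the vertices of the cell that contains the boundary cycle, stays in the closed region bounded by it, and is maximal with these properties), except that for the light-light choice they may instead cross. Insert a gadget in each cell of $F$, colour the edges of $F$ black, and suppose that in the resulting graph each vertex has, in each cardinal direction, as many light red as dark red edges and as many light blue as dark blue edges. The \emph{constructed signature} $\sigma$ on the vertex set of $F$ assigns to each vertex and cardinal direction the number of incident black edges plus half the number of incident red and blue edges in that direction. **Statement.** Let $F$ be a frame graph. 1. If $G$ is a maximal PSL graph that contains $F$ and has no other vertices than $F$, and $\sigma$ is the cardinal signature of $G$, then every edge of $F$ is forced by $\sigma$. 2. For every choice of gadgets as above, every realization of the constructed signature $\sigma$ contains all edges of $F$. -/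

import Mathlib

noncomputable section

/-- Points of the plane; `z.1` is the `x`-coordinate (east) and `z.2` the `y`-coordinate (north). -/
abbrev Pt : Type := ℝ × ℝ

/-! ### Plane straight-line graphs -/

/-- The standing convention on vertex sets: distinct `x`-coordinates, distinct `y`-coordinates,
and no three points on a line. -/
def GeneralPosition (V : Finset Pt) : Prop :=
  (∀ a ∈ V, ∀ b ∈ V, a.1 = b.1 → a = b) ∧
  (∀ a ∈ V, ∀ b ∈ V, a.2 = b.2 → a = b) ∧
  (∀ a ∈ V, ∀ b ∈ V, ∀ c ∈ V, a ≠ b → b ≠ c → a ≠ c → ¬ Collinear ℝ ({a, b, c} : Set Pt))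

/-- Distinct edges, drawn as straight segments, have disjoint relative interiors. -/
def NonCrossing {V : Finset Pt} (G : SimpleGraph V) : Prop :=
  ∀ a b c d : V, G.Adj a b → G.Adj c d → s(a, b) ≠ s(c, d) →
    Disjoint (openSegment ℝ (a : Pt) (b : Pt)) (openSegment ℝ (c : Pt) (d : Pt))

/-- `G` is a plane straight-line (PSL) graph with vertex set `V`. -/
def IsPSL {V : Finset Pt} (G : SimpleGraph V) : Prop :=
  GeneralPosition V ∧ NonCrossing G

/-- A maximal PSL graph: no edge can be added. Such a graph is a triangulation of the
convex hull of its vertex set. -/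
def IsMaximalPSL {V : Finset Pt} (G : SimpleGraph V) : Prop :=
  Maximal (fun H : SimpleGraph V => IsPSL H) G

/-! ### Cardinal degrees, signatures, forced edges -/

/-- The four cardinal directions. -/
inductive Direction : Type
  | north | south | east | west

/-- `LiesIn u D v`: the point `u` lies strictly in direction `D` of `v`. -/
def LiesIn (u : Pt) : Direction → Pt → Prop
  | .north, v => v.2 < u.2
  | .south, v => u.2 < v.2
  | .east, v => v.1 < u.1
  | .west, v => u.1 < v.1

/-- The number of edges of `G` at `v` whose other endpoint lies in direction `D` of `v`. -/
def cardinalDegree {V : Finset Pt} (G : SimpleGraph V) (D : Direction) (v : V) : ℕ :=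
  {u : V | G.Adj v u ∧ LiesIn (u : Pt) D (v : Pt)}.ncard

/-- A cardinal signature on the vertex set `V`: a north-, south-, east- and west-degree for
each vertex. -/
abbrev CardinalSignature (V : Finset Pt) : Type := Direction → V → ℕ

/-- The cardinal signature of a graph. -/
def signature {V : Finset Pt} (G : SimpleGraph V) : CardinalSignature V :=
  fun D v => cardinalDegree G D v

/-- `G` is a realization of `σ`: a PSL graph on `V` with signature `σ`. -/
def IsRealization {V : Finset Pt} (σ : CardinalSignature V) (G : SimpleGraph V) : Prop :=
  IsPSL G ∧ signature G = σ

/-- The edge `uv` is forced by `σ`: every realization of `σ` contains it. -/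
def IsForced {V : Finset Pt} (σ : CardinalSignature V) (u v : V) : Prop :=
  ∀ G : SimpleGraph V, IsRealization σ G → G.Adj u v

/-! ### Frame graphs -/

/-- Twice the signed area of the triangle `a b z`: positive if `z` is to the left of the directed
line from `a` to `b`, negative if it is to the right. -/
def cross (a b z : Pt) : ℝ :=
  (b.1 - a.1) * (z.2 - a.2) - (b.2 - a.2) * (z.1 - a.1)

/-- The segment `ab` is an edge of the convex hull of `S`: all of `S` lies on one side of it. -/
def IsHullEdge (S : Set Pt) (a b : Pt) : Prop :=
  a ∈ S ∧ b ∈ S ∧ a ≠ b ∧ ((∀ z ∈ S, 0 ≤ cross a b z) ∨ (∀ z ∈ S, cross a b z ≤ 0))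

/-- The points of a frame with `w` columns and `h` rows of cells. Every edge of the grid of cells
is subdivided by three vertices, so the vertices on grid edges are indexed by the pairs `(a, b)`
with `a ≤ 4 * w`, `b ≤ 4 * h` and `4 ∣ a` or `4 ∣ b`; the corners of the cells are the pairs with
`4 ∣ a` and `4 ∣ b`. The values of `P` at other pairs are irrelevant.
The vertical path `i` (from the left) is `P (4 * i) 0, …, P (4 * i) (4 * h)` from south to north,
the horizontal path `j` (from the bottom) is `P 0 (4 * j), …, P (4 * w) (4 * j)` from west to east.
The cell in column `i` and row `j` may have interior vertices `p i j` and `q i j`;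
`c` is the cone vertex. -/
structure Frame (w h : ℕ) where
  P : ℕ → ℕ → Pt
  p : Fin w → Fin h → Option Pt
  q : Fin w → Fin h → Option Pt
  c : Pt

namespace Frame

variable {w h : ℕ} (F : Frame w h)

/-- The indices of the vertices on the grid edges. -/
def gridIndices (w h : ℕ) : Finset (ℕ × ℕ) :=
  (Finset.range (4 * w + 1) ×ˢ Finset.range (4 * h + 1)).filter (fun x => 4 ∣ x.1 ∨ 4 ∣ x.2)

/-- All vertices of the frame graph. -/
def verts : Finset Pt :=
  (gridIndices w h).image (fun x => F.P x.1 x.2) ∪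
    Finset.univ.biUnion (fun i => Finset.univ.biUnion (fun j =>
      (F.p i j).toFinset ∪ (F.q i j).toFinset)) ∪ {F.c}

/-- The vertices `v₀, …, v₈` of a cell, from the north-east corner `v₀` south along the east
boundary to the south-east corner `v₄`, then west along the south boundary to the south-west
corner `v₈`. -/
def v (i : Fin w) (j : Fin h) (n : ℕ) : Pt :=
  if n ≤ 4 then F.P (4 * i + 4) (4 * j + (4 - n)) else F.P (4 * i + (8 - n)) (4 * j)

/-- The vertices `v̄₁, …, v̄₇` of a cell, from `v₀` west along the north boundary to the
north-west corner `v̄₄`, then south along the west boundary towards `v₈`. -/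
def vb (i : Fin w) (j : Fin h) (n : ℕ) : Pt :=
  if n ≤ 4 then F.P (4 * i + (4 - n)) (4 * j + 4) else F.P (4 * i) (4 * j + (8 - n))

/-- The vertices of a cell in the order of increasing `x`-coordinate. -/
def xList (i : Fin w) (j : Fin h) : List Pt :=
  [F.vb i j 4, F.vb i j 5, F.vb i j 6, F.vb i j 7, F.v i j 8] ++ (F.p i j).toList ++
  [F.vb i j 3, F.vb i j 2, F.vb i j 1, F.v i j 0, F.v i j 1, F.v i j 2, F.v i j 3] ++
  (F.q i j).toList ++ [F.v i j 7, F.v i j 6, F.v i j 5, F.v i j 4]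

/-- The vertices of a cell in the order of increasing `y`-coordinate. -/
def yList (i : Fin w) (j : Fin h) : List Pt :=
  [F.v i j 4, F.v i j 5, F.v i j 6, F.v i j 7, F.v i j 8] ++ (F.q i j).toList ++
  [F.v i j 3, F.v i j 2, F.v i j 1, F.v i j 0, F.vb i j 1, F.vb i j 2, F.vb i j 3] ++
  (F.p i j).toList ++ [F.vb i j 7, F.vb i j 6, F.vb i j 5, F.vb i j 4]

/-- The frame graph: the vertical paths, the horizontal paths, and the edges from the cone vertex
to the vertices of the leftmost vertical and of the bottommost horizontal path. -/
def graph : SimpleGraph F.verts :=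
  SimpleGraph.fromRel (fun u v : F.verts =>
    (∃ i ≤ w, ∃ k < 4 * h, (u : Pt) = F.P (4 * i) k ∧ (v : Pt) = F.P (4 * i) (k + 1)) ∨
    (∃ j ≤ h, ∃ k < 4 * w, (u : Pt) = F.P k (4 * j) ∧ (v : Pt) = F.P (k + 1) (4 * j)) ∨
    ((u : Pt) = F.c ∧
      ((∃ k ≤ 4 * h, (v : Pt) = F.P 0 k) ∨ (∃ k ≤ 4 * w, (v : Pt) = F.P k 0))))

/-- The conditions on the position of the vertices under which `F.graph` is a frame graph. -/
structure IsFrameGraph : Prop where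
  w_pos : 0 < w
  h_pos : 0 < h
  /-- The grid vertices are pairwise distinct. -/
  inj : ∀ x ∈ gridIndices w h, ∀ y ∈ gridIndices w h, F.P x.1 x.2 = F.P y.1 y.2 → x = y
  /-- The frame graph, hence each of its cells, is a PSL graph. -/
  psl : IsPSL F.graph
  xOrder : ∀ i j, (F.xList i j).Pairwise (fun a b => a.1 < b.1)
  yOrder : ∀ i j, (F.yList i j).Pairwise (fun a b => a.2 < b.2)
  /-- `p`, if present, is south-west of the segment `v̄₇v̄₃`, which descends from west to east. -/
  p_side : ∀ i j, ∀ z ∈ F.p i j, cross (F.vb i j 7) (F.vb i j 3) z < 0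
  /-- `q`, if present, is south-west of the segment `v₃v₇`, which descends from west to east. -/
  q_side : ∀ i j, ∀ z ∈ F.q i j, cross (F.v i j 3) (F.v i j 7) z < 0
  /-- Each vertical path lies on the boundary of the convex hull of all vertices that are
  not east of its southmost vertex. -/
  vertical_hull : ∀ i ≤ w, ∀ k < 4 * h,
    IsHullEdge {z : Pt | z ∈ F.verts ∧ z.1 ≤ (F.P (4 * i) 0).1}
      (F.P (4 * i) k) (F.P (4 * i) (k + 1))
  /-- Each horizontal path lies on the boundary of the convex hull of all vertices that are
  not north of its westmost vertex. -/
  horizontal_hull : ∀ j ≤ h, ∀ k < 4 * w,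
    IsHullEdge {z : Pt | z ∈ F.verts ∧ z.2 ≤ (F.P 0 (4 * j)).2}
      (F.P k (4 * j)) (F.P (k + 1) (4 * j))
  /-- The cone vertex is south and west of all other vertices. -/
  cone : ∀ z ∈ F.verts, z ≠ F.c → F.c.1 < z.1 ∧ F.c.2 < z.2

/-! ### Triangulations of a cell, gadgets, and the constructed signature -/

/-- The boundary cycle `v₀, v̄₁, …, v̄₇, v₈, v₇, …, v₁, v₀` of a cell. -/
def cycle (i : Fin w) (j : Fin h) (k : ℕ) : Pt :=
  if 1 ≤ k ∧ k ≤ 7 then F.vb i j k else if k = 0 then F.v i j 0 else F.v i j (16 - k)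

/-- The boundary cycle of a cell as a graph. -/
def cellBoundary (i : Fin w) (j : Fin h) : SimpleGraph F.verts :=
  SimpleGraph.fromRel (fun u v : F.verts =>
    ∃ k < 16, (u : Pt) = F.cycle i j k ∧ (v : Pt) = F.cycle i j (k + 1))

/-- The boundary curve of a cell. -/
def cellCurve (i : Fin w) (j : Fin h) : Set Pt :=
  {z | ∃ k < 16, z ∈ segment ℝ (F.cycle i j k) (F.cycle i j (k + 1))}

/-- The closed region bounded by the boundary curve of a cell. By the order of the
`x`-coordinates, the curve consists of two `x`-monotone paths from `v̄₄` to `v₄`, so the region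
is the set of the points that have a point of the curve weakly above and one weakly below. -/
def cellRegion (i : Fin w) (j : Fin h) : Set Pt :=
  {z | ∃ a ∈ F.cellCurve i j, ∃ b ∈ F.cellCurve i j,
    a.1 = z.1 ∧ b.1 = z.1 ∧ a.2 ≤ z.2 ∧ z.2 ≤ b.2}

/-- A PSL graph on the vertices of a cell that contains the boundary cycle of the cell as its outer
boundary: its edges join vertices of the cell, and none of them leaves the region of the cell. -/
def IsCellGraph (i : Fin w) (j : Fin h) (H : SimpleGraph F.verts) : Prop :=
  NonCrossing H ∧ F.cellBoundary i j ≤ H ∧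
  ∀ u v : F.verts, H.Adj u v →
    (u : Pt) ∈ F.xList i j ∧ (v : Pt) ∈ F.xList i j ∧
    segment ℝ (u : Pt) (v : Pt) ⊆ F.cellRegion i j

/-- A triangulation of a cell: a cell graph to which no further edge can be added, that is,
one in which every bounded face is a triangle. -/
def IsCellTriangulation (i : Fin w) (j : Fin h) (H : SimpleGraph F.verts) : Prop :=
  Maximal (F.IsCellGraph i j) H

end Frame

/-- The two shades of red and of blue. -/
inductive Shade : Type
  | light | dark

/-- The five edge colours. -/
inductive EdgeColor : Type
  | black
  | red (s : Shade)
  | blue (s : Shade)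

namespace Frame

variable {w h : ℕ} (F : Frame w h)

/-- The subgraph of an edge-coloured graph `U` formed by the edges whose colours are in the local
coloring consisting of black, one shade `r` of red and one shade `b` of blue. -/
def localGraph (U : EdgeColor → SimpleGraph F.verts) (r b : Shade) : SimpleGraph F.verts :=
  U .black ⊔ U (.red r) ⊔ U (.blue b)

/-- The edge-coloured graph `U` (given by its colour classes) is a gadget for the cell `(i, j)`:
each edge has one colour, and for each local coloring the edges with these colours form
a triangulation of the cell, except that the light-light local coloring may instead have
crossing edges. -/
def IsGadget (i : Fin w) (j : Fin h) (U : EdgeColor → SimpleGraph F.verts) : Prop :=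
  (∀ k l : EdgeColor, k ≠ l → Disjoint (U k) (U l)) ∧
  ∀ r b : Shade, F.IsCellTriangulation i j (F.localGraph U r b) ∨
    (r = .light ∧ b = .light ∧ ¬ NonCrossing (F.localGraph U r b))

/-- The edges of a given colour in the graph that results from inserting the graph `U i j`
in each cell `(i, j)` of the frame graph; the edges of the frame graph are black. -/
def filled (U : Fin w → Fin h → EdgeColor → SimpleGraph F.verts) (k : EdgeColor) :
    SimpleGraph F.verts :=
  (⨆ _ : k = .black, F.graph) ⊔ ⨆ i, ⨆ j, U i j k

/-- In the filled frame, each vertex has in each cardinal direction as many light red as dark red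
edges, and as many light blue as dark blue edges. -/
def IsBalanced (U : Fin w → Fin h → EdgeColor → SimpleGraph F.verts) : Prop :=
  ∀ (D : Direction) (v : F.verts),
    cardinalDegree (F.filled U (.red .light)) D v = cardinalDegree (F.filled U (.red .dark)) D v ∧
    cardinalDegree (F.filled U (.blue .light)) D v = cardinalDegree (F.filled U (.blue .dark)) D v

/-- The constructed signature: in each direction, the number of incident black edges plus half the
number of incident coloured (red or blue) edges of the filled frame. -/
def constructedSignature (U : Fin w → Fin h → EdgeColor → SimpleGraph F.verts) :
    CardinalSignature F.verts :=
  fun D v => cardinalDegree (F.filled U .black) D v +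
    (cardinalDegree (F.filled U (.red .light)) D v + cardinalDegree (F.filled U (.red .dark)) D v +
      cardinalDegree (F.filled U (.blue .light)) D v +
      cardinalDegree (F.filled U (.blue .dark)) D v) / 2

end Frame

end

/-! ### Heights of lines over the `x`-axis -/

/-! Direct every edge from west to east and count edges by their right ends. Let S be the set of
vertices that are not east of the southmost vertex of a vertical path. All west neighbours of a
vertex of S lie in S, so the number of edges inside S is the sum of the west-degrees over S, and σ
determines it (`card_edgesIn_west`). By Euler's formula a plane graph on S with k hull edges has at
most 3|S| - 3 - k edges. A graph that attains this bound contains every hull edge, because a missing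
hull edge could be added without a crossing (`HullChains.adj_of_card_le`). The vertical path is part
of the hull of S. So it suffices to have a reference graph Q whose degrees are at most those of σ
and which reaches the bound on every such S: then every realization contains all vertical paths and,
after exchanging the coordinates, all horizontal paths. The westmost vertical and the southmost
horizontal path together screen the cone vertex from all other vertices, so its neighbours lie on
these two paths, and its north-degree forces all of them to be neighbours (`mem_coneChain_of_adj`,
`graph_le_of_degree`).

In statement 1 the reference graph is G. Its part inside S is still maximal between the hull chains:
an edge that leaves S from inside the hull would have to pass both above and below the rightmost
point of S (`HullChains.card_le_of_maximal`). In statement 2 the reference graph consists of the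
black, dark red and dark blue edges. A dark-dark cell triangulation has 13 + 3n edges off the cell
boundary, n being the number of interior vertices. These edge sets are disjoint for different cells
because convexity of the paths forbids chords of the west and south sides (`not_adj_chord`).
Together with the frame edges they reach the bound exactly (`CellEdges.card_le`).

Both directions of Euler's formula come from one charging scheme. At a vertex v order the edges to
the right by slope. The lowest one is charged to v. For any other edge va let vb be the next lower
one and m the leftmost vertex of the wedge between them. If m = a, then vb is the first edge below
a; otherwise va is the first edge above m. In both cases va is charged to m. In a plane graph every
edge is covered this way (`Plane.card_edges_le`); in a maximal graph every admissible charge occurs,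
and distinct charges give distinct edges (`ChainBounded.card_le`). -/

/-- The height at `x` of the line through `a` and `b`. -/
noncomputable def ht (a b : Pt) (x : ℝ) : ℝ := a.2 + (b.2 - a.2) / (b.1 - a.1) * (x - a.1)

/-- The slope of the line through `a` and `b`. -/
noncomputable def sl (a b : Pt) : ℝ := (b.2 - a.2) / (b.1 - a.1)

lemma ht_left (a b : Pt) : ht a b a.1 = a.2 := by simp [ht]

lemma ht_right {a b : Pt} (h : a.1 < b.1) : ht a b b.1 = b.2 := by
  have : b.1 - a.1 ≠ 0 := (sub_pos.2 h).ne'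
  simp only [ht]
  field_simp
  ring

lemma ht_eq_add (a b : Pt) (x y : ℝ) : ht a b y = ht a b x + sl a b * (y - x) := by
  simp only [ht, sl]; ring

lemma ht_eq_sl (a b : Pt) (x : ℝ) : ht a b x = a.2 + sl a b * (x - a.1) := rfl

/-- The gap between two lines is affine in the abscissa; the crossing arguments below are sign
considerations for this affine function. -/
lemma ht_sub_affine (a b c d : Pt) (x y : ℝ) :
    ht a b y - ht c d y = ht a b x - ht c d x + (sl a b - sl c d) * (y - x) := by
  rw [ht_eq_add a b x y, ht_eq_add c d x y]; ring

lemma cross_eq {a b : Pt} (h : a.1 ≠ b.1) (z : Pt) :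
    cross a b z = (b.1 - a.1) * (z.2 - ht a b z.1) := by
  have : b.1 - a.1 ≠ 0 := sub_ne_zero.2 h.symm
  simp only [cross, ht]
  field_simp
  ring

lemma cross_swap (a b z : Pt) : cross b a z = - cross a b z := by
  simp only [cross]; ring

/-- Two lines that change their vertical order meet in between. -/
lemma exists_ht_eq {a b c d : Pt} {x y : ℝ} (hx : ht a b x < ht c d x) (hy : ht c d y < ht a b y) :
    ∃ t, (x < t ∧ t < y ∨ y < t ∧ t < x) ∧ ht a b t = ht c d t := by
  set g0 := ht a b x - ht c d x with hg0
  set μ := sl a b - sl c d with hμ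
  have e : ∀ t, ht a b t - ht c d t = g0 + μ * (t - x) := fun t => ht_sub_affine a b c d x t
  have h0 : g0 < 0 := by linarith
  have h1 : 0 < g0 + μ * (y - x) := by linarith [e y]
  have hμ0 : μ ≠ 0 := by rintro h; rw [h] at h1; linarith
  -- This is the zero of the affine gap g0 + μ (t - x). As `y` may be on either side of `x`, the
  -- interval is not oriented.
  refine ⟨x + (-g0) / μ, ?_, ?_⟩
  · rcases lt_or_gt_of_ne hμ0 with h | h
    · right
      have : (-g0) / μ < 0 := div_neg_of_pos_of_neg (by linarith) h
      refine ⟨?_, by linarith⟩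
      have h2 : y - x < (-g0) / μ := by rw [lt_div_iff_of_neg h]; linarith
      linarith
    · left
      have : 0 < (-g0) / μ := div_pos (by linarith) h
      refine ⟨by linarith, ?_⟩
      have h2 : (-g0) / μ < y - x := by rw [div_lt_iff₀ h]; linarith
      linarith
  · have := e (x + (-g0) / μ)
    have h3 : μ * (x + -g0 / μ - x) = -g0 := by field_simp; ring
    rw [h3] at this
    linarith

lemma ht_le_of_endpoints {a b c d : Pt} {x y t : ℝ} (h1 : ht a b x ≤ ht c d x)
    (h2 : ht a b y ≤ ht c d y) (hx : x ≤ t) (hy : t ≤ y) : ht a b t ≤ ht c d t := by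
  have e1 := ht_sub_affine a b c d t x
  have e2 := ht_sub_affine a b c d t y
  by_contra h
  push Not at h
  rcases le_total 0 (sl a b - sl c d) with h' | h' <;> nlinarith

lemma ht_lt_of_sl_lt {v a b : Pt} (h : sl v a < sl v b) {x : ℝ} (hx : v.1 < x) :
    ht v a x < ht v b x := by
  rw [ht_eq_sl, ht_eq_sl]; nlinarith

lemma ht_le_of_sl_le {v a b : Pt} (h : sl v a ≤ sl v b) {x : ℝ} (hx : v.1 ≤ x) :
    ht v a x ≤ ht v b x := by
  rw [ht_eq_sl, ht_eq_sl]; nlinarith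

lemma sl_lt_of_ht_lt {v a b : Pt} {x : ℝ} (hx : v.1 < x) (h : ht v a x < ht v b x) :
    sl v a < sl v b := by
  by_contra h'
  linarith [ht_le_of_sl_le (not_lt.1 h') hx.le]

lemma sl_le_of_ht_le {v a b : Pt} {x : ℝ} (hx : v.1 < x) (h : ht v a x ≤ ht v b x) :
    sl v a ≤ sl v b := by
  by_contra h'
  linarith [ht_lt_of_sl_lt (not_le.1 h') hx]

/-! ### Plane graphs on point sets in general position -/

/-- The graph `G` on the points of `V` is drawn without crossings, and `V` is in general position,
both expressed by heights. -/
structure Plane (V : Finset Pt) (G : SimpleGraph Pt) : Prop where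
  xinj : ∀ a ∈ V, ∀ b ∈ V, a.1 = b.1 → a = b
  nocol : ∀ a ∈ V, ∀ b ∈ V, ∀ z ∈ V, a.1 < b.1 → z ≠ a → z ≠ b → ht a b z.1 ≠ z.2
  supp : ∀ a b, G.Adj a b → a ∈ V ∧ b ∈ V
  nc : ∀ a b c d, G.Adj a b → G.Adj c d → (a, b) ≠ (c, d) →
    ∀ x, a.1 < x → x < b.1 → c.1 < x → x < d.1 → ht a b x ≠ ht c d x

namespace Plane

variable {V : Finset Pt} {G : SimpleGraph Pt}

/-- The vertical order of two edges does not change over their common range. -/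
lemma order (hG : Plane V G) {a b c d : Pt} (hab : G.Adj a b) (hab' : a.1 < b.1)
    (hcd : G.Adj c d) (hcd' : c.1 < d.1) {x₀ x : ℝ}
    (h1 : a.1 ≤ x₀) (h2 : x₀ ≤ b.1) (h3 : c.1 ≤ x₀) (h4 : x₀ ≤ d.1)
    (g1 : a.1 ≤ x) (g2 : x ≤ b.1) (g3 : c.1 ≤ x) (g4 : x ≤ d.1)
    (h : ht a b x₀ < ht c d x₀) :
    ht a b x < ht c d x ∨ (ht a b x = ht c d x ∧ ((x = a.1 ∧ a = c) ∨ (x = b.1 ∧ b = d))) := by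
  have hne : (a, b) ≠ (c, d) := by
    rintro h'
    simp only [Prod.mk.injEq] at h'
    obtain ⟨rfl, rfl⟩ := h'
    exact lt_irrefl _ h
  obtain ⟨ha, hb⟩ := hG.supp _ _ hab
  obtain ⟨hc, hd⟩ := hG.supp _ _ hcd
  rcases lt_trichotomy (ht a b x) (ht c d x) with hlt | heq | hgt
  · exact Or.inl hlt
  -- Heights can agree only at a common end: an end of one edge inside the other violates `nocol`,
  -- an interior meeting violates `nc`.
  · right
    refine ⟨heq, ?_⟩
    have hxx : x ≠ x₀ := by rintro rfl; linarith
    rcases eq_or_lt_of_le g1 with e1 | e1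
    · left
      refine ⟨e1.symm, ?_⟩
      by_contra hac
      subst e1
      have hcx : c.1 < a.1 := lt_of_le_of_ne g3 (fun h' => hac (hG.xinj _ ha _ hc h'.symm))
      rw [ht_left] at heq
      rcases eq_or_lt_of_le g4 with e4 | e4
      · have : x₀ = a.1 := le_antisymm (e4 ▸ h4) h1
        exact hxx this.symm
      · exact hG.nocol _ hc _ hd _ ha hcd' hac (by rintro rfl; exact lt_irrefl _ e4) heq.symm
    · rcases eq_or_lt_of_le g2 with e2 | e2
      · right
        refine ⟨e2, ?_⟩
        by_contra hbd
        subst e2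
        have hcx : b.1 < d.1 := lt_of_le_of_ne g4 (fun h' => hbd (hG.xinj _ hb _ hd h'))
        rw [ht_right hab'] at heq
        rcases eq_or_lt_of_le g3 with e3 | e3
        · have : x₀ = b.1 := le_antisymm h2 (e3 ▸ h3)
          exact hxx this.symm
        · exact hG.nocol _ hc _ hd _ hb hcd' (by rintro rfl; exact lt_irrefl _ e3) hbd heq.symm
      · exfalso
        rcases eq_or_lt_of_le g3 with e3 | e3
        · subst e3
          rw [ht_left] at heq
          exact hG.nocol _ ha _ hb _ hc hab' (by rintro rfl; exact lt_irrefl _ e1)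
            (by rintro rfl; exact lt_irrefl _ e2) heq
        · rcases eq_or_lt_of_le g4 with e4 | e4
          · subst e4
            rw [ht_right hcd'] at heq
            exact hG.nocol _ ha _ hb _ hd hab' (by rintro rfl; exact lt_irrefl _ e1)
              (by rintro rfl; exact lt_irrefl _ e2) heq
          · exact hG.nc _ _ _ _ hab hcd hne x e1 e2 e3 e4 heq
  · exfalso
    obtain ⟨t, ht1, ht2⟩ := exists_ht_eq h hgt
    refine hG.nc _ _ _ _ hab hcd hne t ?_ ?_ ?_ ?_ ht2 <;>
    rcases ht1 with ht1 | ht1 <;> linarith [ht1.1, ht1.2]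

/-- `order` for heights multiplied by a sign. -/
lemma order_sign (hG : Plane V G) {s : ℝ} (hs : s = 1 ∨ s = -1) {a b c d : Pt} (hab : G.Adj a b)
    (hab' : a.1 < b.1) (hcd : G.Adj c d) (hcd' : c.1 < d.1) {x₀ x : ℝ}
    (h1 : a.1 ≤ x₀) (h2 : x₀ ≤ b.1) (h3 : c.1 ≤ x₀) (h4 : x₀ ≤ d.1)
    (g1 : a.1 ≤ x) (g2 : x ≤ b.1) (g3 : c.1 ≤ x) (g4 : x ≤ d.1)
    (h : s * ht a b x₀ < s * ht c d x₀) :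
    s * ht a b x < s * ht c d x ∨
      (s * ht a b x = s * ht c d x ∧ ((x = a.1 ∧ a = c) ∨ (x = b.1 ∧ b = d))) := by
  rcases hs with rfl | rfl
  · simpa using hG.order hab hab' hcd hcd' h1 h2 h3 h4 g1 g2 g3 g4 (by simpa using h)
  · have := hG.order hcd hcd' hab hab' h3 h4 h1 h2 g3 g4 g1 g2 (by simpa using h)
    rcases this with h | ⟨h, h' | h'⟩
    · left; simpa using h
    · right; exact ⟨by rw [h], Or.inl ⟨h'.1.trans (by rw [h'.2]), h'.2.symm⟩⟩
    · right; exact ⟨by rw [h], Or.inr ⟨h'.1.trans (by rw [h'.2]), h'.2.symm⟩⟩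

end Plane

/-- The edge `ab` (from left to right) is the first edge of `G` that is met from `m` in the
vertical direction of sign `s`. -/
def First (s : ℝ) (G : SimpleGraph Pt) (m a b : Pt) : Prop :=
  G.Adj a b ∧ a.1 < m.1 ∧ m.1 < b.1 ∧ s * m.2 < s * ht a b m.1 ∧
  ∀ c d, G.Adj c d → c.1 < m.1 → m.1 < d.1 → s * m.2 < s * ht c d m.1 →
    s * ht a b m.1 ≤ s * ht c d m.1

namespace Plane

variable {V : Finset Pt} {G : SimpleGraph Pt}

lemma sign_ne {s : ℝ} (hs : s = 1 ∨ s = -1) : s ≠ 0 := by rcases hs with rfl | rfl <;> norm_num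

lemma exists_first (hG : Plane V G) {s : ℝ} {m a b : Pt} (hab : G.Adj a b) (h1 : a.1 < m.1)
    (h2 : m.1 < b.1) (h3 : s * m.2 < s * ht a b m.1) : ∃ c d, First s G m c d := by
  classical
  let K := (V ×ˢ V).filter (fun e => G.Adj e.1 e.2 ∧ e.1.1 < m.1 ∧ m.1 < e.2.1 ∧
    s * m.2 < s * ht e.1 e.2 m.1)
  have hK : K.Nonempty := ⟨(a, b), by
    simp only [K, Finset.mem_filter, Finset.mem_product]
    exact ⟨hG.supp _ _ hab, hab, h1, h2, h3⟩⟩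
  obtain ⟨e, he, hmin⟩ := K.exists_min_image (fun e => s * ht e.1 e.2 m.1) hK
  simp only [K, Finset.mem_filter, Finset.mem_product] at he hmin
  exact ⟨e.1, e.2, he.2.1, he.2.2.1, he.2.2.2.1, he.2.2.2.2, fun c d hcd g1 g2 g3 =>
    hmin (c, d) ⟨hG.supp _ _ hcd, hcd, g1, g2, g3⟩⟩

lemma first_unique (hG : Plane V G) {s : ℝ} (hs : s = 1 ∨ s = -1) {m a b c d : Pt}
    (h : First s G m a b) (h' : First s G m c d) : (a, b) = (c, d) := by
  by_contra hne
  refine hG.nc _ _ _ _ h.1 h'.1 hne m.1 h.2.1 h.2.2.1 h'.2.1 h'.2.2.1 ?_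
  have h1 := h.2.2.2.2 c d h'.1 h'.2.1 h'.2.2.1 h'.2.2.2.1
  have h2 := h'.2.2.2.2 a b h.1 h.2.1 h.2.2.1 h.2.2.2.1
  exact mul_left_cancel₀ (sign_ne hs) (le_antisymm h1 h2)

lemma nocol_sign (hG : Plane V G) {s : ℝ} (hs : s = 1 ∨ s = -1) {a b z : Pt} (ha : a ∈ V)
    (hb : b ∈ V) (hz : z ∈ V) (h : a.1 < b.1) (h1 : z ≠ a) (h2 : z ≠ b) :
    s * ht a b z.1 ≠ s * z.2 :=
  fun h' => hG.nocol _ ha _ hb _ hz h h1 h2 (mul_left_cancel₀ (sign_ne hs) h')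

/-- If an edge other than `vk` has a point in the triangle between `vk` and the first edge `va`
of `k`, left of `k`, then one of its endpoints lies in the interior of this triangle, at least as
far from the line `vk`. -/
lemma exists_vertex_of_edge (hG : Plane V G) {s : ℝ} (hs : s = 1 ∨ s = -1) {v a k c d : Pt}
    (hk : k ∈ V) (hF : First s G k v a) (hcd : G.Adj c d) (hne : ¬ (c = v ∧ d = k)) {x : ℝ}
    (hcx : c.1 ≤ x) (hxd : x ≤ d.1) (hcd' : c.1 < d.1) (hvx : v.1 < x) (hxk : x < k.1)
    (hlow : s * ht v k x ≤ s * ht c d x) (hup : s * ht c d x < s * ht v a x) :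
    ∃ e ∈ V, v.1 < e.1 ∧ e.1 < k.1 ∧ s * e.2 < s * ht v a e.1 ∧
      s * ht c d x - s * ht v k x ≤ s * e.2 - s * ht v k e.1 ∧ s * ht v k e.1 < s * e.2 := by
  obtain ⟨hva, hvk, hka, hkva, hmin⟩ := hF
  obtain ⟨hv, ha⟩ := hG.supp _ _ hva
  obtain ⟨hc, hd⟩ := hG.supp _ _ hcd
  have hva' : v.1 < a.1 := hvk.trans hka
  -- μ is the signed slope of the gap between cd and the line vk. Following cd in the direction
  -- where the gap does not shrink leads to the wanted end.
  set μ := s * (sl c d - sl v k) with hμ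
  have φ : ∀ y z, s * ht c d z - s * ht v k z = s * ht c d y - s * ht v k y + μ * (z - y) := by
    intro y z
    have := ht_sub_affine c d v k y z
    rw [hμ]
    linear_combination s * this
  have hord : ∀ y, c.1 ≤ y → y ≤ d.1 → v.1 ≤ y → y ≤ a.1 → _ := fun y g1 g2 g3 g4 =>
    hG.order_sign hs hcd hcd' hva hva' hcx hxd hvx.le (by linarith) g1 g2 g3 g4 hup
  have finish : ∀ e ∈ V, v.1 < e.1 → e.1 < k.1 → c.1 ≤ e.1 → e.1 ≤ d.1 → ht c d e.1 = e.2 →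
      0 ≤ μ * (e.1 - x) →
      ∃ e ∈ V, v.1 < e.1 ∧ e.1 < k.1 ∧ s * e.2 < s * ht v a e.1 ∧
      s * ht c d x - s * ht v k x ≤ s * e.2 - s * ht v k e.1 ∧ s * ht v k e.1 < s * e.2 := by
    intro e he h1 h2 h3 h4 h5 h6
    have hφ := φ x e.1
    rw [h5] at hφ
    refine ⟨e, he, h1, h2, ?_, by linarith, ?_⟩
    · rcases hord e.1 h3 h4 h1.le (h2.le.trans hka.le) with h | ⟨_, h | h⟩
      · rwa [h5] at h
      · rw [← h.2, ← h.1] at h1; exact absurd h1 (lt_irrefl _)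
      · rw [← h.2, ← h.1] at hka; linarith
    · refine lt_of_le_of_ne (by linarith) ?_
      exact hG.nocol_sign hs hv hk he hvk (by rintro rfl; exact lt_irrefl _ h1)
        (by rintro rfl; exact lt_irrefl _ h2)
  rcases le_or_gt 0 μ with h0 | h0
  -- Follow cd to the right. If it reached past k, it would separate k from va, although va is the
  -- first edge of k. If it ended at k, the gap would be constantly zero, and general position would
  -- give c = v.
  · have hdk : d.1 < k.1 := by
      by_contra hkd
      push Not at hkd
      have h1 := φ x k.1
      rw [ht_right hvk] at h1
      have h1' : 0 ≤ μ * (k.1 - x) := mul_nonneg h0 (by linarith)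
      have h2 : s * ht c d k.1 < s * ht v a k.1 := by
        rcases hord k.1 (by linarith) hkd hvk.le hka.le with h | ⟨_, h | h⟩
        · exact h
        · linarith [h.1]
        · rw [← h.2, ← h.1] at hka; exact absurd hka (lt_irrefl _)
      have h3 : s * k.2 ≤ s * ht c d k.1 := by linarith
      rcases eq_or_lt_of_le hkd with hkd | hkd
      · have hdk : d = k := hG.xinj _ hd _ hk hkd.symm
        subst hdk
        rw [ht_right hcd'] at h1
        have hμ0 : μ * (d.1 - x) = 0 := by linarith
        have hμ0 : μ = 0 := by
          rcases mul_eq_zero.1 hμ0 with h | h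
          · exact h
          · linarith
        have h4 := φ x c.1
        rw [ht_left, hμ0] at h4
        have h5 : c = v := by
          by_contra hcv
          refine hG.nocol_sign hs hv hk hc hvk hcv ?_ (z := c) ?_
          · rintro rfl; exact lt_irrefl _ hcd'
          · linarith
        exact hne ⟨h5, rfl⟩
      · rcases eq_or_lt_of_le h3 with h3 | h3
        · exact hG.nocol_sign hs hc hd hk hcd' (by rintro rfl; linarith)
            (by rintro rfl; exact lt_irrefl _ hkd) h3.symm
        · linarith [hmin c d hcd (by linarith) hkd h3]
    exact finish d hd (by linarith) hdk hcd'.le le_rfl (ht_right hcd')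
      (mul_nonneg h0 (by linarith))
  -- Here the gap grows to the left. If cd extended as far as v, it would be strictly beyond v
  -- there, hence beyond va, which it cannot cross.
  · have hcv : v.1 < c.1 := by
      by_contra hcv
      push Not at hcv
      have h1 := φ x v.1
      rw [ht_left] at h1
      have h2 : 0 < μ * (v.1 - x) := mul_pos_of_neg_of_neg h0 (by linarith)
      have h3 := hord v.1 hcv (by linarith) le_rfl hva'.le
      rw [ht_left] at h3
      rcases h3 with h | ⟨h, _⟩ <;> linarith
    exact finish c hc hcv (by linarith) le_rfl hcd'.le (ht_left _ _)
      (mul_nonneg_of_nonpos_of_nonpos h0.le (by linarith))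

/-- No edge other than `vk` has a point that is weakly above the segment `vk` and strictly below
`va` (for `s = 1`; upside down for `s = -1`). -/
def _root_.ClearLeft (s : ℝ) (G : SimpleGraph Pt) (v k a : Pt) : Prop :=
  ∀ c d, G.Adj c d → c.1 < d.1 → ∀ x, c.1 ≤ x → x ≤ d.1 → v.1 < x → x < k.1 →
    s * ht v k x ≤ s * ht c d x → s * ht c d x < s * ht v a x → c = v ∧ d = k

/-- Among the vertices with first edge va, take k extreme in slope as seen from v. If an edge
intrudes, the triangle contains a vertex; let n be the one farthest from the line vk. An edge
between n and va would produce a still farther vertex by `exists_vertex_of_edge`, so va is also the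
first edge of n, against the choice of k. -/
lemma exists_clearLeft (hG : Plane V G) {s : ℝ} (hs : s = 1 ∨ s = -1) {v a m₀ : Pt}
    (hm₀ : m₀ ∈ V) (h₀ : First s G m₀ v a) :
    ∃ k ∈ V, First s G k v a ∧ ClearLeft s G v k a ∧
      ∀ m ∈ V, First s G m v a → m ≠ k → s * m.2 < s * ht v k m.1 := by
  classical
  obtain ⟨hv, ha⟩ := hG.supp _ _ h₀.1
  obtain ⟨k, hk, hmax⟩ := (V.filter (fun m => First s G m v a)).exists_max_image
    (fun m => s * sl v m) ⟨m₀, by simp [hm₀, h₀]⟩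
  simp only [Finset.mem_filter] at hk hmax
  obtain ⟨hk, hF⟩ := hk
  have hvk := hF.2.1
  have hlow : ∀ m ∈ V, First s G m v a → m ≠ k → s * m.2 < s * ht v k m.1 := by
    intro m hm hm' hne
    refine lt_of_le_of_ne ?_ (hG.nocol_sign hs hv hk hm hvk ?_ hne).symm
    · have h1 := hmax m ⟨hm, hm'⟩
      have h2 := ht_eq_sl v m m.1
      rw [ht_right hm'.2.1] at h2
      rw [h2, ht_eq_sl]
      nlinarith [hm'.2.1]
    · rintro rfl; exact lt_irrefl _ hm'.2.1
  refine ⟨k, hk, hF, ?_, hlow⟩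
  intro c d hcd hcd' x h1 h2 h3 h4 h5 h6
  by_contra hne
  obtain ⟨e₀, he₀, f1, f2, f3, -, f5⟩ :=
    hG.exists_vertex_of_edge hs hk hF hcd hne h1 h2 hcd' h3 h4 h5 h6
  obtain ⟨n, hn, hnmax⟩ := (V.filter (fun e => v.1 < e.1 ∧ e.1 < k.1 ∧
    s * e.2 < s * ht v a e.1 ∧ s * ht v k e.1 < s * e.2)).exists_max_image
    (fun e => s * e.2 - s * ht v k e.1) ⟨e₀, by simp [he₀, f1, f2, f3, f5]⟩
  simp only [Finset.mem_filter] at hn hnmax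
  obtain ⟨hn, n1, n2, n3, n4⟩ := hn
  have hnF : First s G n v a := by
    refine ⟨hF.1, n1, n2.trans hF.2.2.1, n3, ?_⟩
    intro c' d' hcd1 g1 g2 g3
    by_contra g4
    push Not at g4
    obtain ⟨e, he, e1, e2, e3, e4, e5⟩ := hG.exists_vertex_of_edge hs hk hF hcd1
      (by rintro ⟨rfl, rfl⟩; linarith) g1.le g2.le (g1.trans g2) n1 n2 (by linarith) g4
    have := hnmax e ⟨he, e1, e2, e3, e5⟩
    linarith
  have := hlow n hn hnF (by rintro rfl; exact lt_irrefl _ n2)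
  linarith

end Plane

/-! ### Reflection in a vertical line -/

/-- The reflection in the `y`-axis. -/
def flipX (z : Pt) : Pt := (-z.1, z.2)

lemma flipX_flipX (z : Pt) : flipX (flipX z) = z := by simp [flipX]

lemma ht_comm {a b : Pt} (h : a.1 ≠ b.1) (x : ℝ) : ht a b x = ht b a x := by
  have h1 : b.1 - a.1 ≠ 0 := sub_ne_zero.2 h.symm
  have h2 : a.1 - b.1 ≠ 0 := sub_ne_zero.2 h
  simp only [ht]
  field_simp
  ring

lemma ht_flipX (a b : Pt) (x : ℝ) : ht (flipX a) (flipX b) x = ht a b (-x) := by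
  simp only [ht, flipX]
  have : -b.1 - -a.1 = -(b.1 - a.1) := by ring
  rw [this, div_neg]
  ring

lemma mem_image_flipX {V : Finset Pt} {z : Pt} : z ∈ V.image flipX ↔ flipX z ∈ V := by
  simp only [Finset.mem_image]
  constructor
  · rintro ⟨w, hw, rfl⟩; rwa [flipX_flipX]
  · intro h; exact ⟨_, h, flipX_flipX z⟩

namespace Plane

variable {V : Finset Pt} {G : SimpleGraph Pt}

lemma flip (hG : Plane V G) : Plane (V.image flipX) (G.comap flipX) where
  xinj a ha b hb h := by
    rw [mem_image_flipX] at ha hb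
    have := hG.xinj _ ha _ hb (by simpa [flipX] using h)
    rw [← flipX_flipX a, this, flipX_flipX]
  nocol a ha b hb z hz h h1 h2 := by
    rw [mem_image_flipX] at ha hb hz
    have := hG.nocol _ hb _ ha _ hz (by simpa [flipX] using h)
      (fun h' => h2 (by rw [← flipX_flipX z, h', flipX_flipX]))
      (fun h' => h1 (by rw [← flipX_flipX z, h', flipX_flipX]))
    rw [ht_flipX, ← ht_comm (by simpa [flipX] using h.ne)] at this
    simpa [flipX] using this
  supp a b h := by
    rw [mem_image_flipX, mem_image_flipX]
    exact hG.supp _ _ h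
  nc a b c d hab hcd hne x h1 h2 h3 h4 := by
    have hab' : a.1 < b.1 := h1.trans h2
    have hcd' : c.1 < d.1 := h3.trans h4
    have := hG.nc _ _ _ _ (hab : G.Adj _ _).symm (hcd : G.Adj _ _).symm (by
      intro h
      simp only [Prod.mk.injEq] at h
      apply hne
      rw [← flipX_flipX a, ← flipX_flipX b, h.1, h.2, flipX_flipX, flipX_flipX]) (-x)
      (by simpa [flipX] using h2) (by simpa [flipX] using h1)
      (by simpa [flipX] using h4) (by simpa [flipX] using h3)
    rw [ht_flipX, ht_flipX, ← ht_comm hab'.ne, ← ht_comm hcd'.ne] at this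
    simpa using this

lemma first_flip {s : ℝ} {m a b : Pt} (h : First s G m a b) :
    First s (G.comap flipX) (flipX m) (flipX b) (flipX a) := by
  obtain ⟨h1, h2, h3, h4, h5⟩ := h
  refine ⟨by simpa [flipX_flipX] using h1.symm, by simpa [flipX] using h3,
    by simpa [flipX] using h2, ?_, ?_⟩
  · rw [ht_flipX, ← ht_comm (h2.trans h3).ne]
    simpa [flipX] using h4
  · intro c d hcd g1 g2 g3
    have hcd' := g1.trans g2
    have := h5 (flipX d) (flipX c) (hcd : G.Adj _ _).symm
      (by simp only [flipX] at g2 ⊢; linarith) (by simp only [flipX] at g1 ⊢; linarith)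
    rw [ht_flipX, ← ht_comm (h2.trans h3).ne]
    rw [ht_flipX, ← ht_comm hcd'.ne] at this
    simpa [flipX] using this (by simpa [flipX] using g3)

lemma first_flip_iff {s : ℝ} {m a b : Pt} :
    First s (G.comap flipX) (flipX m) (flipX b) (flipX a) ↔ First s G m a b := by
  refine ⟨fun h => ?_, first_flip⟩
  have := first_flip h
  have e : (G.comap flipX).comap flipX = G := by
    ext x y; simp [flipX_flipX]
  rwa [e, flipX_flipX, flipX_flipX, flipX_flipX] at this

/-- The mirror image of `ClearLeft`. -/
def _root_.ClearRight (s : ℝ) (G : SimpleGraph Pt) (v k a : Pt) : Prop :=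
  ∀ c d, G.Adj c d → c.1 < d.1 → ∀ x, c.1 ≤ x → x ≤ d.1 → k.1 < x → x < a.1 →
    s * ht k a x ≤ s * ht c d x → s * ht c d x < s * ht v a x → c = k ∧ d = a

lemma exists_clearRight (hG : Plane V G) {s : ℝ} (hs : s = 1 ∨ s = -1) {v a m₀ : Pt}
    (hm₀ : m₀ ∈ V) (h₀ : First s G m₀ v a) :
    ∃ k ∈ V, First s G k v a ∧ ClearRight s G v k a ∧
      ∀ m ∈ V, First s G m v a → m ≠ k → s * m.2 < s * ht k a m.1 := by
  obtain ⟨k, hk, h1, h2, h3⟩ := hG.flip.exists_clearLeft hs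
    (mem_image_flipX.2 (by rwa [flipX_flipX])) (first_flip h₀)
  obtain ⟨k, rfl⟩ : ∃ k', k = flipX k' := ⟨flipX k, (flipX_flipX k).symm⟩
  rw [mem_image_flipX, flipX_flipX] at hk
  have hF := first_flip_iff.1 h1
  refine ⟨k, hk, hF, ?_, ?_⟩
  · intro c d hcd hcd' x g1 g2 g3 g4 g5 g6
    have := h2 (flipX d) (flipX c) (by simpa [flipX_flipX] using hcd.symm)
      (by simpa [flipX] using hcd') (-x) (by simpa [flipX] using g2) (by simpa [flipX] using g1)
      (by simpa [flipX] using g4) (by simpa [flipX] using g3)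
    rw [ht_flipX, ht_flipX, ht_flipX, neg_neg, ← ht_comm hcd'.ne, ← ht_comm hF.2.2.1.ne,
      ← ht_comm (hF.2.1.trans hF.2.2.1).ne] at this
    obtain ⟨e1, e2⟩ := this g5 g6
    exact ⟨by rw [← flipX_flipX c, e2, flipX_flipX], by rw [← flipX_flipX d, e1, flipX_flipX]⟩
  · intro m hm hm' hne
    have := h3 (flipX m) (mem_image_flipX.2 (by rwa [flipX_flipX])) (first_flip hm')
      (fun h => hne (by rw [← flipX_flipX m, h, flipX_flipX]))
    rw [ht_flipX, ← ht_comm hF.2.2.1.ne] at this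
    simpa [flipX] using this

end Plane

/-! ### Maximal graphs between two chains -/

/-- The sign of a side: `1` for above, `-1` for below. -/
def sg (s : Bool) : ℝ := if s then 1 else -1

lemma sg_eq (s : Bool) : sg s = 1 ∨ sg s = -1 := by cases s <;> simp [sg]

lemma sg_not (s : Bool) : sg (!s) = - sg s := by cases s <;> simp [sg]

/-- The edges of `G` within `S`, directed from left to right. -/
noncomputable def edgesIn (S : Finset Pt) (G : SimpleGraph Pt) : Finset (Pt × Pt) := by
  classical exact (S ×ˢ S).filter (fun e => G.Adj e.1 e.2 ∧ e.1.1 < e.2.1)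

lemma mem_edgesIn {S : Finset Pt} {G : SimpleGraph Pt} {e : Pt × Pt} :
    e ∈ edgesIn S G ↔ e.1 ∈ S ∧ e.2 ∈ S ∧ G.Adj e.1 e.2 ∧ e.1.1 < e.2.1 := by
  classical
  simp [edgesIn, and_assoc]

/-- `(x, y)` is weakly below the chain `W true` and weakly above the chain `W false`. -/
def BetweenChains (W : Bool → ℕ → Pt) (N : Bool → ℕ) (x y : ℝ) : Prop :=
  ∀ s, ∀ n < N s, (W s n).1 ≤ x → x ≤ (W s (n + 1)).1 →
    sg s * y ≤ sg s * ht (W s n) (W s (n + 1)) x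

/-- `G` is a plane graph that contains an upper and a lower `x`-monotone chain with common ends,
lies between them, and is maximal with these properties. -/
structure ChainBounded (X : Finset Pt) (G : SimpleGraph Pt) (W : Bool → ℕ → Pt) (N : Bool → ℕ) :
    Prop where
  plane : Plane X G
  pos : ∀ s, 0 < N s
  adj : ∀ s, ∀ n < N s, G.Adj (W s n) (W s (n + 1))
  lt : ∀ s, ∀ n < N s, (W s n).1 < (W s (n + 1)).1
  left : ∀ s, ∀ m ∈ X, (W s 0).1 ≤ m.1
  right : ∀ s, ∀ m ∈ X, m.1 ≤ (W s (N s)).1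
  verts : ∀ m ∈ X, BetweenChains W N m.1 m.2
  edges : ∀ c d, G.Adj c d → ∀ x, c.1 ≤ x → x ≤ d.1 → BetweenChains W N x (ht c d x)
  max : ∀ v ∈ X, ∀ k ∈ X, v.1 < k.1 →
    (∀ c d, G.Adj c d → ∀ x, c.1 < x → x < d.1 → v.1 < x → x < k.1 → ht c d x = ht v k x →
      c = v ∧ d = k) →
    (∀ x, v.1 < x → x < k.1 → BetweenChains W N x (ht v k x)) → G.Adj v k

/-- A discrete intermediate value theorem. -/
lemma exists_step {f : ℕ → ℝ} {N : ℕ} (hN : 0 < N) {x : ℝ} (h0 : f 0 ≤ x) (h1 : x ≤ f N) :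
    ∃ n < N, f n ≤ x ∧ x ≤ f (n + 1) := by
  induction N with
  | zero => omega
  | succ N ih =>
    by_cases h : f N ≤ x
    · exact ⟨N, by omega, h, h1⟩
    · rcases Nat.eq_zero_or_pos N with rfl | hN
      · exact absurd h0 h
      · obtain ⟨n, hn, h2⟩ := ih hN (not_le.1 h).le
        exact ⟨n, by omega, h2⟩

namespace ChainBounded

variable {X : Finset Pt} {G : SimpleGraph Pt} {W : Bool → ℕ → Pt} {N : Bool → ℕ}

/-- The vertices of a chain. -/
noncomputable def _root_.chainVerts (W : Bool → ℕ → Pt) (N : Bool → ℕ) (s : Bool) : Finset Pt := by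
  classical exact (Finset.range (N s + 1)).image (W s)

lemma _root_.mem_chainVerts {s : Bool} {z : Pt} :
    z ∈ chainVerts W N s ↔ ∃ n ≤ N s, W s n = z := by
  classical
  simp [chainVerts]

lemma _root_.card_chainVerts_le (s : Bool) : (chainVerts W N s).card ≤ N s + 1 := by
  classical
  simpa [chainVerts] using Finset.card_image_le (s := Finset.range (N s + 1)) (f := W s)

lemma sl_injective_right (hG : Plane X G) {v a b : Pt} (hv : v ∈ X) (ha : a ∈ X) (hb : b ∈ X)
    (hva : v.1 < a.1) (hvb : v.1 < b.1) (h : sl v a = sl v b) : a = b := by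
  by_contra hne
  refine hG.nocol _ hv _ hb _ ha hvb (by rintro rfl; exact lt_irrefl _ hva) hne ?_
  rw [ht_eq_sl, ← h, ← ht_eq_sl, ht_right hva]

lemma exists_first (h : ChainBounded X G W N) {s : Bool} {m : Pt} (hm : m ∈ X)
    (hm' : m ∉ chainVerts W N s) : ∃ a b, First (sg s) G m a b := by
  obtain ⟨n, hn, h1, h2⟩ := exists_step (f := fun n => (W s n).1) (h.pos s) (h.left s m hm)
    (h.right s m hm)
  have e1 : m ≠ W s n := fun e => hm' (mem_chainVerts.2 ⟨n, hn.le, e.symm⟩)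
  have e2 : m ≠ W s (n + 1) := fun e => hm' (mem_chainVerts.2 ⟨n + 1, hn, e.symm⟩)
  have hadj := h.adj s n hn
  obtain ⟨ha, hb⟩ := h.plane.supp _ _ hadj
  refine h.plane.exists_first hadj (lt_of_le_of_ne h1 fun e => e1 (h.plane.xinj _ hm _ ha e.symm))
    (lt_of_le_of_ne h2 fun e => e2 (h.plane.xinj _ hm _ hb e)) ?_
  refine lt_of_le_of_ne (h.verts m hm s n hn h1 h2) ?_
  exact (h.plane.nocol_sign (sg_eq s) ha hb hm (h.lt s n hn) e1 e2).symm

/-- A segment below the first edge `va` of `k` that is not crossed and has no edge between itself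
and `va` belongs to the graph. -/
lemma adj_of_clear (h : ChainBounded X G W N) {s : Bool} {k v a p q : Pt} (hk : k ∈ X)
    (hF : First (sg s) G k v a) (hp : p ∈ X) (hq : q ∈ X) (hvp : v.1 ≤ p.1) (hpq : p.1 < q.1)
    (hqa : q.1 ≤ a.1)
    (hclear : ∀ c d, G.Adj c d → c.1 < d.1 → ∀ x, c.1 ≤ x → x ≤ d.1 → p.1 < x → x < q.1 →
      sg s * ht p q x ≤ sg s * ht c d x → sg s * ht c d x < sg s * ht v a x → c = p ∧ d = q)
    (hbelow : ∀ x, p.1 < x → x < q.1 → sg s * ht p q x < sg s * ht v a x) : G.Adj p q := by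
  have hva := hF.1
  obtain ⟨hv, ha⟩ := h.plane.supp _ _ hva
  have hva' : v.1 < a.1 := hF.2.1.trans hF.2.2.1
  refine h.max p hp q hq hpq ?_ ?_
  · intro c d hcd x h1 h2 h3 h4 heq
    exact hclear c d hcd (h1.trans h2) x h1.le h2.le h3 h4 (by rw [heq])
      (by rw [heq]; exact hbelow x h3 h4)
  · intro x h3 h4 s' n hn g1 g2
    have hreg := h.edges v a hva x (by linarith) (by linarith) s' n hn g1 g2
    have hb := hbelow x h3 h4
    by_cases hs : s' = s
    · subst hs; linarith
    -- On the opposite chain: if pq left the strip at x, a chain edge would lie between pq and va,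
    -- which `hclear` excludes. If the chain edge is va itself, then k is on the wrong side of the
    -- chain.
    · have hs : s' = !s := by cases s <;> cases s' <;> simp_all
      subst hs
      rw [sg_not] at hreg ⊢
      by_contra hlt
      have hadj := h.adj _ n hn
      have hlt' := h.lt _ n hn
      obtain ⟨hc, hd⟩ := h.plane.supp _ _ hadj
      rcases eq_or_lt_of_le hreg with heq | hreg
      · have heq' : ht v a x = ht (W (!s) n) (W (!s) (n + 1)) x :=
          mul_left_cancel₀ (Plane.sign_ne (sg_eq s)) (by linarith)
        rcases eq_or_lt_of_le g1 with e | g1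
        · rw [← e, ht_left] at heq'
          exact h.plane.nocol _ hv _ ha _ hc hva' (by rintro e'; rw [e'] at e; linarith)
            (by rintro e'; rw [e'] at e; linarith) heq'
        · rcases eq_or_lt_of_le g2 with e | g2
          · rw [e, ht_right hlt'] at heq'
            exact h.plane.nocol _ hv _ ha _ hd hva' (by rintro e'; rw [e'] at e; linarith)
              (by rintro e'; rw [e'] at e; linarith) heq'
          · have : (v, a) = (W (!s) n, W (!s) (n + 1)) := by
              by_contra hne
              exact h.plane.nc _ _ _ _ hva hadj hne x (by linarith) (by linarith) g1 g2 heq'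
            obtain ⟨i1, i2⟩ := Prod.mk.inj this
            have := h.verts k hk (!s) n hn (by rw [← i1]; exact hF.2.1.le)
              (by rw [← i2]; exact hF.2.2.1.le)
            rw [← i1, ← i2, sg_not] at this
            linarith [hF.2.2.2.1]
      · have := hclear _ _ hadj hlt' x g1 g2 h3 h4 (by linarith) (by linarith)
        rw [this.1, this.2] at hlt
        exact hlt le_rfl

lemma _root_.sl_sign_lt {s : ℝ} {v m a : Pt} (hvm : v.1 < m.1)
    (h : s * m.2 < s * ht v a m.1) : s * sl v m < s * sl v a := by
  rw [ht_eq_sl] at h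
  have h2 := ht_eq_sl v m m.1
  rw [ht_right hvm] at h2
  rw [h2] at h
  by_contra h'
  push Not at h'
  nlinarith

lemma _root_.ht_sign_lt_left {s : ℝ} {v m a : Pt} (hvm : v.1 < m.1)
    (h : s * m.2 < s * ht v a m.1) {x : ℝ} (hx : v.1 < x) : s * ht v m x < s * ht v a x := by
  have := sl_sign_lt hvm h
  rw [ht_eq_sl, ht_eq_sl]
  nlinarith

lemma _root_.ht_sign_lt_right {s : ℝ} {v m a : Pt} (hvm : v.1 < m.1) (hma : m.1 < a.1)
    (h : s * m.2 < s * ht v a m.1) {x : ℝ} (hx : x < a.1) : s * ht m a x < s * ht v a x := by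
  have h1 := ht_sub_affine m a v a m.1 a.1
  have h2 := ht_sub_affine m a v a m.1 x
  rw [ht_left, ht_right hma, ht_right (hvm.trans hma)] at h1
  rw [ht_left] at h2
  have h3 : 0 < (a.1 - m.1) := by linarith
  have h4 : s * (m.2 - ht v a m.1) < 0 := by linarith
  have h5 : (sl m a - sl v a) * (a.1 - m.1) = -(m.2 - ht v a m.1) := by linarith
  have h6 : (a.1 - m.1) * (ht m a x - ht v a x) = (m.2 - ht v a m.1) * (a.1 - x) := by
    rw [h2]; linear_combination (x - m.1) * h5
  have h7 : (a.1 - m.1) * (s * (ht m a x - ht v a x)) < 0 := by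
    have : (a.1 - m.1) * (s * (ht m a x - ht v a x)) = (s * (m.2 - ht v a m.1)) * (a.1 - x) := by
      linear_combination s * h6
    rw [this]
    exact mul_neg_of_neg_of_pos h4 (by linarith)
  have := neg_of_mul_neg_right h7 h3.le
  linarith

/-- In a maximal graph, a vertex and its first edge span a face. -/
lemma triangle (h : ChainBounded X G W N) {s : Bool} {m v a : Pt} (hm : m ∈ X)
    (hF : First (sg s) G m v a) : G.Adj v m ∧ G.Adj m a ∧ ClearLeft (sg s) G v m a ∧
      ∀ m' ∈ X, First (sg s) G m' v a → m' = m := by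
  obtain ⟨hv, ha⟩ := h.plane.supp _ _ hF.1
  -- The vertex k is extreme as seen from v and l as seen from a. Their clear sides vk and la are
  -- edges by maximality; the crux is that k = l.
  obtain ⟨k, hk, hkF, hkc, hkm⟩ := h.plane.exists_clearLeft (sg_eq s) hm hF
  obtain ⟨l, hl, hlF, hlc, hlm⟩ := h.plane.exists_clearRight (sg_eq s) hm hF
  have hvk : G.Adj v k := h.adj_of_clear hk hkF hv hk le_rfl hkF.2.1 hkF.2.2.1.le hkc
    (fun x h1 _ => ht_sign_lt_left hkF.2.1 hkF.2.2.2.1 h1)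
  have hla : G.Adj l a := h.adj_of_clear hl hlF hl ha hlF.2.1.le hlF.2.2.1 le_rfl hlc
    (fun x _ h2 => ht_sign_lt_right hlF.2.1 hlF.2.2.1 hlF.2.2.2.1 h2)
  have hlk : l = k := by
    by_contra hne
    have h1 := hkm l hl hlF hne
    have h2 := hlm k hk hkF (Ne.symm hne)
    rcases lt_trichotomy l.1 k.1 with hlt | heq | hgt
    -- With l left of k, the edge vk separates l from va, although va is the first edge of l.
    · have h3 := hlF.2.2.2.2 v k hvk hlF.2.1 hlt h1
      have h4 := ht_sign_lt_left hkF.2.1 hkF.2.2.2.1 hlF.2.1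
      linarith
    · exact hne (h.plane.xinj _ hl _ hk heq)
    · have h3 := sl_sign_lt hlF.2.1 h1
      have h4 := hkF.2.2.2.1
      have h5 := ht_sign_lt_left hlF.2.1 h1 (x := k.1) hkF.2.1
      rw [ht_right hkF.2.1] at h5
      have h6 := hkF.2.2.2.2 l a hla
      -- four points in concave position cannot lie below the segment `va`
      have e1 := ht_eq_add l a l.1 k.1
      rw [ht_left] at e1
      have e2 := ht_eq_add l a l.1 v.1
      rw [ht_left] at e2
      have e3 : ht v k l.1 = _ := ht_eq_add v k k.1 l.1
      rw [ht_right hkF.2.1] at e3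
      have e4 : ht v k v.1 = _ := ht_eq_add v k k.1 v.1
      rw [ht_right hkF.2.1, ht_left] at e4
      have e5 := sl_sign_lt hlF.2.1 hlF.2.2.2.1
      have e6 := ht_sign_lt_right hlF.2.1 hlF.2.2.1 hlF.2.2.2.1 (x := v.1)
        (by linarith [hlF.2.1, hlF.2.2.1])
      rw [ht_left] at e6
      rw [e3] at h1
      rw [e1] at h2
      rw [e2] at e6
      have h7 : 0 < (l.1 - k.1) * (sg s * sl v k - sg s * sl l a) := by nlinarith
      have h8 : 0 < sg s * sl v k - sg s * sl l a := pos_of_mul_pos_right h7 (by linarith)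
      have h9 : 0 < (k.1 - v.1) * (sg s * sl v k - sg s * sl l a) :=
        mul_pos (by linarith [hkF.2.1]) h8
      have h10 := congrArg (sg s * ·) e4
      beta_reduce at h10
      linarith
  subst hlk
  -- Any other vertex with first edge va would be separated from va by one of the edges vl and la.
  have huniq : ∀ m' ∈ X, First (sg s) G m' v a → m' = l := by
    intro m' hm' hF'
    by_contra hne
    have h1 := hkm m' hm' hF' hne
    have h2 := hlm m' hm' hF' hne
    rcases lt_trichotomy m'.1 l.1 with hlt | heq | hgt
    · have h3 := hF'.2.2.2.2 v l hvk hF'.2.1 hlt h1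
      linarith [ht_sign_lt_left hkF.2.1 hkF.2.2.2.1 hF'.2.1]
    · exact hne (h.plane.xinj _ hm' _ hl heq)
    · have h3 := hF'.2.2.2.2 l a hla hgt hF'.2.2.1 h2
      linarith [ht_sign_lt_right hkF.2.1 hkF.2.2.1 hkF.2.2.2.1 hF'.2.2.1]
  obtain rfl := huniq m hm hF
  exact ⟨hvk, hla, hkc, huniq⟩


/-! ### Counting the edges of a maximal graph between two chains -/

/-- Off the upper chain, the triangle under the first edge supplies an edge to the right. -/
lemma exists_east (h : ChainBounded X G W N) {v : Pt} (hv : v ∈ X)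
    (hr : v ≠ W true (N true)) : ∃ b, G.Adj v b ∧ v.1 < b.1 := by
  by_cases hc : v ∈ chainVerts W N true
  · obtain ⟨n, hn, rfl⟩ := mem_chainVerts.1 hc
    have hn : n < N true := lt_of_le_of_ne hn (by rintro rfl; exact hr rfl)
    exact ⟨_, h.adj _ n hn, h.lt _ n hn⟩
  · obtain ⟨a, b, hF⟩ := h.exists_first hv hc
    exact ⟨b, (h.triangle hv hF).2.1, hF.2.2.1⟩

/-- There is no edge at `v` between the edges to a vertex and to the end of its first edge. -/
lemma sl_le_of_first (h : ChainBounded X G W N) {s : Bool} {m v a y : Pt} (hm : m ∈ X)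
    (hF : First (sg s) G m v a) (hy : G.Adj v y) (hvy : v.1 < y.1)
    (h1 : sg s * sl v y < sg s * sl v a) : sg s * sl v y ≤ sg s * sl v m := by
  by_contra h2
  push Not at h2
  have hvm := hF.2.1
  -- Any abscissa just right of v would do: there the edges at v are ordered by slope, so vy would
  -- run inside the face spanned by m and va.
  have hx1 : v.1 < (v.1 + min m.1 y.1) / 2 := by
    have := lt_min hvm hvy; linarith
  have hx2 : (v.1 + min m.1 y.1) / 2 < m.1 := by
    have := min_le_left m.1 y.1
    have := lt_min hvm hvy; linarith
  have hx3 : (v.1 + min m.1 y.1) / 2 < y.1 := by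
    have := min_le_right m.1 y.1
    have := lt_min hvm hvy; linarith
  have := (h.triangle hm hF).2.2.1 v y hy hvy _ hx1.le hx3.le hx1 hx2
    (by rw [ht_eq_sl, ht_eq_sl]; nlinarith) (by rw [ht_eq_sl, ht_eq_sl]; nlinarith)
  rw [this.2] at h2
  exact lt_irrefl _ h2

/-- A maximal graph between two chains has at least as many edges as Euler's formula predicts. -/
theorem card_le (h : ChainBounded X G W N) :
    3 * X.card ≤ (edgesIn X G).card + N true + N false + 3 := by
  classical
  set r := W true (N true) with hr
  have hlow : ∀ v, ∃ b, v ∈ X.erase r → G.Adj v b ∧ v.1 < b.1 ∧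
      ∀ c, G.Adj v c → v.1 < c.1 → sl v b ≤ sl v c := by
    intro v
    by_cases hv : v ∈ X.erase r
    · rw [Finset.mem_erase] at hv
      obtain ⟨b, hb, hb'⟩ := h.exists_east hv.2 hv.1
      obtain ⟨c, hc, hmin⟩ := (X.filter (fun c => G.Adj v c ∧ v.1 < c.1)).exists_min_image
        (fun c => sl v c) ⟨b, by simp [hb, hb', (h.plane.supp _ _ hb).2]⟩
      simp only [Finset.mem_filter] at hc hmin
      exact ⟨c, fun _ => ⟨hc.2.1, hc.2.2, fun d hd hd' =>
        hmin d ⟨(h.plane.supp _ _ hd).2, hd, hd'⟩⟩⟩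
    · exact ⟨v, fun h => absurd h hv⟩
  choose low hlow using hlow
  have hfirst : ∀ (s : Bool) m, ∃ e : Pt × Pt, m ∈ X \ chainVerts W N s →
      First (sg s) G m e.1 e.2 := by
    intro s m
    by_cases hm : m ∈ X \ chainVerts W N s
    · have hm' := Finset.mem_sdiff.1 hm
      obtain ⟨a, b, hF⟩ := h.exists_first hm'.1 hm'.2
      exact ⟨(a, b), fun _ => hF⟩
    · exact ⟨(m, m), fun h => absurd h hm⟩
  choose fe hfe using hfirst
  -- Three disjoint families of edges: the lowest edge to the right at every vertex but the last;
  -- the first edge above each vertex off the upper chain; and, for each m off the lower chain, the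
  -- edge to m from the left end of the first edge below m.
  set I0 := (X.erase r).image (fun v => (v, low v)) with hI0
  set I1 := (X \ chainVerts W N true).image (fe true) with hI1
  set I2 := (X \ chainVerts W N false).image (fun m => ((fe false m).1, m)) with hI2
  have hX : ∀ s m, m ∈ X \ chainVerts W N s → m ∈ X := fun s m hm => (Finset.mem_sdiff.1 hm).1
  have c0 : I0.card = (X.erase r).card :=
    Finset.card_image_of_injective _ (fun a b hab => (Prod.mk.inj hab).1)
  have c1 : I1.card = (X \ chainVerts W N true).card := by
    apply Finset.card_image_of_injOn
    intro m hm m' hm' he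
    rw [Finset.mem_coe] at hm hm'
    have f1 := hfe true m hm
    have f2 := hfe true m' hm'
    rw [← he] at f2
    exact ((h.triangle (hX _ _ hm) f1).2.2.2 m' (hX _ _ hm') f2).symm
  have c2 : I2.card = (X \ chainVerts W N false).card :=
    Finset.card_image_of_injective _ (fun a b hab => (Prod.mk.inj hab).2)
  -- The first edge va above m is not lowest at v, because vm is an edge below it.
  have d01 : Disjoint I0 I1 := by
    rw [Finset.disjoint_left]
    rintro e he0 he1
    obtain ⟨v, hv, rfl⟩ := Finset.mem_image.1 he0
    obtain ⟨m, hm, he⟩ := Finset.mem_image.1 he1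
    have f1 := hfe true m hm
    rw [he] at f1
    have t := h.triangle (hX _ _ hm) f1
    have := (hlow v hv).2.2 m t.1 f1.2.1
    have h2 := sl_sign_lt f1.2.1 f1.2.2.2.1
    simp only [sg, if_true, one_mul] at h2
    linarith
  have d02 : Disjoint I0 I2 := by
    rw [Finset.disjoint_left]
    rintro e he0 he1
    obtain ⟨v, hv, rfl⟩ := Finset.mem_image.1 he0
    obtain ⟨m, hm, he⟩ := Finset.mem_image.1 he1
    have f1 := hfe false m hm
    obtain ⟨e1, e2⟩ := Prod.mk.inj he
    rw [e1] at f1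
    have := (hlow v hv).2.2 _ f1.1 (f1.2.1.trans f1.2.2.1)
    have h2 := sl_sign_lt f1.2.1 f1.2.2.2.1
    rw [← e2] at this
    simp only [sg] at h2
    norm_num at h2
    linarith
  -- Suppose vm' is the first edge above m and vb is the first edge below m'. Neither vb nor vm can
  -- lie strictly between the other and vm', so b = m. But m is left of m' and m' is left of b.
  have d12 : Disjoint I1 I2 := by
    rw [Finset.disjoint_left]
    rintro e he0 he1
    obtain ⟨m, hm, rfl⟩ := Finset.mem_image.1 he0
    obtain ⟨m', hm', he⟩ := Finset.mem_image.1 he1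
    have f1 := hfe true m hm
    have f2 := hfe false m' hm'
    have e1 : (fe false m').1 = (fe true m).1 := (Prod.ext_iff.1 he).1
    have e2 : m' = (fe true m).2 := (Prod.ext_iff.1 he).2
    rw [e1] at f2
    rw [← e2] at f1
    set v := (fe true m).1
    set b := (fe false m').2
    have t1 := h.triangle (hX _ _ hm) f1
    have i1 := h.sl_le_of_first (hX _ _ hm) f1 f2.1 (f2.2.1.trans f2.2.2.1) (by
      have := sl_sign_lt f2.2.1 f2.2.2.2.1
      simp only [sg] at this ⊢
      norm_num at this ⊢
      exact this)
    have i2 := h.sl_le_of_first (hX _ _ hm') f2 t1.1 f1.2.1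
    have i3 := sl_sign_lt f1.2.1 f1.2.2.2.1
    simp only [sg] at i1 i2 i3
    norm_num at i1 i2 i3
    have i4 : sl v b = sl v m := by
      refine le_antisymm i1 ?_
      by_contra hlt
      linarith [i2 (not_le.1 hlt)]
    have hv := (h.plane.supp _ _ f1.1).1
    have := sl_injective_right h.plane hv (h.plane.supp _ _ f2.1).2 (hX _ _ hm)
      (f2.2.1.trans f2.2.2.1) f1.2.1 i4
    have g1 := f1.2.2.1
    have g2 := f2.2.2.1
    rw [this] at g2
    linarith
  have hsub : I0 ∪ I1 ∪ I2 ⊆ edgesIn X G := by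
    intro e he
    rw [mem_edgesIn]
    simp only [Finset.mem_union] at he
    rcases he with (he | he) | he
    · obtain ⟨v, hv, rfl⟩ := Finset.mem_image.1 he
      obtain ⟨g1, g2, -⟩ := hlow v hv
      exact ⟨(h.plane.supp _ _ g1).1, (h.plane.supp _ _ g1).2, g1, g2⟩
    · obtain ⟨m, hm, rfl⟩ := Finset.mem_image.1 he
      have f1 := hfe true m hm
      exact ⟨(h.plane.supp _ _ f1.1).1, (h.plane.supp _ _ f1.1).2, f1.1, f1.2.1.trans f1.2.2.1⟩
    · obtain ⟨m, hm, rfl⟩ := Finset.mem_image.1 he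
      have f1 := hfe false m hm
      exact ⟨(h.plane.supp _ _ f1.1).1, hX _ _ hm, (h.triangle (hX _ _ hm) f1).1, f1.2.1⟩
  have hcard := Finset.card_le_card hsub
  rw [Finset.card_union_of_disjoint (by
    rw [Finset.disjoint_union_left]; exact ⟨d02, d12⟩), Finset.card_union_of_disjoint d01, c0, c1,
    c2] at hcard
  -- The families have at least |X| - 1, |X| - N true - 1 and |X| - N false - 1 members.
  have k0 : X.card - 1 ≤ (X.erase r).card := Finset.pred_card_le_card_erase
  have k1 := Finset.le_card_sdiff (chainVerts W N true) X
  have k2 := Finset.le_card_sdiff (chainVerts W N false) X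
  have k3 := card_chainVerts_le (W := W) (N := N) true
  have k4 := card_chainVerts_le (W := W) (N := N) false
  omega

end ChainBounded

/-! ### The upper bound on the number of edges -/

namespace Plane

variable {S : Finset Pt} {T : SimpleGraph Pt}

/-- No edge passes between two consecutive edges `vb`, `va` at `v` over the leftmost vertex `m` of
the wedge that they span. -/
lemma not_edge_in_wedge (hT : Plane S T) {v a b m c d : Pt} (hva : T.Adj v a) (hvb : T.Adj v b)
    (hvm : v.1 < m.1) (hma : m.1 ≤ a.1) (hmb : m.1 ≤ b.1)
    (hnext : ∀ y, T.Adj v y → v.1 < y.1 → sl v y < sl v a → sl v y ≤ sl v b)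
    (hmin : ∀ z ∈ S, v.1 < z.1 → sl v b ≤ sl v z → sl v z ≤ sl v a → m.1 ≤ z.1)
    (hcd : T.Adj c d) (hcm : c.1 < m.1) (hmd : m.1 < d.1) (h1 : ht v b m.1 < ht c d m.1)
    (h2 : ht c d m.1 < ht v a m.1) : False := by
  have hcd' : c.1 < d.1 := hcm.trans hmd
  have hva' : v.1 < a.1 := by linarith
  have hvb' : v.1 < b.1 := by linarith
  rcases lt_trichotomy v.1 c.1 with h | h | h
  -- An edge starting right of v starts inside the wedge and left of m, contradicting the choice of
  -- m.
  · have o1 := hT.order hcd hcd' hva hva' hcm.le hmd.le hvm.le hma le_rfl hcd'.le h.le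
      (by linarith) h2
    have o2 := hT.order hvb hvb' hcd hcd' hvm.le hmb hcm.le hmd.le h.le (by linarith) le_rfl
      hcd'.le h1
    rw [ht_left] at o1 o2
    have g1 : c.2 ≤ ht v a c.1 := by rcases o1 with o | o <;> linarith [o]
    have g2 : ht v b c.1 ≤ c.2 := by rcases o2 with o | o <;> linarith [o]
    have e := ht_right h
    rw [← e] at g1 g2
    have := hmin c (hT.supp _ _ hcd).1 h (sl_le_of_ht_le h g2) (sl_le_of_ht_le h g1)
    linarith
  -- An edge starting at v would lie strictly between the consecutive edges vb and va.
  · have hcv : v = c := hT.xinj _ (hT.supp _ _ hva).1 _ (hT.supp _ _ hcd).1 h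
    subst hcv
    have g1 := sl_lt_of_ht_lt hvm h1
    have g2 := sl_lt_of_ht_lt hvm h2
    have := hnext d hcd hcd' g2
    linarith
  -- An edge starting left of v would have to pass below v because of va, and above v because of vb.
  · have o1 := hT.order hcd hcd' hva hva' hcm.le hmd.le hvm.le hma h.le (by linarith) le_rfl
      hva'.le h2
    have o2 := hT.order hvb hvb' hcd hcd' hvm.le hmb hcm.le hmd.le le_rfl hvb'.le h.le
      (by linarith) h1
    rw [ht_left] at o1 o2
    rcases o1 with o1 | ⟨o1, o | o⟩
    · rcases o2 with o2 | ⟨o2, -⟩ <;> linarith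
    · linarith [o.1]
    · linarith [o.1]

/-- A plane graph has at most as many edges as Euler's formula predicts for a triangulation whose
upper and lower hull vertices are `H true` and `H false`. -/
theorem card_edges_le (hT : Plane S T) (H : Bool → Finset Pt) (hHS : ∀ s, H s ⊆ S)
    (hH : ∀ s, ∀ m ∈ H s, ∀ a b, T.Adj a b → a.1 < m.1 → m.1 < b.1 →
      ¬ sg s * m.2 < sg s * ht a b m.1) {r : Pt} (hr : r ∈ S) (hr' : ∀ m ∈ S, m.1 ≤ r.1) :
    (edgesIn S T).card + 1 + (H true).card + (H false).card ≤ 3 * S.card := by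
  classical
  have hfirst : ∀ (s : Bool) m, ∃ e : Pt × Pt, ∀ a b, First (sg s) T m a b → e = (a, b) := by
    intro s m
    by_cases h : ∃ a b, First (sg s) T m a b
    · obtain ⟨a, b, h⟩ := h
      exact ⟨(a, b), fun c d h' => hT.first_unique (sg_eq s) h h'⟩
    -- The default value is harmless: `E1` and `E2` only have to cover the edges, and their sizes
    -- are bounded by the number of vertices used as arguments.
    · exact ⟨(m, m), fun a b h' => absurd ⟨a, b, h'⟩ h⟩
  choose fe hfe using hfirst
  -- The same three families as in the lower bound; here it matters that they exhaust the edges.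
  set E0 := (edgesIn S T).filter (fun e => ∀ c, T.Adj e.1 c → e.1.1 < c.1 → sl e.1 e.2 ≤ sl e.1 c)
    with hE0
  set E1 := (S \ H true).image (fe true) with hE1
  set E2 := (S \ H false).image (fun m => ((fe false m).1, m)) with hE2
  have hnot : ∀ s, ∀ m ∈ S, ∀ a b, First (sg s) T m a b → m ∈ S \ H s := by
    intro s m hm a b hF
    exact Finset.mem_sdiff.2 ⟨hm, fun h => hH s m h a b hF.1 hF.2.1 hF.2.2.1 hF.2.2.2.1⟩
  have c0 : E0.card ≤ (S.erase r).card := by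
    apply Finset.card_le_card_of_injOn Prod.fst
    · intro e he
      rw [Finset.mem_coe, hE0, Finset.mem_filter, mem_edgesIn] at he
      rw [Finset.mem_coe, Finset.mem_erase]
      refine ⟨?_, he.1.1⟩
      intro h
      have := hr' _ he.1.2.1
      rw [← h] at this
      linarith [he.1.2.2.2]
    · rintro ⟨v, a⟩ he ⟨v', b⟩ he' h
      rw [Finset.mem_coe, hE0, Finset.mem_filter, mem_edgesIn] at he he'
      simp only at h he he'
      subst h
      have := le_antisymm (he.2 b he'.1.2.2.1 he'.1.2.2.2) (he'.2 a he.1.2.2.1 he.1.2.2.2)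
      rw [ChainBounded.sl_injective_right hT he.1.1 he.1.2.1 he'.1.2.1 he.1.2.2.2 he'.1.2.2.2 this]
  have c1 : E1.card ≤ (S \ H true).card := Finset.card_image_le
  have c2 : E2.card ≤ (S \ H false).card := Finset.card_image_le
  have hsub : edgesIn S T ⊆ E0 ∪ E1 ∪ E2 := by
    rintro ⟨v, a⟩ he
    have he' := mem_edgesIn.1 he
    obtain ⟨hv, ha, hva, hva'⟩ := he'
    simp only at hv ha hva hva'
    by_cases hl : ∀ c, T.Adj v c → v.1 < c.1 → sl v a ≤ sl v c
    · have : (v, a) ∈ E0 := Finset.mem_filter.2 ⟨he, hl⟩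
      simp [this]
    push Not at hl
    obtain ⟨b₀, hb₀, hvb₀, hlt₀⟩ := hl
    -- The next edge below va at v.
    obtain ⟨b, hb, hbmax⟩ := (S.filter (fun c => T.Adj v c ∧ v.1 < c.1 ∧
      sl v c < sl v a)).exists_max_image (fun c => sl v c)
      ⟨b₀, by simp [hb₀, hvb₀, hlt₀, (hT.supp _ _ hb₀).2]⟩
    simp only [Finset.mem_filter] at hb hbmax
    obtain ⟨hbS, hvb, hvb', hba⟩ := hb
    -- The leftmost vertex of the closed wedge; a and b themselves are candidates.
    obtain ⟨m, hm, hmmin⟩ := (S.filter (fun z => v.1 < z.1 ∧ sl v b ≤ sl v z ∧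
      sl v z ≤ sl v a)).exists_min_image (fun z => z.1) ⟨a, by simp [ha, hva', hba.le]⟩
    simp only [Finset.mem_filter] at hm hmmin
    obtain ⟨hm, hvm, hbm, hma⟩ := hm
    have hmb1 := hmmin b ⟨hbS, hvb', le_rfl, hba.le⟩
    have hma1 := hmmin a ⟨ha, hva', hba.le, le_rfl⟩
    have key : ∀ c d, T.Adj c d → c.1 < m.1 → m.1 < d.1 → ht v b m.1 < ht c d m.1 →
        ht c d m.1 < ht v a m.1 → False := fun c d hcd g1 g2 g3 g4 =>
      hT.not_edge_in_wedge hva hvb hvm hma1 hmb1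
        (fun y hy hy' hy'' => hbmax y ⟨(hT.supp _ _ hy).2, hy, hy', hy''⟩)
        (fun z hz h1 h2 h3 => hmmin z ⟨hz, h1, h2, h3⟩) hcd g1 g2 g3 g4
    -- If m = a, then vb is the first edge below a. Otherwise va is the first edge above m; this
    -- includes the case m = b.
    by_cases hmane : m = a
    · subst hmane
      have hbne : m.1 < b.1 := lt_of_le_of_ne hmb1 (fun h => by
        rw [hT.xinj _ hm _ hbS h] at hba; exact lt_irrefl _ hba)
      have hF : First (sg false) T m v b := by
        have hlow : ht v b m.1 < m.2 := by
          have := ht_lt_of_sl_lt hba hvm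
          rwa [ht_right hvm] at this
        refine ⟨hvb, hvm, hbne, by simp [sg, hlow], ?_⟩
        intro c d hcd g1 g2 g3
        by_contra g4
        simp only [sg] at g3 g4
        norm_num at g3 g4
        refine key c d hcd g1 g2 g4 ?_
        rw [ht_right hvm]; exact g3
      have : (v, m) ∈ E2 := Finset.mem_image.2 ⟨m, hnot _ _ hm _ _ hF, by
        rw [hfe false m _ _ hF]⟩
      simp [this]
    · have hma2 : m.1 < a.1 := lt_of_le_of_ne hma1 fun h => hmane (hT.xinj _ hm _ ha h)
      have hF : First (sg true) T m v a := by
        have hup : m.2 < ht v a m.1 := by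
          refine lt_of_le_of_ne ?_ (hT.nocol _ hv _ ha _ hm hva' ?_ hmane).symm
          · have := ht_le_of_sl_le hma hvm.le
            rwa [ht_right hvm] at this
          · rintro rfl; exact lt_irrefl _ hvm
        have hlow : ht v b m.1 ≤ m.2 := by
          have := ht_le_of_sl_le hbm hvm.le
          rwa [ht_right hvm] at this
        refine ⟨hva, hvm, hma2, by simp [sg, hup], ?_⟩
        intro c d hcd g1 g2 g3
        by_contra g4
        simp only [sg, if_true, one_mul] at g3 g4
        exact key c d hcd g1 g2 (by linarith) (by linarith)
      have : (v, a) ∈ E1 := Finset.mem_image.2 ⟨m, hnot _ _ hm _ _ hF, hfe true m _ _ hF⟩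
      simp [this]
  have hcard := Finset.card_le_card hsub
  have u1 := Finset.card_union_le (E0 ∪ E1) E2
  have u2 := Finset.card_union_le E0 E1
  have k0 : (S.erase r).card + 1 = S.card := Finset.card_erase_add_one hr
  have k1 := Finset.card_sdiff_add_card_eq_card (hHS true)
  have k2 := Finset.card_sdiff_add_card_eq_card (hHS false)
  omega

end Plane

/-! ### Edges and chains -/

namespace Plane

variable {V : Finset Pt} {G : SimpleGraph Pt}

/-- An edge extending beyond q can neither cross pq nor contain p or q, so it is still below the
chain when it passes q. -/
lemma below_chain_step (hG : Plane V G) {s : ℝ} (hs : s = 1 ∨ s = -1) {p q c d : Pt}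
    (hpq : G.Adj p q) (hpq' : p.1 < q.1) (hcd : G.Adj c d) {x : ℝ} (h1 : p.1 ≤ x) (h2 : x ≤ q.1)
    (hcx : c.1 < x) (hqd : q.1 < d.1) (hx : s * ht c d x ≤ s * ht p q x) :
    s * ht c d q.1 < s * q.2 := by
  obtain ⟨hp, hq⟩ := hG.supp _ _ hpq
  obtain ⟨hc, hd⟩ := hG.supp _ _ hcd
  have hcd' : c.1 < d.1 := by linarith
  have hno : ∀ z ∈ V, c.1 < z.1 → z.1 < d.1 → ht c d z.1 ≠ z.2 := fun z hz g1 g2 =>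
    hG.nocol _ hc _ hd _ hz hcd' (by rintro rfl; exact lt_irrefl _ g1)
      (by rintro rfl; exact lt_irrefl _ g2)
  rcases eq_or_lt_of_le hx with hx | hx
  · exfalso
    have hx := mul_left_cancel₀ (sign_ne hs) hx
    rcases eq_or_lt_of_le h1 with e | h1
    · rw [← e, ht_left] at hx
      exact hno p hp (by linarith) (by linarith) hx
    · rcases eq_or_lt_of_le h2 with e | h2
      · rw [e, ht_right hpq'] at hx
        exact hno q hq (by linarith) (by linarith) hx
      · refine hG.nc _ _ _ _ hcd hpq ?_ x hcx (by linarith) h1 h2 hx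
        intro e
        rw [(Prod.mk.inj e).2] at hqd
        exact lt_irrefl _ hqd
  · have := hG.order_sign hs hcd hcd' hpq hpq' hcx.le (by linarith) h1 h2 (by linarith) hqd.le
      hpq'.le le_rfl hx
    rw [ht_right hpq'] at this
    rcases this with h | ⟨_, h | h⟩
    · exact h
    · linarith [h.1]
    · linarith [h.1]

/-- An edge that is below a chain at some place stays below the chain to the right. -/
lemma below_chain (hG : Plane V G) {s : ℝ} (hs : s = 1 ∨ s = -1) {W : ℕ → Pt} {N : ℕ}
    (hadj : ∀ n < N, G.Adj (W n) (W (n + 1))) (hlt : ∀ n < N, (W n).1 < (W (n + 1)).1)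
    {c d : Pt} (hcd : G.Adj c d) {x : ℝ} {i : ℕ} (h1 : (W i).1 ≤ x)
    (h2 : x ≤ (W (i + 1)).1) (hcx : c.1 < x)
    (hx : s * ht c d x ≤ s * ht (W i) (W (i + 1)) x) {j : ℕ} (hij : i < j) (hj : j ≤ N)
    (hjd : (W j).1 < d.1) : s * ht c d (W j).1 < s * (W j).2 ∧ x ≤ (W j).1 := by
  induction j, hij using Nat.le_induction with
  | base =>
    exact ⟨hG.below_chain_step hs (hadj i (by omega)) (hlt i (by omega)) hcd h1 h2 hcx hjd hx, h2⟩
  | succ k hk ih =>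
    have hk' := hlt k (by omega)
    obtain ⟨g1, g2⟩ := ih (by omega) (by linarith)
    refine ⟨hG.below_chain_step hs (hadj k (by omega)) hk' hcd le_rfl hk'.le (by linarith) hjd ?_,
      by linarith⟩
    rw [ht_left]; exact g1.le

end Plane

/-- The subgraph of `G` on the vertices in `S`. -/
def restrictTo (S : Finset Pt) (G : SimpleGraph Pt) : SimpleGraph Pt where
  Adj a b := G.Adj a b ∧ a ∈ S ∧ b ∈ S
  symm := ⟨fun _ _ h => ⟨h.1.symm, h.2.2, h.2.1⟩⟩
  loopless := ⟨fun _ h => G.loopless.irrefl _ h.1⟩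

lemma edgesIn_restrictTo (S : Finset Pt) (G : SimpleGraph Pt) :
    edgesIn S (restrictTo S G) = edgesIn S G := by
  ext e
  simp only [mem_edgesIn, restrictTo]
  tauto

lemma Plane.restrict {V S : Finset Pt} {G : SimpleGraph Pt} (hG : Plane V G) (hS : S ⊆ V) :
    Plane S (restrictTo S G) where
  xinj a ha b hb := hG.xinj a (hS ha) b (hS hb)
  nocol a ha b hb z hz := hG.nocol a (hS ha) b (hS hb) z (hS hz)
  supp _ _ h := h.2
  nc a b c d hab hcd := hG.nc a b c d hab.1 hcd.1

/-! ### Hull edges -/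

/-- The chains `W true` and `W false` run along the upper and the lower hull of `S`. -/
structure HullChains (S : Finset Pt) (W : Bool → ℕ → Pt) (N : Bool → ℕ) : Prop where
  pos : ∀ s, 0 < N s
  mem : ∀ s, ∀ n ≤ N s, W s n ∈ S
  lt : ∀ s, ∀ n < N s, (W s n).1 < (W s (n + 1)).1
  left : ∀ s, ∀ m ∈ S, (W s 0).1 ≤ m.1
  right : ∀ s, ∀ m ∈ S, m.1 ≤ (W s (N s)).1
  hull : ∀ s, ∀ n < N s, ∀ z ∈ S, sg s * z.2 ≤ sg s * ht (W s n) (W s (n + 1)) z.1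

namespace HullChains

variable {S : Finset Pt} {T : SimpleGraph Pt} {W : Bool → ℕ → Pt} {N : Bool → ℕ}

lemma ht_sign_le_of_endpoints {s : ℝ} (hs : s = 1 ∨ s = -1) {a b c d : Pt} {x y t : ℝ}
    (h1 : s * ht a b x ≤ s * ht c d x) (h2 : s * ht a b y ≤ s * ht c d y) (hx : x ≤ t)
    (hy : t ≤ y) : s * ht a b t ≤ s * ht c d t := by
  rcases hs with rfl | rfl
  · simpa using ht_le_of_endpoints (by simpa using h1) (by simpa using h2) hx hy
  · simpa using ht_le_of_endpoints (by simpa using h1) (by simpa using h2) hx hy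

/-- Segments between points of `S` stay below the lines through the hull edges. -/
lemma segment_le (h : HullChains S W N) (s : Bool) {n : ℕ} (hn : n < N s) {c d : Pt} (hc : c ∈ S)
    (hd : d ∈ S) {x : ℝ} (h1 : c.1 ≤ x) (h2 : x ≤ d.1) :
    sg s * ht c d x ≤ sg s * ht (W s n) (W s (n + 1)) x := by
  have e1 := h.hull s n hn c hc
  have e2 := h.hull s n hn d hd
  rcases eq_or_lt_of_le (h1.trans h2) with e | e
  · have : x = c.1 := le_antisymm (e ▸ h2) h1
    subst this
    rw [ht_left]; exact e1
  · refine ht_sign_le_of_endpoints (sg_eq s) (x := c.1) (y := d.1) ?_ ?_ h1 h2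
    · rwa [ht_left]
    · rwa [ht_right e]

lemma strictMono (h : HullChains S W N) (s : Bool) {m n : ℕ} (hmn : m < n) (hn : n ≤ N s) :
    (W s m).1 < (W s n).1 := by
  induction n, hmn using Nat.le_induction with
  | base => exact h.lt s m (by omega)
  | succ k hk ih => exact (ih (by omega)).trans (h.lt s k (by omega))

lemma card_chainVerts (h : HullChains S W N) (s : Bool) : (chainVerts W N s).card = N s + 1 := by
  classical
  have : Set.InjOn (W s) (Finset.range (N s + 1) : Set ℕ) := by
    intro m hm n hn hmn
    simp only [Finset.coe_range, Set.mem_Iio] at hm hn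
    rcases lt_trichotomy m n with hlt | heq | hgt
    · have := h.strictMono s hlt (by omega); rw [hmn] at this; exact absurd this (lt_irrefl _)
    · exact heq
    · have := h.strictMono s hgt (by omega); rw [hmn] at this; exact absurd this (lt_irrefl _)
  simp only [chainVerts]
  convert Finset.card_image_of_injOn this using 1
  simp

/-- Each chain vertex but the last starts a hull edge whose line bounds all segments between points
of S, so no edge passes beyond such a vertex. The last vertex is the rightmost point, which no edge
passes at all. -/
theorem card_edges_le (h : HullChains S W N) (hT : Plane S T) :
    (edgesIn S T).card + N true + N false + 3 ≤ 3 * S.card := by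
  have := hT.card_edges_le (chainVerts W N) ?_ ?_ (h.mem true (N true) le_rfl) (h.right true)
  · rw [h.card_chainVerts, h.card_chainVerts] at this
    omega
  · intro s z hz
    obtain ⟨n, hn, rfl⟩ := mem_chainVerts.1 hz
    exact h.mem s n hn
  · intro s m hm a b hab h1 h2
    obtain ⟨n, hn, rfl⟩ := mem_chainVerts.1 hm
    obtain ⟨ha, hb⟩ := hT.supp _ _ hab
    rcases eq_or_lt_of_le hn with rfl | hn
    · linarith [h.right s b hb]
    · have := h.segment_le s hn ha hb h1.le h2.le
      rw [ht_left] at this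
      exact not_lt.2 this

/-- Adding a hull edge to a plane graph creates no crossing. -/
lemma plane_sup_edge (h : HullChains S W N) (hT : Plane S T) {s : Bool} {n : ℕ} (hn : n < N s) :
    Plane S (T ⊔ SimpleGraph.edge (W s n) (W s (n + 1))) := by
  set p := W s n with hp
  set q := W s (n + 1) with hq
  have hpS : p ∈ S := h.mem s n hn.le
  have hqS : q ∈ S := h.mem s (n + 1) hn
  have hpq : p.1 < q.1 := h.lt s n hn
  have hedge : ∀ a b, (SimpleGraph.edge p q).Adj a b → a.1 < b.1 → a = p ∧ b = q := by
    intro a b hab hlt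
    rw [SimpleGraph.edge_adj] at hab
    rcases hab.1 with h | h
    · exact ⟨h.1, h.2⟩
    · rw [h.1, h.2] at hlt; linarith
  have key : ∀ c d, T.Adj c d → (c, d) ≠ (p, q) → ∀ x, p.1 < x → x < q.1 → c.1 < x → x < d.1 →
      ht p q x ≠ ht c d x := by
    intro c d hcd hne x h1 h2 h3 h4 heq
    obtain ⟨hc, hd⟩ := hT.supp _ _ hcd
    have hcd' := h3.trans h4
    have e1 := h.hull s n hn c hc
    have e2 := h.hull s n hn d hd
    have f1 := ht_sub_affine c d p q x c.1
    have f2 := ht_sub_affine c d p q x d.1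
    rw [ht_left] at f1
    rw [ht_right hcd'] at f2
    have g : ∀ {z}, z ∈ S → ht p q z.1 = z.2 → z = p ∨ z = q := by
      intro z hz he
      by_contra hcon
      push Not at hcon
      exact hT.nocol _ hpS _ hqS _ hz hpq hcon.1 hcon.2 he
    -- The gap between cd and pq vanishes at x and has the same weak sign at c, left of x, and at d,
    -- right of x. An affine function of this kind is zero.
    have hμ : sg s * (sl c d - sl p q) = 0 := by
      have i1 : sg s * (sl c d - sl p q) * (c.1 - x) ≤ 0 := by
        have : sg s * (sl c d - sl p q) * (c.1 - x) = sg s * c.2 - sg s * ht p q c.1 := by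
          linear_combination (-sg s) * f1 + (sg s) * heq
        rw [this]; linarith
      have i2 : sg s * (sl c d - sl p q) * (d.1 - x) ≤ 0 := by
        have : sg s * (sl c d - sl p q) * (d.1 - x) = sg s * d.2 - sg s * ht p q d.1 := by
          linear_combination (-sg s) * f2 + (sg s) * heq
        rw [this]; linarith
      nlinarith
    have hμ : sl c d - sl p q = 0 := (mul_eq_zero.1 hμ).resolve_left (Plane.sign_ne (sg_eq s))
    rw [hμ] at f1 f2
    have hc' := g hc (by linarith)
    have hd' := g hd (by linarith)
    rcases hc' with rfl | rfl <;> rcases hd' with rfl | rfl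
    · linarith
    · exact hne rfl
    · linarith
    · linarith
  refine ⟨hT.xinj, hT.nocol, ?_, ?_⟩
  · intro a b hab
    rcases hab with hab | hab
    · exact hT.supp _ _ hab
    · rw [SimpleGraph.edge_adj] at hab
      rcases hab.1 with h | h <;> rw [h.1, h.2] <;> exact ⟨‹_›, ‹_›⟩
  · intro a b c d hab hcd hne x h1 h2 h3 h4
    rcases hab with hab | hab <;> rcases hcd with hcd | hcd
    · exact hT.nc _ _ _ _ hab hcd hne x h1 h2 h3 h4
    · obtain ⟨rfl, rfl⟩ := hedge _ _ hcd (h3.trans h4)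
      exact (key _ _ hab hne x h3 h4 h1 h2).symm
    · obtain ⟨rfl, rfl⟩ := hedge _ _ hab (h1.trans h2)
      exact key _ _ hcd hne.symm x h1 h2 h3 h4
    · obtain ⟨rfl, rfl⟩ := hedge _ _ hcd (h3.trans h4)
      obtain ⟨rfl, rfl⟩ := hedge _ _ hab (h1.trans h2)
      exact absurd rfl hne

/-- A plane graph with the maximum number of edges contains all hull edges. -/
theorem adj_of_card_le (h : HullChains S W N) (hT : Plane S T)
    (hcard : 3 * S.card ≤ (edgesIn S T).card + N true + N false + 3) {s : Bool} {n : ℕ}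
    (hn : n < N s) : T.Adj (W s n) (W s (n + 1)) := by
  by_contra hnot
  have hup := h.card_edges_le (h.plane_sup_edge hT hn)
  have hlt : (edgesIn S T).card <
      (edgesIn S (T ⊔ SimpleGraph.edge (W s n) (W s (n + 1)))).card := by
    apply Finset.card_lt_card
    rw [Finset.ssubset_iff_of_subset]
    · refine ⟨(W s n, W s (n + 1)), ?_, ?_⟩
      · rw [mem_edgesIn]
        refine ⟨h.mem s n hn.le, h.mem s _ hn, Or.inr ?_, h.lt s n hn⟩
        rw [SimpleGraph.edge_adj]
        refine ⟨Or.inl ⟨rfl, rfl⟩, ?_⟩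
        intro e
        have := h.lt s n hn
        simp only at e
        rw [e] at this
        exact lt_irrefl _ this
      · rw [mem_edgesIn]
        exact fun h => hnot h.2.2.1
    · intro e he
      rw [mem_edgesIn] at he ⊢
      exact ⟨he.1, he.2.1, Or.inl he.2.2.1, he.2.2.2⟩
  omega


/-- If a maximal plane graph `G` on `V` contains the hull edges of the set `S` of the vertices in
a left half-plane, then its subgraph on `S` has the maximum number of edges. -/
theorem card_le_of_maximal {V : Finset Pt} {G : SimpleGraph Pt} (h : HullChains S W N)
    (hG : Plane V G)
    (hmax : ∀ v ∈ V, ∀ k ∈ V, v.1 < k.1 → (∀ c d, G.Adj c d → ∀ x, c.1 < x → x < d.1 → v.1 < x →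
      x < k.1 → ht c d x = ht v k x → c = v ∧ d = k) → G.Adj v k)
    (hS : ∀ z, z ∈ S ↔ z ∈ V ∧ z.1 ≤ (W true (N true)).1)
    (hW : ∀ s, ∀ n < N s, G.Adj (W s n) (W s (n + 1))) :
    3 * S.card ≤ (edgesIn S G).card + N true + N false + 3 := by
  have hSV : S ⊆ V := fun z hz => ((hS z).1 hz).1
  rw [← edgesIn_restrictTo]
  have hr : ∀ s, W s (N s) = W true (N true) := by
    intro s
    refine hG.xinj _ (hSV (h.mem s _ le_rfl)) _ (hSV (h.mem true _ le_rfl)) ?_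
    exact le_antisymm (h.right true _ (h.mem s _ le_rfl)) (h.right s _ (h.mem true _ le_rfl))
  refine ChainBounded.card_le (W := W) (N := N) ⟨hG.restrict hSV, h.pos,
    fun s n hn => ⟨hW s n hn, h.mem s n hn.le, h.mem s _ hn⟩, h.lt, h.left, h.right, ?_, ?_, ?_⟩
  · intro m hm s n hn _ _
    exact h.hull s n hn m hm
  · intro c d hcd x h1 h2 s n hn _ _
    exact h.segment_le s hn hcd.2.1 hcd.2.2 h1 h2
  · intro v hv k hk hvk hnc hreg
    refine ⟨hmax v (hSV hv) k (hSV hk) hvk ?_, hv, hk⟩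
    intro c d hcd x h1 h2 h3 h4 heq
    obtain ⟨hc, hd⟩ := hG.supp _ _ hcd
    have hxr : x < (W true (N true)).1 := h4.trans_le ((hS k).1 hk).2
    have hcS : c ∈ S := (hS c).2 ⟨hc, by linarith⟩
    by_cases hdS : d ∈ S
    · exact hnc c d ⟨hcd, hcS, hdS⟩ x h1 h2 h3 h4 heq
    exfalso
    have hdr : (W true (N true)).1 < d.1 := by
      by_contra hcon
      exact hdS ((hS d).2 ⟨hd, not_lt.1 hcon⟩)
    -- The edge cd leaves S, so it passes over the common right end of both chains. Lying between
    -- the chains at x, it remains strictly below the upper and strictly above the lower one, which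
    -- is impossible where they meet.
    have key : ∀ s, sg s * ht c d (W true (N true)).1 < sg s * (W true (N true)).2 := by
      intro s
      obtain ⟨i, hi, g1, g2⟩ := exists_step (f := fun n => (W s n).1) (h.pos s) (x := x)
        ((h.left s c hcS).trans h1.le) (by rw [hr]; exact hxr.le)
      have := hreg x h3 h4 s i hi g1 g2
      rw [← heq] at this
      have := (hG.below_chain (sg_eq s) (hW s) (h.lt s) hcd g1 g2 h1 this (j := N s) hi le_rfl
        (by rw [hr]; exact hdr)).1
      rwa [hr] at this
    have k1 := key true
    have k2 := key false
    simp only [sg] at k1 k2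
    norm_num at k1 k2
    linarith

end HullChains

/-! ### Graphs on a vertex set as graphs on the plane -/

/-- A graph on the vertex set `V`, as a graph on all points of the plane. -/
def lift {V : Finset Pt} (G : SimpleGraph V) : SimpleGraph Pt :=
  G.map (Function.Embedding.subtype _)

lemma lift_adj {V : Finset Pt} {G : SimpleGraph V} {a b : Pt} :
    (lift G).Adj a b ↔ ∃ (ha : a ∈ V) (hb : b ∈ V), G.Adj ⟨a, ha⟩ ⟨b, hb⟩ := by
  simp only [lift, SimpleGraph.map_adj, Function.Embedding.subtype_apply]
  constructor
  · rintro ⟨u, v, h, rfl, rfl⟩; exact ⟨u.2, v.2, h⟩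
  · rintro ⟨ha, hb, h⟩; exact ⟨_, _, h, rfl, rfl⟩

lemma lift_adj_coe {V : Finset Pt} {G : SimpleGraph V} (u v : V) :
    (lift G).Adj u v ↔ G.Adj u v := by
  rw [lift_adj]; exact ⟨fun ⟨_, _, h⟩ => h, fun h => ⟨u.2, v.2, h⟩⟩

lemma mem_openSegment_ht {a b : Pt} (hab : a.1 < b.1) {z : Pt} :
    z ∈ openSegment ℝ a b ↔ a.1 < z.1 ∧ z.1 < b.1 ∧ z.2 = ht a b z.1 := by
  have hne : b.1 - a.1 ≠ 0 := (sub_pos.2 hab).ne'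
  constructor
  · rintro ⟨s, t, hs, ht', hst, rfl⟩
    simp only [Prod.fst_add, Prod.smul_fst, Prod.snd_add, Prod.smul_snd, smul_eq_mul]
    have hs' : s = 1 - t := by linarith
    subst hs'
    refine ⟨by nlinarith, by nlinarith, ?_⟩
    simp only [ht]
    field_simp
    ring
  · rintro ⟨h1, h2, h3⟩
    refine ⟨(b.1 - z.1) / (b.1 - a.1), (z.1 - a.1) / (b.1 - a.1), div_pos (by linarith)
      (by linarith), div_pos (by linarith) (by linarith), by field_simp; ring, ?_⟩
    ext
    · simp only [Prod.fst_add, Prod.smul_fst, smul_eq_mul]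
      field_simp
      ring
    · simp only [Prod.snd_add, Prod.smul_snd, smul_eq_mul, h3, ht]
      field_simp
      ring

lemma mem_segment_ht {a b : Pt} (hab : a.1 < b.1) {z : Pt} :
    z ∈ segment ℝ a b ↔ a.1 ≤ z.1 ∧ z.1 ≤ b.1 ∧ z.2 = ht a b z.1 := by
  have hne : b.1 - a.1 ≠ 0 := (sub_pos.2 hab).ne'
  constructor
  · rintro ⟨s, t, hs, ht', hst, rfl⟩
    simp only [Prod.fst_add, Prod.smul_fst, Prod.snd_add, Prod.smul_snd, smul_eq_mul]
    have hs' : s = 1 - t := by linarith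
    subst hs'
    refine ⟨by nlinarith, by nlinarith, ?_⟩
    simp only [ht]
    field_simp
    ring
  · rintro ⟨h1, h2, h3⟩
    refine ⟨(b.1 - z.1) / (b.1 - a.1), (z.1 - a.1) / (b.1 - a.1), div_nonneg (by linarith)
      (by linarith), div_nonneg (by linarith) (by linarith), by field_simp; ring, ?_⟩
    ext
    · simp only [Prod.fst_add, Prod.smul_fst, smul_eq_mul]
      field_simp
      ring
    · simp only [Prod.snd_add, Prod.smul_snd, smul_eq_mul, h3, ht]
      field_simp
      ring

lemma collinear_of_ht {a b z : Pt} (hab : a.1 < b.1) (h : ht a b z.1 = z.2) :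
    Collinear ℝ ({a, b, z} : Set Pt) := by
  have hne : b.1 - a.1 ≠ 0 := (sub_pos.2 hab).ne'
  rw [collinear_iff_of_mem (p₀ := a) (by simp)]
  refine ⟨b - a, ?_⟩
  intro p hp
  simp only [Set.mem_insert_iff, Set.mem_singleton_iff] at hp
  rcases hp with rfl | rfl | rfl
  · exact ⟨0, by simp⟩
  · exact ⟨1, by simp⟩
  · refine ⟨(p.1 - a.1) / (b.1 - a.1), ?_⟩
    ext
    · simp only [vadd_eq_add, Prod.fst_add, Prod.smul_fst, Prod.fst_sub, smul_eq_mul]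
      field_simp
      ring
    · simp only [vadd_eq_add, Prod.snd_add, Prod.smul_snd, Prod.snd_sub, smul_eq_mul, ← h, ht]
      field_simp
      ring

section

variable {V : Finset Pt} {G : SimpleGraph V}

lemma plane_lift_of (hV : GeneralPosition V) (hG : NonCrossing G) : Plane V (lift G) where
  xinj := hV.1
  nocol a ha b hb z hz hab h1 h2 h :=
    hV.2.2 a ha b hb z hz (by rintro rfl; exact lt_irrefl _ hab) (Ne.symm h2) (Ne.symm h1)
      (collinear_of_ht hab h)
  supp a b h := ⟨(lift_adj.1 h).1, (lift_adj.1 h).2.1⟩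
  nc a b c d hab hcd hne x h1 h2 h3 h4 heq := by
    obtain ⟨ha, hb, hab⟩ := lift_adj.1 hab
    obtain ⟨hc, hd, hcd⟩ := lift_adj.1 hcd
    have hab' := h1.trans h2
    have hcd' := h3.trans h4
    refine Set.disjoint_left.1 (hG _ _ _ _ hab hcd ?_)
      ((mem_openSegment_ht (z := (x, ht a b x)) hab').2 ⟨h1, h2, rfl⟩)
      ((mem_openSegment_ht hcd').2 ⟨h3, h4, heq⟩)
    intro h
    simp only [Sym2.eq_iff, Subtype.mk.injEq] at h
    rcases h with ⟨rfl, rfl⟩ | ⟨rfl, rfl⟩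
    · exact hne rfl
    · linarith

lemma nonCrossing_of_ht (hV : GeneralPosition V)
    (h : ∀ a b c d : V, G.Adj a b → G.Adj c d → (a, b) ≠ (c, d) → ∀ x, a.1.1 < x → x < b.1.1 →
      c.1.1 < x → x < d.1.1 → ht a b x ≠ ht c d x) : NonCrossing G := by
  have orient : ∀ a b : V, G.Adj a b → ∃ a' b' : V, G.Adj a' b' ∧ s(a', b') = s(a, b) ∧
      a'.1.1 < b'.1.1 ∧ openSegment ℝ (a' : Pt) b' = openSegment ℝ (a : Pt) b := by
    intro a b hab
    rcases lt_trichotomy a.1.1 b.1.1 with h | h | h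
    · exact ⟨a, b, hab, rfl, h, rfl⟩
    · exact absurd (Subtype.ext (hV.1 _ a.2 _ b.2 h)) hab.ne
    · exact ⟨b, a, hab.symm, Sym2.eq_swap, h, openSegment_symm _ _ _⟩
  intro a b c d hab hcd hne
  obtain ⟨a', b', hab, e1, hab', e2⟩ := orient a b hab
  obtain ⟨c', d', hcd, e3, hcd', e4⟩ := orient c d hcd
  rw [← e2, ← e4, Set.disjoint_left]
  rw [← e1, ← e3] at hne
  intro z hz hz'
  rw [mem_openSegment_ht hab'] at hz
  rw [mem_openSegment_ht hcd'] at hz'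
  refine h a' b' c' d' hab hcd ?_ z.1 hz.1 hz.2.1 hz'.1 hz'.2.1 (hz.2.2.symm.trans hz'.2.2)
  intro h
  rw [(Prod.mk.inj h).1, (Prod.mk.inj h).2] at hne
  exact hne rfl

/-- Adding an edge that crosses no edge. -/
lemma nonCrossing_sup_edge (hV : GeneralPosition V) (hG : NonCrossing G) {v k : V}
    (hvk : v.1.1 < k.1.1)
    (h : ∀ c d, (lift G).Adj c d → ∀ x, c.1 < x → x < d.1 → v.1.1 < x → x < k.1.1 →
      ht c d x = ht v k x → c = v ∧ d = k) : NonCrossing (G ⊔ SimpleGraph.edge v k) := by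
  have hP := plane_lift_of hV hG
  have hedge : ∀ a b : V, (SimpleGraph.edge v k).Adj a b → a.1.1 < b.1.1 → a = v ∧ b = k := by
    intro a b hab hlt
    rw [SimpleGraph.edge_adj] at hab
    rcases hab.1 with h | h
    · exact h
    · rw [h.1, h.2] at hlt; linarith
  refine nonCrossing_of_ht hV ?_
  intro a b c d hab hcd hne x h1 h2 h3 h4 heq
  have hne' : ((a : Pt), (b : Pt)) ≠ ((c : Pt), (d : Pt)) := by
    intro h
    simp only [Prod.mk.injEq] at h
    exact hne (Prod.ext (Subtype.ext h.1) (Subtype.ext h.2))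
  rcases hab with hab | hab <;> rcases hcd with hcd | hcd
  · exact hP.nc _ _ _ _ ((lift_adj_coe a b).2 hab) ((lift_adj_coe c d).2 hcd) hne' x h1 h2 h3 h4
      heq
  · obtain ⟨rfl, rfl⟩ := hedge _ _ hcd (h3.trans h4)
    obtain ⟨e1, e2⟩ := h a b ((lift_adj_coe a b).2 hab) x h1 h2 h3 h4 heq
    exact hne' (by rw [e1, e2])
  · obtain ⟨rfl, rfl⟩ := hedge _ _ hab (h1.trans h2)
    obtain ⟨e1, e2⟩ := h c d ((lift_adj_coe c d).2 hcd) x h3 h4 h1 h2 heq.symm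
    exact hne' (by rw [e1, e2])
  · obtain ⟨rfl, rfl⟩ := hedge _ _ hab (h1.trans h2)
    obtain ⟨rfl, rfl⟩ := hedge _ _ hcd (h3.trans h4)
    exact hne rfl

lemma adj_of_isMaximalPSL (hG : IsMaximalPSL G) {v k : Pt} (hv : v ∈ V) (hk : k ∈ V)
    (hvk : v.1 < k.1)
    (h : ∀ c d, (lift G).Adj c d → ∀ x, c.1 < x → x < d.1 → v.1 < x → x < k.1 →
      ht c d x = ht v k x → c = v ∧ d = k) : (lift G).Adj v k := by
  have h1 : IsPSL (G ⊔ SimpleGraph.edge ⟨v, hv⟩ ⟨k, hk⟩) :=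
    ⟨hG.1.1, nonCrossing_sup_edge hG.1.1 hG.1.2 hvk h⟩
  have h2 := hG.2 h1 le_sup_left
  rw [lift_adj]
  refine ⟨hv, hk, h2 (Or.inr ?_)⟩
  rw [SimpleGraph.edge_adj]
  refine ⟨Or.inl ⟨rfl, rfl⟩, ?_⟩
  intro e
  rw [Subtype.mk.injEq] at e
  rw [e] at hvk
  exact lt_irrefl _ hvk

end

/-! ### The order of the vertices of a frame -/

/-- `xList` and `yList` have the same shape: five vertices, an optional one, seven vertices, an
optional one, four vertices. One lemma therefore serves both coordinates. -/
lemma pairwise_cell {f : Pt → ℝ} {a1 a2 a3 a4 a5 b1 b2 b3 b4 b5 b6 b7 c1 c2 c3 c4 : Pt}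
    {p q : Option Pt}
    (h : ([a1, a2, a3, a4, a5] ++ p.toList ++ [b1, b2, b3, b4, b5, b6, b7] ++ q.toList ++
      [c1, c2, c3, c4]).Pairwise (fun a b => f a < f b)) :
    f a1 < f a2 ∧ f a2 < f a3 ∧ f a3 < f a4 ∧ f a4 < f a5 ∧ f a5 < f b1 ∧ f b1 < f b2 ∧
    f b2 < f b3 ∧ f b3 < f b4 ∧ f b4 < f b5 ∧ f b5 < f b6 ∧ f b6 < f b7 ∧ f b7 < f c1 ∧
    f c1 < f c2 ∧ f c2 < f c3 ∧ f c3 < f c4 ∧ (∀ z ∈ p, f a5 < f z ∧ f z < f b1) ∧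
    (∀ z ∈ q, f b7 < f z ∧ f z < f c1) := by
  have hc := h.isChain
  cases p <;> cases q <;>
    simp only [Option.toList, List.cons_append, List.nil_append, List.append_nil,
      List.isChain_cons_cons, List.isChain_singleton, and_true] at hc <;>
    (obtain ⟨_, hc⟩ := hc
     refine ⟨?_, ?_, ?_, ?_, ?_, ?_, ?_, ?_, ?_, ?_, ?_, ?_, ?_, ?_, ?_, ?_, ?_⟩ <;>
      first | linarith | (intro z hz; cases hz <;> constructor <;> linarith))

namespace Frame

variable {w h : ℕ} {F : Frame w h}

/-- The upper (`true`) and the lower (`false`) boundary chain of the cell `(i, j)`, from the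
north-west to the south-east corner. -/
def bd (F : Frame w h) (i j : ℕ) (s : Bool) (n : ℕ) : Pt :=
  if s then (if n ≤ 4 then F.P (4 * i + n) (4 * j + 4) else F.P (4 * i + 4) (4 * j + (8 - n)))
  else (if n ≤ 4 then F.P (4 * i) (4 * j + (4 - n)) else F.P (4 * i + (n - 4)) (4 * j))

/-- The order of the vertices of a cell in both coordinates. -/
structure CellOrder (F : Frame w h) (i : Fin w) (j : Fin h) : Prop where
  x_lt : ∀ s, ∀ n < 8, (F.bd i j s n).1 < (F.bd i j s (n + 1)).1
  x_mid : (F.bd i j false 4).1 < (F.bd i j true 1).1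
  x_mid' : (F.bd i j true 7).1 < (F.bd i j false 5).1
  x_p : ∀ z ∈ F.p i j, (F.bd i j false 4).1 < z.1 ∧ z.1 < (F.bd i j true 1).1
  x_q : ∀ z ∈ F.q i j, (F.bd i j true 7).1 < z.1 ∧ z.1 < (F.bd i j false 5).1
  y_lt : ∀ s, ∀ n < 8, (F.bd i j s (n + 1)).2 < (F.bd i j s n).2
  y_mid : (F.bd i j false 4).2 < (F.bd i j true 7).2
  y_mid' : (F.bd i j true 1).2 < (F.bd i j false 3).2
  y_p : ∀ z ∈ F.p i j, (F.bd i j true 1).2 < z.2 ∧ z.2 < (F.bd i j false 3).2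
  y_q : ∀ z ∈ F.q i j, (F.bd i j false 4).2 < z.2 ∧ z.2 < (F.bd i j true 7).2

lemma cellOrder (hF : F.IsFrameGraph) (i : Fin w) (j : Fin h) : F.CellOrder i j := by
  obtain ⟨x1, x2, x3, x4, x5, x6, x7, x8, x9, x10, x11, x12, x13, x14, x15, x16, x17⟩ :=
    pairwise_cell (f := Prod.fst) (hF.xOrder i j)
  obtain ⟨y1, y2, y3, y4, y5, y6, y7, y8, y9, y10, y11, y12, y13, y14, y15, y16, y17⟩ :=
    pairwise_cell (f := Prod.snd) (hF.yOrder i j)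
  simp only [v, vb, Nat.reduceLeDiff, if_true, if_false, Nat.reduceSub, Nat.add_zero]
    at x1 x2 x3 x4 x5 x6 x7 x8 x9 x10 x11 x12 x13 x14 x15 y1 y2 y3 y4 y5 y6 y7 y8 y9 y10 y11 y12
      y13 y14 y15
  constructor
  · intro s n hn
    cases s <;> interval_cases n <;> simp [bd] <;> linarith
  · simpa [bd] using x5
  · simpa [bd] using x12
  · simpa [bd, v, vb] using x16
  · simpa [bd, v, vb] using x17
  · intro s n hn
    cases s <;> interval_cases n <;> simp [bd] <;> linarith
  · simpa [bd] using y5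
  · simpa [bd] using y12
  · simpa [bd, v, vb] using y17
  · simpa [bd, v, vb] using y16

end Frame

namespace Frame

variable {w h : ℕ} {F : Frame w h}

/-! ### Vertices and edges of a frame -/

lemma mem_verts {z : Pt} : z ∈ F.verts ↔ (∃ x ∈ gridIndices w h, F.P x.1 x.2 = z) ∨
    (∃ i j, z ∈ F.p i j ∨ z ∈ F.q i j) ∨ z = F.c := by
  simp only [verts, Finset.mem_union, Finset.mem_image, Finset.mem_biUnion, Finset.mem_univ,
    true_and, Option.mem_toFinset, Finset.mem_singleton, or_assoc]

lemma mem_gridIndices {a b : ℕ} :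
    (a, b) ∈ gridIndices w h ↔ a ≤ 4 * w ∧ b ≤ 4 * h ∧ (4 ∣ a ∨ 4 ∣ b) := by
  simp only [gridIndices, Finset.mem_filter, Finset.mem_product, Finset.mem_range]
  omega

lemma grid_mem {a b : ℕ} (ha : a ≤ 4 * w) (hb : b ≤ 4 * h) (hab : 4 ∣ a ∨ 4 ∣ b) :
    F.P a b ∈ F.verts :=
  mem_verts.2 (Or.inl ⟨(a, b), mem_gridIndices.2 ⟨ha, hb, hab⟩, rfl⟩)

lemma vert_mem {i k : ℕ} (hi : i ≤ w) (hk : k ≤ 4 * h) : F.P (4 * i) k ∈ F.verts :=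
  grid_mem (by omega) hk (Or.inl ⟨i, rfl⟩)

lemma hor_mem {j k : ℕ} (hj : j ≤ h) (hk : k ≤ 4 * w) : F.P k (4 * j) ∈ F.verts :=
  grid_mem hk (by omega) (Or.inr ⟨j, rfl⟩)

lemma c_mem : F.c ∈ F.verts := mem_verts.2 (Or.inr (Or.inr rfl))

lemma p_mem {i : Fin w} {j : Fin h} {z : Pt} (hz : z ∈ F.p i j) : z ∈ F.verts :=
  mem_verts.2 (Or.inr (Or.inl ⟨i, j, Or.inl hz⟩))

lemma q_mem {i : Fin w} {j : Fin h} {z : Pt} (hz : z ∈ F.q i j) : z ∈ F.verts :=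
  mem_verts.2 (Or.inr (Or.inl ⟨i, j, Or.inr hz⟩))

/-- The four kinds of vertices of a frame. -/
lemma verts_cases {z : Pt} (hz : z ∈ F.verts) : z = F.c ∨
    (∃ i ≤ w, ∃ k ≤ 4 * h, z = F.P (4 * i) k) ∨ (∃ j ≤ h, ∃ k ≤ 4 * w, z = F.P k (4 * j)) ∨
    ∃ i j, z ∈ F.p i j ∨ z ∈ F.q i j := by
  rcases mem_verts.1 hz with ⟨⟨a, b⟩, hx, rfl⟩ | hz | hz
  · obtain ⟨ha, hb, ⟨i, rfl⟩ | ⟨j, rfl⟩⟩ := mem_gridIndices.1 hx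
    · exact Or.inr (Or.inl ⟨i, by omega, b, hb, rfl⟩)
    · exact Or.inr (Or.inr (Or.inl ⟨j, by omega, a, ha, rfl⟩))
  · exact Or.inr (Or.inr (Or.inr hz))
  · exact Or.inl hz

/-- `a` is strictly south-west of `b`. -/
def SW (a b : Pt) : Prop := a.1 < b.1 ∧ a.2 < b.2

lemma SW.trans {a b c : Pt} (h1 : SW a b) (h2 : SW b c) : SW a c :=
  ⟨h1.1.trans h2.1, h1.2.trans h2.2⟩

/-- The steps can be read off from the cell orders: a vertical path is the west side of a column of
cells, except that the last path is the east side of the last column. -/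
lemma vert_step (hF : F.IsFrameGraph) {i k : ℕ} (hi : i ≤ w) (hk : k < 4 * h) :
    (F.P (4 * i) (k + 1)).1 < (F.P (4 * i) k).1 ∧ (F.P (4 * i) k).2 < (F.P (4 * i) (k + 1)).2 := by
  have hw := hF.w_pos
  obtain ⟨j, t, ht, rfl⟩ : ∃ j t, t < 4 ∧ k = 4 * j + t := ⟨k / 4, k % 4, by omega, by omega⟩
  rcases Nat.lt_or_ge i w with hi' | hi'
  · have O := F.cellOrder hF ⟨i, hi'⟩ ⟨j, by omega⟩
    have h1 := O.x_lt false (3 - t) (by omega)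
    have h2 := O.y_lt false (3 - t) (by omega)
    interval_cases t <;> simpa [bd, add_assoc] using And.intro h1 h2
  · obtain ⟨i, rfl⟩ : ∃ i', i = i' + 1 := ⟨i - 1, by omega⟩
    have O := F.cellOrder hF ⟨i, by omega⟩ ⟨j, by omega⟩
    have h1 := O.x_lt true (7 - t) (by omega)
    have h2 := O.y_lt true (7 - t) (by omega)
    interval_cases t <;> simpa [bd, add_assoc, mul_add] using And.intro h1 h2

lemma hor_step (hF : F.IsFrameGraph) {j k : ℕ} (hj : j ≤ h) (hk : k < 4 * w) :
    (F.P k (4 * j)).1 < (F.P (k + 1) (4 * j)).1 ∧ (F.P (k + 1) (4 * j)).2 < (F.P k (4 * j)).2 := by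
  have hh := hF.h_pos
  obtain ⟨i, t, ht, rfl⟩ : ∃ j t, t < 4 ∧ k = 4 * j + t := ⟨k / 4, k % 4, by omega, by omega⟩
  rcases Nat.lt_or_ge j h with hj' | hj'
  · have O := F.cellOrder hF ⟨i, by omega⟩ ⟨j, hj'⟩
    have h1 := O.x_lt false (4 + t) (by omega)
    have h2 := O.y_lt false (4 + t) (by omega)
    interval_cases t <;> simpa [bd, add_assoc] using And.intro h1 h2
  · obtain ⟨j, rfl⟩ : ∃ j', j = j' + 1 := ⟨j - 1, by omega⟩
    have O := F.cellOrder hF ⟨i, by omega⟩ ⟨j, by omega⟩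
    have h1 := O.x_lt true t (by omega)
    have h2 := O.y_lt true t (by omega)
    interval_cases t <;> simpa [bd, add_assoc, mul_add] using And.intro h1 h2

lemma vert_mono (hF : F.IsFrameGraph) {i k l : ℕ} (hi : i ≤ w) (hkl : k ≤ l) (hl : l ≤ 4 * h) :
    (F.P (4 * i) l).1 ≤ (F.P (4 * i) k).1 ∧ (F.P (4 * i) k).2 ≤ (F.P (4 * i) l).2 := by
  induction l, hkl using Nat.le_induction with
  | base => exact ⟨le_rfl, le_rfl⟩
  | succ l hkl ih =>
    have h1 := vert_step hF hi (show l < 4 * h by omega)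
    have h2 := ih (by omega)
    exact ⟨h1.1.le.trans h2.1, h2.2.trans h1.2.le⟩

lemma hor_mono (hF : F.IsFrameGraph) {j k l : ℕ} (hj : j ≤ h) (hkl : k ≤ l) (hl : l ≤ 4 * w) :
    (F.P k (4 * j)).1 ≤ (F.P l (4 * j)).1 ∧ (F.P l (4 * j)).2 ≤ (F.P k (4 * j)).2 := by
  induction l, hkl using Nat.le_induction with
  | base => exact ⟨le_rfl, le_rfl⟩
  | succ l hkl ih =>
    have h1 := hor_step hF hj (show l < 4 * w by omega)
    have h2 := ih (by omega)
    exact ⟨h2.1.trans h1.1.le, h1.2.le.trans h2.2⟩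

namespace CellOrder

variable {i : Fin w} {j : Fin h}

lemma x_le (O : F.CellOrder i j) (s : Bool) {m n : ℕ} (hmn : m ≤ n) (hn : n ≤ 8) :
    (F.bd i j s m).1 ≤ (F.bd i j s n).1 := by
  induction n, hmn using Nat.le_induction with
  | base => exact le_rfl
  | succ l hkl ih => exact (ih (by omega)).trans (O.x_lt s l (by omega)).le

lemma y_le (O : F.CellOrder i j) (s : Bool) {m n : ℕ} (hmn : m ≤ n) (hn : n ≤ 8) :
    (F.bd i j s n).2 ≤ (F.bd i j s m).2 := by
  induction n, hmn using Nat.le_induction with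
  | base => exact le_rfl
  | succ l hkl ih => exact (O.y_lt s l (by omega)).le.trans (ih (by omega))

lemma sw_upper (O : F.CellOrder i j) {n : ℕ} (h1 : 1 ≤ n) (h2 : n ≤ 7) :
    SW (F.bd i j false 4) (F.bd i j true n) :=
  ⟨O.x_mid.trans_le (O.x_le true h1 (by omega)), O.y_mid.trans_le (O.y_le true h2 (by omega))⟩

lemma sw_p (O : F.CellOrder i j) {z : Pt} (hz : z ∈ F.p i j) : SW (F.bd i j false 4) z :=
  ⟨(O.x_p z hz).1, (O.sw_upper le_rfl (by omega)).2.trans (O.y_p z hz).1⟩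

lemma sw_q (O : F.CellOrder i j) {z : Pt} (hz : z ∈ F.q i j) : SW (F.bd i j false 4) z :=
  ⟨(O.sw_upper (n := 7) (by omega) le_rfl).1.trans (O.x_q z hz).1, (O.y_q z hz).1⟩

end CellOrder

/-- The south-west corner of a cell is strictly south-west of the other vertices of the cell that
are not on its west and south sides. -/
lemma sw_of_hor (hF : F.IsFrameGraph) {i j t : ℕ} (hi : i < w) (hj : j < h) (h1 : 1 ≤ t)
    (h2 : t ≤ 4) : SW (F.P (4 * i) (4 * j)) (F.P (4 * i + t) (4 * j + 4)) := by
  have := (F.cellOrder hF ⟨i, hi⟩ ⟨j, hj⟩).sw_upper h1 (by omega)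
  simpa [bd, h2] using this

lemma sw_of_vert (hF : F.IsFrameGraph) {i j t : ℕ} (hi : i < w) (hj : j < h) (h1 : 1 ≤ t)
    (h2 : t ≤ 4) : SW (F.P (4 * i) (4 * j)) (F.P (4 * i + 4) (4 * j + t)) := by
  rcases eq_or_lt_of_le h2 with rfl | h2
  · exact sw_of_hor hF hi hj (by omega) le_rfl
  · have := (F.cellOrder hF ⟨i, hi⟩ ⟨j, hj⟩).sw_upper (n := 8 - t) (by omega) (by omega)
    rw [bd, bd] at this
    simpa [show ¬ (8 - t ≤ 4) by omega, show 8 - (8 - t) = t by omega] using this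

lemma sw_of_pq (hF : F.IsFrameGraph) {i : Fin w} {j : Fin h} {z : Pt}
    (hz : z ∈ F.p i j ∨ z ∈ F.q i j) : SW (F.P (4 * i) (4 * j)) z := by
  rcases hz with hz | hz
  · simpa [bd] using (F.cellOrder hF i j).sw_p hz
  · simpa [bd] using (F.cellOrder hF i j).sw_q hz

/-- The north-east vertices of a cell bound its interior vertices. -/
lemma pq_bounds (hF : F.IsFrameGraph) {i : Fin w} {j : Fin h} {z : Pt}
    (hz : z ∈ F.p i j ∨ z ∈ F.q i j) :
    (F.P (4 * i) (4 * j + 4)).1 ≤ z.1 ∧ z.1 ≤ (F.P (4 * i + 4) (4 * j)).1 ∧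
    (F.P (4 * i + 4) (4 * j)).2 ≤ z.2 ∧ z.2 ≤ (F.P (4 * i) (4 * j + 4)).2 := by
  have O := F.cellOrder hF i j
  have a1 := O.x_le false (m := 0) (n := 4) (by omega) (by omega)
  have a2 := O.x_le false (m := 5) (n := 8) (by omega) (by omega)
  have a3 := O.y_le false (m := 0) (n := 3) (by omega) (by omega)
  have a4 := O.y_le false (m := 4) (n := 8) (by omega) (by omega)
  have s1 := sw_of_pq hF hz
  have b1 := O.x_mid'
  have b2 := O.y_mid'
  have c1 := O.x_le true (m := 1) (n := 7) (by omega) (by omega)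
  have c2 := O.y_le true (m := 1) (n := 7) (by omega) (by omega)
  have e1 : F.bd i j false 0 = F.P (4 * i) (4 * j + 4) := by simp [bd]
  have e2 : F.bd i j false 8 = F.P (4 * i + 4) (4 * j) := by simp [bd]
  have e3 : F.bd i j false 4 = F.P (4 * i) (4 * j) := by simp [bd]
  rw [← e1, ← e2]
  rw [← e3] at s1
  have := s1.1
  have := s1.2
  rcases hz with hz | hz
  · have := O.x_p z hz
    have := O.y_p z hz
    refine ⟨?_, ?_, ?_, ?_⟩ <;> linarith
  · have := O.x_q z hz
    have := O.y_q z hz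
    refine ⟨?_, ?_, ?_, ?_⟩ <;> linarith

/-- The cone condition speaks only of vertices different from the cone vertex, so it does not by
itself exclude a coincidence. But each grid vertex has a neighbour on its path that is strictly west
or strictly south of it. -/
lemma grid_ne_c (hF : F.IsFrameGraph) {a b : ℕ} (ha : a ≤ 4 * w) (hb : b ≤ 4 * h)
    (hab : 4 ∣ a ∨ 4 ∣ b) : F.P a b ≠ F.c := by
  intro hc
  have hw := hF.w_pos
  have hh := hF.h_pos
  have key : ∀ z ∈ F.verts, F.c.1 ≤ z.1 ∧ F.c.2 ≤ z.2 := by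
    intro z hz
    by_cases hz' : z = F.c
    · rw [hz']; exact ⟨le_rfl, le_rfl⟩
    · have := hF.cone z hz hz'
      exact ⟨this.1.le, this.2.le⟩
  rcases hab with ⟨i, rfl⟩ | ⟨j, rfl⟩
  · have hi : i ≤ w := by omega
    rcases Nat.lt_or_ge b (4 * h) with hb' | hb'
    · have := (vert_step hF hi hb').1
      have := (key _ (vert_mem (F := F) hi (k := b + 1) (by omega))).1
      rw [← hc] at this
      linarith
    · obtain ⟨b, rfl⟩ : ∃ b', b = b' + 1 := ⟨b - 1, by omega⟩
      have := (vert_step hF hi (k := b) (by omega)).2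
      have := (key _ (vert_mem (F := F) hi (k := b) (by omega))).2
      rw [← hc] at this
      linarith
  · have hj : j ≤ h := by omega
    rcases Nat.lt_or_ge a (4 * w) with hb' | hb'
    · have := (hor_step hF hj hb').2
      have := (key _ (hor_mem (F := F) hj (k := a + 1) (by omega))).2
      rw [← hc] at this
      linarith
    · obtain ⟨a, rfl⟩ : ∃ b', a = b' + 1 := ⟨a - 1, by omega⟩
      have := (hor_step hF hj (k := a) (by omega)).1
      have := (key _ (hor_mem (F := F) hj (k := a) (by omega))).1
      rw [← hc] at this
      linarith

lemma c_sw_grid (hF : F.IsFrameGraph) {a b : ℕ} (ha : a ≤ 4 * w) (hb : b ≤ 4 * h)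
    (hab : 4 ∣ a ∨ 4 ∣ b) : SW F.c (F.P a b) :=
  hF.cone _ (grid_mem ha hb hab) (grid_ne_c hF ha hb hab)

/-- The north-west corner of the frame is the westmost and northmost vertex besides `c`. -/
lemma nw_bounds (hF : F.IsFrameGraph) {z : Pt} (hz : z ∈ F.verts) (hzc : z ≠ F.c) :
    (F.P 0 (4 * h)).1 ≤ z.1 ∧ z.2 ≤ (F.P 0 (4 * h)).2 := by
  have hv : ∀ {i k : ℕ}, i ≤ w → k ≤ 4 * h → (F.P 0 (4 * h)).1 ≤ (F.P (4 * i) k).1 ∧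
      (F.P (4 * i) k).2 ≤ (F.P 0 (4 * h)).2 := by
    intro i k hi hk
    have h1 := vert_mono hF hi hk le_rfl
    have h2 := hor_mono hF (j := h) le_rfl (Nat.zero_le (4 * i)) (by omega)
    exact ⟨h2.1.trans h1.1, h1.2.trans h2.2⟩
  rcases verts_cases hz with h0 | ⟨i, hi, k, hk, rfl⟩ | ⟨j, hj, k, hk, rfl⟩ | ⟨i, j, hz⟩
  · exact absurd h0 hzc
  · exact hv hi hk
  · have h1 := hor_mono hF hj (Nat.zero_le k) hk
    have h2 := vert_mono hF (i := 0) (Nat.zero_le _) (k := 4 * j) (l := 4 * h) (by omega) le_rfl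
    exact ⟨h2.1.trans h1.1, h1.2.trans h2.2⟩
  · have h1 := pq_bounds hF hz
    have h2 := hv (i := i) (k := 4 * j + 4) i.2.le (by omega)
    exact ⟨h2.1.trans h1.1, h1.2.2.2.trans h2.2⟩

/-! ### The vertices that are not east of a vertical path -/

/-- The vertices that are not east of the southmost vertex of the vertical path `i`. -/
noncomputable def west (F : Frame w h) (i : ℕ) : Finset Pt :=
  F.verts.filter (fun z => z.1 ≤ (F.P (4 * i) 0).1)

lemma mem_west {i : ℕ} {z : Pt} : z ∈ F.west i ↔ z ∈ F.verts ∧ z.1 ≤ (F.P (4 * i) 0).1 := by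
  simp [west]

/-- The hull condition leaves the side open. The cone vertex, strictly south-west of the descending
edge, decides it. -/
lemma vert_hull (hF : F.IsFrameGraph) {i k : ℕ} (hi : i ≤ w) (hk : k < 4 * h) {z : Pt}
    (hz : z ∈ F.west i) : z.2 ≤ ht (F.P (4 * i) (k + 1)) (F.P (4 * i) k) z.1 := by
  have hst := vert_step hF hi hk
  obtain ⟨-, -, -, hside⟩ := hF.vertical_hull i hi k hk
  have hc : SW F.c (F.P (4 * i) k) := c_sw_grid hF (by omega) (by omega) (Or.inl ⟨i, rfl⟩)
  have hc0 : SW F.c (F.P (4 * i) 0) := c_sw_grid hF (by omega) (by omega) (Or.inl ⟨i, rfl⟩)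
  have hcross : 0 < cross (F.P (4 * i) k) (F.P (4 * i) (k + 1)) F.c := by
    have := hc.1
    have := hc.2
    simp only [cross]
    nlinarith
  have hz' : 0 ≤ cross (F.P (4 * i) k) (F.P (4 * i) (k + 1)) z := by
    rcases hside with h0 | h0
    · exact h0 z (mem_west.1 hz)
    · exact absurd hcross (not_lt.2 (h0 F.c ⟨c_mem, hc0.1.le⟩))
  rw [← neg_neg (cross _ _ _), ← cross_swap, cross_eq hst.1.ne] at hz'
  nlinarith [hst.1]

lemma hor_hull (hF : F.IsFrameGraph) {j k : ℕ} (hj : j ≤ h) (hk : k < 4 * w) {z : Pt}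
    (hz : z ∈ F.verts) (hz' : z.2 ≤ (F.P 0 (4 * j)).2) :
    z.2 ≤ ht (F.P k (4 * j)) (F.P (k + 1) (4 * j)) z.1 := by
  have hst := hor_step hF hj hk
  obtain ⟨-, -, -, hside⟩ := hF.horizontal_hull j hj k hk
  have hc : SW F.c (F.P k (4 * j)) := c_sw_grid hF (by omega) (by omega) (Or.inr ⟨j, rfl⟩)
  have hc0 : SW F.c (F.P 0 (4 * j)) := c_sw_grid hF (by omega) (by omega) (Or.inr ⟨j, rfl⟩)
  have hcross : cross (F.P k (4 * j)) (F.P (k + 1) (4 * j)) F.c < 0 := by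
    have := hc.1
    have := hc.2
    simp only [cross]
    nlinarith
  have hz' : cross (F.P k (4 * j)) (F.P (k + 1) (4 * j)) z ≤ 0 := by
    rcases hside with h0 | h0
    · exact absurd hcross (not_lt.2 (h0 F.c ⟨c_mem, hc0.2.le⟩))
    · exact h0 z ⟨hz, hz'⟩
  rw [cross_eq hst.1.ne] at hz'
  nlinarith [hst.1]

/-- Points north-east of a vertex of a vertical path are east of the path. -/
lemma not_mem_west_of_sw (hF : F.IsFrameGraph) {i k : ℕ} (hi : i ≤ w) (hk : k ≤ 4 * h) {z : Pt}
    (hz : SW (F.P (4 * i) k) z) : z ∉ F.west i := by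
  intro hzw
  have hh := hF.h_pos
  rcases Nat.lt_or_ge k (4 * h) with hk' | hk'
  · have h1 := vert_hull hF hi hk' hzw
    have hst := vert_step hF hi hk'
    rw [ht_eq_add _ _ (F.P (4 * i) k).1, ht_right hst.1] at h1
    -- The hull line descends, so a point north-east of one of its points is strictly above it.
    have h2 : sl (F.P (4 * i) (k + 1)) (F.P (4 * i) k) < 0 :=
      div_neg_of_neg_of_pos (by linarith) (by linarith)
    have := hz.1
    have := hz.2
    nlinarith
  · obtain ⟨k, rfl⟩ : ∃ k', k = k' + 1 := ⟨k - 1, by omega⟩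
    have h1 := vert_hull hF hi (k := k) (by omega) hzw
    have hst := vert_step hF hi (k := k) (by omega)
    rw [ht_eq_add _ _ (F.P (4 * i) (k + 1)).1, ht_left] at h1
    have h2 : sl (F.P (4 * i) (k + 1)) (F.P (4 * i) k) < 0 :=
      div_neg_of_neg_of_pos (by linarith) (by linarith)
    have := hz.1
    have := hz.2
    nlinarith

/-- Step diagonally: the corner (i' - 1, j - 1) is south-west of the corner (i', j). The descent
ends at path i, or on the southmost path, where the abscissa alone decides. -/
lemma not_mem_west_of_sw_corner (hF : F.IsFrameGraph) {i i' j : ℕ} (hii : i ≤ i') (hi : i' ≤ w)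
    (hj : j ≤ h) {z : Pt} (hz : SW (F.P (4 * i') (4 * j)) z) : z ∉ F.west i := by
  induction i', hii using Nat.le_induction generalizing j z with
  | base => exact not_mem_west_of_sw hF hi (by omega) hz
  | succ i' hii ih =>
    rcases Nat.eq_zero_or_pos j with rfl | hj0
    · intro hzw
      have h1 := (mem_west.1 hzw).2
      have h2 := (hor_mono hF (j := 0) (Nat.zero_le _) (show 4 * i ≤ 4 * (i' + 1) by omega)
        (by omega)).1
      have := hz.1
      simp only [mul_zero] at h2 this
      linarith
    · obtain ⟨j, rfl⟩ : ∃ j', j = j' + 1 := ⟨j - 1, by omega⟩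
      exact ih (by omega) (j := j) (by omega) ((sw_of_hor hF (by omega) (by omega)
        (show 1 ≤ 4 by omega) le_rfl).trans hz)

lemma vert_not_mem_west (hF : F.IsFrameGraph) {i i' k : ℕ} (hii : i < i') (hi : i' ≤ w)
    (hk : k ≤ 4 * h) : F.P (4 * i') k ∉ F.west i := by
  obtain ⟨i', rfl⟩ : ∃ i'', i' = i'' + 1 := ⟨i' - 1, by omega⟩
  rcases Nat.eq_zero_or_pos k with rfl | hk0
  · intro hzw
    have h1 := (mem_west.1 hzw).2
    have h2 := (hor_mono hF (j := 0) (Nat.zero_le _) (show 4 * i + 1 ≤ 4 * (i' + 1) by omega)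
      (by omega)).1
    have h3 := (hor_step hF (j := 0) (Nat.zero_le _) (show 4 * i < 4 * w by omega)).1
    simp only [mul_zero] at h2 h3
    linarith
  · obtain ⟨j, t, ht1, ht2, rfl⟩ : ∃ j t, 1 ≤ t ∧ t ≤ 4 ∧ k = 4 * j + t :=
      ⟨(k - 1) / 4, (k - 1) % 4 + 1, by omega, by omega, by omega⟩
    exact not_mem_west_of_sw_corner hF (show i ≤ i' by omega) (by omega) (j := j) (by omega)
      (sw_of_vert hF (by omega) (by omega) ht1 ht2)

lemma hor_not_mem_west (hF : F.IsFrameGraph) {i j k : ℕ} (hik : 4 * i < k) (hk : k ≤ 4 * w)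
    (hj : j ≤ h) : F.P k (4 * j) ∉ F.west i := by
  rcases Nat.eq_zero_or_pos j with rfl | hj0
  · intro hzw
    have h1 := (mem_west.1 hzw).2
    have h2 := (hor_mono hF (j := 0) (Nat.zero_le _) (show 4 * i + 1 ≤ k by omega) (by omega)).1
    have h3 := (hor_step hF (j := 0) (Nat.zero_le _) (show 4 * i < 4 * w by omega)).1
    simp only [mul_zero] at h1 h2 h3
    linarith
  · obtain ⟨j, rfl⟩ : ∃ j', j = j' + 1 := ⟨j - 1, by omega⟩
    obtain ⟨i', t, ht1, ht2, rfl⟩ : ∃ j t, 1 ≤ t ∧ t ≤ 4 ∧ k = 4 * j + t :=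
      ⟨(k - 1) / 4, (k - 1) % 4 + 1, by omega, by omega, by omega⟩
    exact not_mem_west_of_sw_corner hF (show i ≤ i' by omega) (by omega) (j := j) (by omega)
      (sw_of_hor hF (by omega) (by omega) ht1 ht2)

lemma pq_not_mem_west (hF : F.IsFrameGraph) {i : ℕ} {i' : Fin w} {j : Fin h} (hii : i ≤ i')
    {z : Pt} (hz : z ∈ F.p i' j ∨ z ∈ F.q i' j) : z ∉ F.west i :=
  not_mem_west_of_sw_corner hF hii i'.2.le j.2.le (sw_of_pq hF hz)

/-- This turns the metric condition defining `west` into bounds on indices, which makes counting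
possible. -/
lemma west_cases (hF : F.IsFrameGraph) {i : ℕ} {z : Pt} (hz : z ∈ F.west i) :
    z = F.c ∨ (∃ i' ≤ w, i' ≤ i ∧ ∃ k ≤ 4 * h, z = F.P (4 * i') k) ∨
    (∃ j ≤ h, ∃ k ≤ 4 * w, k ≤ 4 * i ∧ z = F.P k (4 * j)) ∨
    ∃ (i' : Fin w) (j : Fin h), (i' : ℕ) < i ∧ (z ∈ F.p i' j ∨ z ∈ F.q i' j) := by
  rcases verts_cases (mem_west.1 hz).1 with h0 | ⟨i', hi', k, hk, rfl⟩ | ⟨j, hj, k, hk, rfl⟩ |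
    ⟨i', j, hz'⟩
  · exact Or.inl h0
  · refine Or.inr (Or.inl ⟨i', hi', ?_, k, hk, rfl⟩)
    by_contra hcon
    exact vert_not_mem_west hF (not_le.1 hcon) hi' hk hz
  · refine Or.inr (Or.inr (Or.inl ⟨j, hj, k, hk, ?_, rfl⟩))
    by_contra hcon
    exact hor_not_mem_west hF (not_le.1 hcon) hk hj hz
  · refine Or.inr (Or.inr (Or.inr ⟨i', j, ?_, hz'⟩))
    by_contra hcon
    exact pq_not_mem_west hF (not_lt.1 hcon) hz' hz

/-- Bounds for the vertices of the vertical paths up to the path `i`. -/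
lemma vert_se_bounds (hF : F.IsFrameGraph) {i i' k : ℕ} (hi : i ≤ w) (hii : i' ≤ i)
    (hk : k ≤ 4 * h) : (F.P (4 * i') k).1 ≤ (F.P (4 * i) 0).1 ∧
      (F.P (4 * i) 0).2 ≤ (F.P (4 * i') k).2 := by
  have h1 := vert_mono hF (show i' ≤ w by omega) (Nat.zero_le k) hk
  have h2 := hor_mono hF (j := 0) (Nat.zero_le _) (show 4 * i' ≤ 4 * i by omega) (by omega)
  simp only [mul_zero] at h2
  exact ⟨h1.1.trans h2.1, h2.2.trans h1.2⟩

lemma hor_se_bounds (hF : F.IsFrameGraph) {i j k : ℕ} (hi : i ≤ w) (hki : k ≤ 4 * i)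
    (hj : j ≤ h) : (F.P k (4 * j)).1 ≤ (F.P (4 * i) 0).1 ∧
      (F.P (4 * i) 0).2 ≤ (F.P k (4 * j)).2 := by
  have h1 := hor_mono hF hj hki (by omega)
  have h2 := vert_se_bounds hF hi le_rfl (show 4 * j ≤ 4 * h by omega)
  exact ⟨h1.1.trans h2.1, h2.2.trans h1.2⟩

lemma pq_se_bounds (hF : F.IsFrameGraph) {i : ℕ} {i' : Fin w} {j : Fin h} (hi : i ≤ w)
    (hii : (i' : ℕ) < i) {z : Pt} (hz : z ∈ F.p i' j ∨ z ∈ F.q i' j) :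
    z.1 ≤ (F.P (4 * i) 0).1 ∧ (F.P (4 * i) 0).2 ≤ z.2 := by
  have h1 := pq_bounds hF hz
  have h2 := vert_se_bounds hF hi (show (i' : ℕ) + 1 ≤ i by omega)
    (show 4 * (j : ℕ) ≤ 4 * h by omega)
  rw [mul_add, mul_one] at h2
  exact ⟨h1.2.1.trans h2.1, h2.2.trans h1.2.2.1⟩

lemma vert_mem_west (hF : F.IsFrameGraph) {i i' k : ℕ} (hi : i ≤ w) (hii : i' ≤ i)
    (hk : k ≤ 4 * h) : F.P (4 * i') k ∈ F.west i :=
  mem_west.2 ⟨vert_mem (by omega) hk, (vert_se_bounds hF hi hii hk).1⟩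

lemma hor_mem_west (hF : F.IsFrameGraph) {i j k : ℕ} (hi : i ≤ w) (hki : k ≤ 4 * i)
    (hj : j ≤ h) : F.P k (4 * j) ∈ F.west i :=
  mem_west.2 ⟨hor_mem hj (by omega), (hor_se_bounds hF hi hki hj).1⟩

lemma pq_mem_west (hF : F.IsFrameGraph) {i : ℕ} {i' : Fin w} {j : Fin h} (hi : i ≤ w)
    (hii : (i' : ℕ) < i) {z : Pt} (hz : z ∈ F.p i' j ∨ z ∈ F.q i' j) : z ∈ F.west i :=
  mem_west.2 ⟨mem_verts.2 (Or.inr (Or.inl ⟨_, _, hz⟩)), (pq_se_bounds hF hi hii hz).1⟩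

lemma c_mem_west (hF : F.IsFrameGraph) {i : ℕ} (hi : i ≤ w) : F.c ∈ F.west i :=
  mem_west.2 ⟨c_mem, (c_sw_grid hF (by omega) (by omega) (Or.inl ⟨i, rfl⟩)).1.le⟩

lemma south_bound_west (hF : F.IsFrameGraph) {i : ℕ} (hi : i ≤ w) {z : Pt} (hz : z ∈ F.west i)
    (hzc : z ≠ F.c) : (F.P (4 * i) 0).2 ≤ z.2 := by
  rcases west_cases hF hz with h0 | ⟨i', hi', hii, k, hk, rfl⟩ | ⟨j, hj, k, hk, hki, rfl⟩ |
    ⟨i', j, hii, hz'⟩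
  · exact absurd h0 hzc
  · exact (vert_se_bounds hF hi hii hk).2
  · exact (hor_se_bounds hF hi hki hj).2
  · exact (pq_se_bounds hF hi hii hz').2

/-- The hull of `F.west i`: above, `c`, the northmost horizontal path and the vertical path `i`;
below, the edge from `c` to the southmost vertex of this path. -/
def hullChain (F : Frame w h) (i : ℕ) (s : Bool) (n : ℕ) : Pt :=
  if s then (if n = 0 then F.c else if n ≤ 4 * i + 1 then F.P (n - 1) (4 * h)
    else F.P (4 * i) (4 * h - (n - (4 * i + 1))))
  else (if n = 0 then F.c else F.P (4 * i) 0)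

/-- The number of edges of the two hull chains. -/
def hullLength (h i : ℕ) (s : Bool) : ℕ := if s then 4 * i + 4 * h + 1 else 1

lemma hullChain_cases (i : ℕ) {s : Bool} {n : ℕ} (hn : n < hullLength h i s) :
    (s = true ∧ F.hullChain i s n = F.c ∧ F.hullChain i s (n + 1) = F.P 0 (4 * h)) ∨
    (s = true ∧ ∃ k < 4 * i, F.hullChain i s n = F.P k (4 * h) ∧
      F.hullChain i s (n + 1) = F.P (k + 1) (4 * h)) ∨
    (s = true ∧ ∃ k < 4 * h, F.hullChain i s n = F.P (4 * i) (k + 1) ∧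
      F.hullChain i s (n + 1) = F.P (4 * i) k) ∨
    (s = false ∧ F.hullChain i s n = F.c ∧ F.hullChain i s (n + 1) = F.P (4 * i) 0) := by
  cases s
  · simp only [hullLength] at hn
    norm_num at hn
    subst hn
    simp [hullChain]
  · simp only [hullLength, if_true] at hn
    rcases Nat.eq_zero_or_pos n with rfl | hn0
    · left; simp [hullChain]
    right
    obtain ⟨n, rfl⟩ : ∃ n', n = n' + 1 := ⟨n - 1, by omega⟩
    rcases Nat.lt_or_ge n (4 * i) with hni | hni
    · left
      refine ⟨rfl, n, hni, ?_, ?_⟩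
      · simp [hullChain, show n ≤ 4 * i by omega]
      · simp [hullChain, show n + 1 ≤ 4 * i by omega]
    · right; left
      refine ⟨rfl, 4 * h - (n - 4 * i) - 1, by omega, ?_, ?_⟩
      · rcases eq_or_lt_of_le hni with rfl | hni
        · have : 4 * h - 1 + 1 = 4 * h := by omega
          simp [hullChain, this]
        · simp only [hullChain, if_true, if_neg (show ¬ n + 1 = 0 by omega),
            if_neg (show ¬ n + 1 ≤ 4 * i + 1 by omega)]
          congr 1
          omega
      · simp only [hullChain, if_true, if_neg (show ¬ n + 1 + 1 = 0 by omega),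
            if_neg (show ¬ n + 1 + 1 ≤ 4 * i + 1 by omega)]
        congr 1
        omega

lemma hullChain_zero (i : ℕ) (s : Bool) : F.hullChain i s 0 = F.c := by
  cases s <;> simp [hullChain]

lemma hullChain_last (hF : F.IsFrameGraph) (i : ℕ) (s : Bool) :
    F.hullChain i s (hullLength h i s) = F.P (4 * i) 0 := by
  have := hF.h_pos
  cases s
  · simp [hullChain, hullLength]
  · simp only [hullLength, if_true]
    simp only [hullChain, if_true, if_neg (show ¬ 4 * i + 4 * h + 1 = 0 by omega),
            if_neg (show ¬ 4 * i + 4 * h + 1 ≤ 4 * i + 1 by omega)]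
    congr 1
    omega

/-- The path edges are hull edges by hypothesis. The two edges at the cone vertex ascend: apart from
that vertex, no vertex is west or north of the north-west corner, and none in the set is east or
south of the south end of path i. -/
lemma hullChains (hF : F.IsFrameGraph) {i : ℕ} (hi : i ≤ w) :
    HullChains (F.west i) (F.hullChain i) (hullLength h i) := by
  have hw := hF.w_pos
  have hh := hF.h_pos
  have hc_le : ∀ z ∈ F.verts, F.c.1 ≤ z.1 ∧ F.c.2 ≤ z.2 := by
    intro z hz
    by_cases hz' : z = F.c
    · rw [hz']; exact ⟨le_rfl, le_rfl⟩
    · have := hF.cone z hz hz'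
      exact ⟨this.1.le, this.2.le⟩
  have hcnw : SW F.c (F.P 0 (4 * h)) := c_sw_grid hF (by omega) le_rfl (Or.inl ⟨0, rfl⟩)
  have hcse : SW F.c (F.P (4 * i) 0) := c_sw_grid hF (by omega) (by omega) (Or.inl ⟨i, rfl⟩)
  have hlast : F.P (4 * i) 0 ∈ F.west i := vert_mem_west hF hi le_rfl (Nat.zero_le _)
  have hmem : ∀ s, ∀ n < hullLength h i s, F.hullChain i s n ∈ F.west i := by
    intro s n hn
    rcases hullChain_cases (F := F) i hn with ⟨-, h1, -⟩ | ⟨-, k, hk, h1, -⟩ | ⟨-, k, hk, h1, -⟩ |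
      ⟨-, h1, -⟩ <;> rw [h1]
    · exact c_mem_west hF hi
    · exact hor_mem_west hF hi (by omega) le_rfl
    · exact vert_mem_west hF hi le_rfl (by omega)
    · exact c_mem_west hF hi
  refine ⟨?_, ?_, ?_, ?_, ?_, ?_⟩
  · intro s; cases s <;> simp [hullLength]
  · intro s n hn
    rcases eq_or_lt_of_le hn with rfl | hn
    · rwa [hullChain_last hF]
    · exact hmem s n hn
  · intro s n hn
    rcases hullChain_cases (F := F) i hn with ⟨-, h1, h2⟩ | ⟨-, k, hk, h1, h2⟩ |
      ⟨-, k, hk, h1, h2⟩ | ⟨-, h1, h2⟩ <;> rw [h1, h2]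
    · exact hcnw.1
    · exact (hor_step hF le_rfl (by omega)).1
    · exact (vert_step hF hi hk).1
    · exact hcse.1
  · intro s m hm
    rw [hullChain_zero]
    exact (hc_le m (mem_west.1 hm).1).1
  · intro s m hm
    rw [hullChain_last hF]
    exact (mem_west.1 hm).2
  · intro s n hn z hz
    have hzV := (mem_west.1 hz).1
    rcases hullChain_cases (F := F) i hn with ⟨rfl, h1, h2⟩ | ⟨rfl, k, hk, h1, h2⟩ |
      ⟨rfl, k, hk, h1, h2⟩ | ⟨rfl, h1, h2⟩ <;> rw [h1, h2] <;> simp only [sg, if_true, one_mul]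
    · by_cases hzc : z = F.c
      · rw [hzc, ht_left]
      · have hb := nw_bounds hF hzV hzc
        rw [ht_eq_add _ _ (F.P 0 (4 * h)).1, ht_right hcnw.1]
        have : 0 < sl F.c (F.P 0 (4 * h)) :=
          div_pos (by linarith [hcnw.2]) (by linarith [hcnw.1])
        nlinarith [hb.1, hb.2]
    · refine hor_hull hF le_rfl (by omega) hzV ?_
      by_cases hzc : z = F.c
      · rw [hzc]; exact hcnw.2.le
      · exact (nw_bounds hF hzV hzc).2
    · exact vert_hull hF hi hk hz
    · norm_num
      by_cases hzc : z = F.c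
      · rw [hzc, ht_left]
      · have hb := south_bound_west hF hi hz hzc
        have hb' := (mem_west.1 hz).2
        rw [ht_eq_add _ _ (F.P (4 * i) 0).1, ht_right hcse.1]
        have : 0 < sl F.c (F.P (4 * i) 0) :=
          div_pos (by linarith [hcse.2]) (by linarith [hcse.1])
        nlinarith

/-! ### The frame graph -/

lemma lift_graph_adj {a b : Pt} (ha : a ∈ F.verts) (hb : b ∈ F.verts) (hne : a ≠ b)
    (h : (∃ i ≤ w, ∃ k < 4 * h, a = F.P (4 * i) k ∧ b = F.P (4 * i) (k + 1)) ∨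
      (∃ j ≤ h, ∃ k < 4 * w, a = F.P k (4 * j) ∧ b = F.P (k + 1) (4 * j)) ∨
      (a = F.c ∧ ((∃ k ≤ 4 * h, b = F.P 0 k) ∨ (∃ k ≤ 4 * w, b = F.P k 0)))) :
    (lift F.graph).Adj a b := by
  rw [lift_adj]
  refine ⟨ha, hb, ?_⟩
  rw [graph, SimpleGraph.fromRel_adj]
  exact ⟨fun e => hne (congrArg Subtype.val e), Or.inl h⟩

lemma vert_adj (hF : F.IsFrameGraph) {i k : ℕ} (hi : i ≤ w) (hk : k < 4 * h) :
    (lift F.graph).Adj (F.P (4 * i) k) (F.P (4 * i) (k + 1)) := by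
  refine lift_graph_adj (vert_mem hi hk.le) (vert_mem hi hk) ?_ (Or.inl ⟨i, hi, k, hk, rfl, rfl⟩)
  intro e
  have := (vert_step hF hi hk).1
  rw [e] at this
  exact lt_irrefl _ this

lemma hor_adj (hF : F.IsFrameGraph) {j k : ℕ} (hj : j ≤ h) (hk : k < 4 * w) :
    (lift F.graph).Adj (F.P k (4 * j)) (F.P (k + 1) (4 * j)) := by
  refine lift_graph_adj (hor_mem hj hk.le) (hor_mem hj hk) ?_
    (Or.inr (Or.inl ⟨j, hj, k, hk, rfl, rfl⟩))
  intro e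
  have := (hor_step hF hj hk).1
  rw [e] at this
  exact lt_irrefl _ this

lemma cone_adj_vert (hF : F.IsFrameGraph) {k : ℕ} (hk : k ≤ 4 * h) :
    (lift F.graph).Adj F.c (F.P 0 k) :=
  lift_graph_adj c_mem (grid_mem (by omega) hk (Or.inl ⟨0, rfl⟩))
    (grid_ne_c hF (by omega) hk (Or.inl ⟨0, rfl⟩)).symm
    (Or.inr (Or.inr ⟨rfl, Or.inl ⟨k, hk, rfl⟩⟩))

lemma cone_adj_hor (hF : F.IsFrameGraph) {k : ℕ} (hk : k ≤ 4 * w) :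
    (lift F.graph).Adj F.c (F.P k 0) :=
  lift_graph_adj c_mem (grid_mem hk (by omega) (Or.inr ⟨0, rfl⟩))
    (grid_ne_c hF hk (by omega) (Or.inr ⟨0, rfl⟩)).symm
    (Or.inr (Or.inr ⟨rfl, Or.inr ⟨k, hk, rfl⟩⟩))

lemma lift_mono {V : Finset Pt} {G H : SimpleGraph V} (hGH : G ≤ H) : lift G ≤ lift H :=
  SimpleGraph.map_monotone _ hGH

lemma hullChain_adj (hF : F.IsFrameGraph) {i : ℕ} (hi : i ≤ w) (s : Bool) {n : ℕ}
    (hn : n < hullLength h i s) :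
    (lift F.graph).Adj (F.hullChain i s n) (F.hullChain i s (n + 1)) := by
  rcases hullChain_cases (F := F) i hn with ⟨rfl, h1, h2⟩ | ⟨rfl, k, hk, h1, h2⟩ |
    ⟨rfl, k, hk, h1, h2⟩ | ⟨rfl, h1, h2⟩ <;> rw [h1, h2]
  · exact cone_adj_vert hF le_rfl
  · exact hor_adj hF le_rfl (by omega)
  · exact (vert_adj hF hi hk).symm
  · exact cone_adj_hor hF (by omega)

/-- A PSL graph with the maximum number of edges west of a vertical path contains this path. -/
lemma vert_adj_of_card (hF : F.IsFrameGraph) {T : SimpleGraph F.verts} (hT : IsPSL T) {i : ℕ}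
    (hi : i ≤ w)
    (hcard : 3 * (F.west i).card ≤ (edgesIn (F.west i) (lift T)).card + 4 * i + 4 * h + 5)
    {k : ℕ} (hk : k < 4 * h) : (lift T).Adj (F.P (4 * i) k) (F.P (4 * i) (k + 1)) := by
  have hP : Plane (F.west i) (restrictTo (F.west i) (lift T)) :=
    (plane_lift_of hT.1 hT.2).restrict (Finset.filter_subset _ _)
  -- The upper chain has 1 + 4i edges before it reaches path i, which it then follows southwards;
  -- the path edge between k and k + 1 comes after 4h - k - 1 more edges.
  have hn : 4 * i + 4 * h - k < hullLength h i true := by simp [hullLength]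
  have := (hullChains hF hi).adj_of_card_le hP (by
    rw [edgesIn_restrictTo]; simp only [hullLength, if_true]; norm_num; omega) hn
  have e1 : F.hullChain i true (4 * i + 4 * h - k) = F.P (4 * i) (k + 1) := by
    rcases Nat.lt_or_ge (k + 1) (4 * h) with h1 | h1
    · simp only [hullChain, if_true, if_neg (show ¬ 4 * i + 4 * h - k = 0 by omega),
            if_neg (show ¬ 4 * i + 4 * h - k ≤ 4 * i + 1 by omega)]
      congr 1; omega
    · have h2 : 4 * h = k + 1 := by omega
      simp only [hullChain, if_true, if_neg (show ¬ 4 * i + 4 * h - k = 0 by omega),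
            if_pos (show 4 * i + 4 * h - k ≤ 4 * i + 1 by omega)]
      congr 1
      omega
  have e2 : F.hullChain i true (4 * i + 4 * h - k + 1) = F.P (4 * i) k := by
    simp only [hullChain, if_true, if_neg (show ¬ 4 * i + 4 * h - k + 1 = 0 by omega),
            if_neg (show ¬ 4 * i + 4 * h - k + 1 ≤ 4 * i + 1 by omega)]
    congr 1; omega
  rw [e1, e2] at this
  exact this.1.symm

/-- A maximal PSL graph that contains the frame graph has the maximum number of edges west of each
vertical path. -/
lemma card_le_of_isMaximalPSL (hF : F.IsFrameGraph) {G : SimpleGraph F.verts}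
    (hG : IsMaximalPSL G) (hFG : F.graph ≤ G) {i : ℕ} (hi : i ≤ w) :
    3 * (F.west i).card ≤ (edgesIn (F.west i) (lift G)).card + 4 * i + 4 * h + 5 := by
  have := (hullChains hF hi).card_le_of_maximal (plane_lift_of hG.1.1 hG.1.2)
    (fun v hv k hk hvk hx => adj_of_isMaximalPSL hG hv hk hvk hx)
    (fun z => by rw [hullChain_last hF, mem_west])
    (fun s n hn => lift_mono hFG (hullChain_adj hF hi s hn))
  simp only [hullLength, if_true] at this
  norm_num at this
  omega

end Frame

/-! ### Exchanging the coordinates -/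

section Swap

variable {V V' : Finset Pt}

/-- The map between vertex sets that exchanges the coordinates. -/
def swapVert (hV : ∀ z, z ∈ V' ↔ z.swap ∈ V) (u : V') : V := ⟨(u : Pt).swap, (hV _).1 u.2⟩

/-- A graph with exchanged coordinates. -/
def swapGraph (hV : ∀ z, z ∈ V' ↔ z.swap ∈ V) (G : SimpleGraph V) : SimpleGraph V' :=
  G.comap (swapVert hV)

lemma swap_openSegment {a b z : Pt} (hz : z ∈ openSegment ℝ a b) :
    z.swap ∈ openSegment ℝ a.swap b.swap := by
  obtain ⟨s, t, hs, ht', hst, rfl⟩ := hz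
  exact ⟨s, t, hs, ht', hst, rfl⟩

lemma swap_collinear {a b z : Pt} (h : Collinear ℝ ({a, b, z} : Set Pt)) :
    Collinear ℝ ({a.swap, b.swap, z.swap} : Set Pt) := by
  rw [collinear_iff_of_mem (p₀ := a) (by simp)] at h
  obtain ⟨v, hv⟩ := h
  rw [collinear_iff_of_mem (p₀ := a.swap) (by simp)]
  refine ⟨v.swap, ?_⟩
  intro p hp
  obtain ⟨r, hr⟩ := hv p.swap (by
    simp only [Set.mem_insert_iff, Set.mem_singleton_iff] at hp ⊢
    rcases hp with rfl | rfl | rfl <;> simp)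
  refine ⟨r, ?_⟩
  rw [← Prod.swap_swap p, hr]
  rfl

lemma lift_swapGraph (hV : ∀ z, z ∈ V' ↔ z.swap ∈ V) (G : SimpleGraph V) {a b : Pt} :
    (lift (swapGraph hV G)).Adj a b ↔ (lift G).Adj a.swap b.swap := by
  rw [lift_adj, lift_adj]
  constructor
  · rintro ⟨ha, hb, h⟩
    exact ⟨_, _, h⟩
  · rintro ⟨ha, hb, h⟩
    exact ⟨(hV a).2 ha, (hV b).2 hb, h⟩

lemma isPSL_swapGraph (hV : ∀ z, z ∈ V' ↔ z.swap ∈ V) {G : SimpleGraph V} (hG : IsPSL G) :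
    IsPSL (swapGraph hV G) := by
  obtain ⟨⟨h1, h2, h3⟩, h4⟩ := hG
  have hinj : ∀ {a b : Pt}, a.swap = b.swap → a = b := fun h => Prod.swap_injective h
  refine ⟨⟨?_, ?_, ?_⟩, ?_⟩
  · intro a ha b hb hab
    exact hinj (h2 _ ((hV a).1 ha) _ ((hV b).1 hb) hab)
  · intro a ha b hb hab
    exact hinj (h1 _ ((hV a).1 ha) _ ((hV b).1 hb) hab)
  · intro a ha b hb c hc hab hbc hac hcol
    exact h3 _ ((hV a).1 ha) _ ((hV b).1 hb) _ ((hV c).1 hc) (fun h => hab (hinj h))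
      (fun h => hbc (hinj h)) (fun h => hac (hinj h)) (swap_collinear hcol)
  · intro a b c d hab hcd hne
    rw [Set.disjoint_left]
    intro z hz hz'
    refine Set.disjoint_left.1 (h4 _ _ _ _ hab hcd ?_) (swap_openSegment hz) (swap_openSegment hz')
    intro h
    apply hne
    have : ∀ {u v : V'}, swapVert hV u = swapVert hV v → u = v := fun h =>
      Subtype.ext (hinj (congrArg Subtype.val h))
    rw [Sym2.eq_iff] at h ⊢
    rcases h with ⟨e1, e2⟩ | ⟨e1, e2⟩
    · exact Or.inl ⟨this e1, this e2⟩
    · exact Or.inr ⟨this e1, this e2⟩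

lemma swap_mem_iff (hV : ∀ z, z ∈ V' ↔ z.swap ∈ V) (z : Pt) : z ∈ V ↔ z.swap ∈ V' := by
  rw [hV, Prod.swap_swap]

lemma swapGraph_mono (hV : ∀ z, z ∈ V' ↔ z.swap ∈ V) {G H : SimpleGraph V} (h : G ≤ H) :
    swapGraph hV G ≤ swapGraph hV H := fun _ _ hab => h hab

lemma isMaximalPSL_swapGraph (hV : ∀ z, z ∈ V' ↔ z.swap ∈ V) {G : SimpleGraph V}
    (hG : IsMaximalPSL G) : IsMaximalPSL (swapGraph hV G) := by
  refine ⟨isPSL_swapGraph hV hG.1, ?_⟩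
  intro H hH hle
  exact swapGraph_mono hV
    (hG.2 (isPSL_swapGraph (swap_mem_iff hV) hH) (swapGraph_mono (swap_mem_iff hV) hle))

lemma cardinalDegree_swapGraph (hV : ∀ z, z ∈ V' ↔ z.swap ∈ V) (G : SimpleGraph V) (v : V') :
    cardinalDegree (swapGraph hV G) .west v = cardinalDegree G .south (swapVert hV v) := by
  unfold cardinalDegree
  have hinj : Function.Injective (swapVert hV) := fun u v h =>
    Subtype.ext (Prod.swap_injective (congrArg Subtype.val h))
  rw [← Set.ncard_image_of_injective _ hinj]
  congr 1
  ext u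
  constructor
  · rintro ⟨x, hx, rfl⟩; exact hx
  · intro hu
    exact ⟨swapVert (swap_mem_iff hV) u, hu, rfl⟩

end Swap

namespace Frame

variable {w h : ℕ} {F : Frame w h}

/-- The frame with exchanged coordinates. -/
def transpose (F : Frame w h) : Frame h w where
  P a b := (F.P b a).swap
  -- The exchange swaps the north-west and south-east corners of a cell, and with them the roles of
  -- `p` and `q`.
  p i j := (F.q j i).map Prod.swap
  q i j := (F.p j i).map Prod.swap
  c := F.c.swap

lemma mem_map_swap {o : Option Pt} {z : Pt} : z ∈ o.map Prod.swap ↔ z.swap ∈ o := by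
  cases o with
  | none => simp
  | some a =>
    simp only [Option.map_some, Option.mem_def, Option.some.injEq]
    constructor
    · rintro rfl; simp
    · intro h; rw [h, Prod.swap_swap]

lemma mem_verts_transpose (z : Pt) : z ∈ F.transpose.verts ↔ z.swap ∈ F.verts := by
  have e : ∀ a b : Pt, a.swap = b ↔ a = b.swap := fun a b =>
    ⟨fun h => by rw [← h, Prod.swap_swap], fun h => by rw [h, Prod.swap_swap]⟩
  rw [mem_verts, mem_verts]
  refine or_congr ?_ (or_congr ?_ ?_)
  · constructor
    · rintro ⟨⟨a, b⟩, hx, hz⟩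
      rw [mem_gridIndices] at hx
      exact ⟨(b, a), mem_gridIndices.2 ⟨hx.2.1, hx.1, hx.2.2.symm⟩, (e _ _).1 hz⟩
    · rintro ⟨⟨a, b⟩, hx, hz⟩
      rw [mem_gridIndices] at hx
      exact ⟨(b, a), mem_gridIndices.2 ⟨hx.2.1, hx.1, hx.2.2.symm⟩, (e _ _).2 hz⟩
  · constructor
    · rintro ⟨i, j, hz⟩
      exact ⟨j, i, hz.symm.imp mem_map_swap.1 mem_map_swap.1⟩
    · rintro ⟨i, j, hz⟩
      exact ⟨j, i, hz.symm.imp mem_map_swap.2 mem_map_swap.2⟩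
  · rw [show F.transpose.c = F.c.swap from rfl, eq_comm, e, eq_comm]

lemma graph_transpose : F.transpose.graph = swapGraph mem_verts_transpose F.graph := by
  have e : ∀ a b : Pt, a.swap = b ↔ a = b.swap := fun a b =>
    ⟨fun h => by rw [← h, Prod.swap_swap], fun h => by rw [h, Prod.swap_swap]⟩
  have key : ∀ u v : Pt,
      ((∃ i ≤ h, ∃ k < 4 * w, u = F.transpose.P (4 * i) k ∧ v = F.transpose.P (4 * i) (k + 1)) ∨
      (∃ j ≤ w, ∃ k < 4 * h, u = F.transpose.P k (4 * j) ∧ v = F.transpose.P (k + 1) (4 * j)) ∨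
      (u = F.transpose.c ∧
        ((∃ k ≤ 4 * w, v = F.transpose.P 0 k) ∨ (∃ k ≤ 4 * h, v = F.transpose.P k 0)))) ↔
      ((∃ i ≤ w, ∃ k < 4 * h, u.swap = F.P (4 * i) k ∧ v.swap = F.P (4 * i) (k + 1)) ∨
      (∃ j ≤ h, ∃ k < 4 * w, u.swap = F.P k (4 * j) ∧ v.swap = F.P (k + 1) (4 * j)) ∨
      (u.swap = F.c ∧
        ((∃ k ≤ 4 * h, v.swap = F.P 0 k) ∨ (∃ k ≤ 4 * w, v.swap = F.P k 0)))) := by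
    intro u v
    simp only [e]
    simp only [transpose]
    rw [or_left_comm]
    exact or_congr_right (or_congr_right (and_congr_right' or_comm))
  ext u v
  simp only [swapGraph, SimpleGraph.comap_adj, graph, SimpleGraph.fromRel_adj]
  rw [key, key]
  refine and_congr_left' (not_congr ?_)
  constructor
  · rintro rfl; rfl
  · intro h; exact Subtype.ext (Prod.swap_injective (congrArg Subtype.val h))

lemma xList_transpose (i : Fin h) (j : Fin w) :
    F.transpose.xList i j = (F.yList j i).map Prod.swap := by
  have e : ∀ o : Option Pt, (o.map Prod.swap).toList = o.toList.map Prod.swap := by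
    intro o; cases o <;> rfl
  simp [xList, yList, v, vb, transpose, e]

lemma yList_transpose (i : Fin h) (j : Fin w) :
    F.transpose.yList i j = (F.xList j i).map Prod.swap := by
  have e : ∀ o : Option Pt, (o.map Prod.swap).toList = o.toList.map Prod.swap := by
    intro o; cases o <;> rfl
  simp [xList, yList, v, vb, transpose, e]

lemma cross_swap_swap (a b z : Pt) : cross a.swap b.swap z.swap = - cross a b z := by
  simp only [cross, Prod.fst_swap, Prod.snd_swap]; ring

lemma isHullEdge_swap {S S' : Set Pt} (hS : ∀ z, z ∈ S' ↔ z.swap ∈ S) {a b : Pt}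
    (h : IsHullEdge S a b) : IsHullEdge S' a.swap b.swap := by
  obtain ⟨ha, hb, hne, hside⟩ := h
  refine ⟨(hS _).2 (by rwa [Prod.swap_swap]), (hS _).2 (by rwa [Prod.swap_swap]),
    fun h => hne (Prod.swap_injective h), ?_⟩
  have : ∀ z, cross a.swap b.swap z = - cross a b z.swap := fun z => by
    rw [← cross_swap_swap, Prod.swap_swap]
  simp only [this]
  rcases hside with hs | hs
  · exact Or.inr fun z hz => by linarith [hs _ ((hS z).1 hz)]
  · exact Or.inl fun z hz => by linarith [hs _ ((hS z).1 hz)]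

lemma isFrameGraph_transpose (hF : F.IsFrameGraph) : F.transpose.IsFrameGraph where
  w_pos := hF.h_pos
  h_pos := hF.w_pos
  inj := by
    rintro ⟨a, b⟩ hx ⟨a', b'⟩ hy hxy
    rw [mem_gridIndices] at hx hy
    have := hF.inj (b, a) (mem_gridIndices.2 ⟨hx.2.1, hx.1, hx.2.2.symm⟩) (b', a')
      (mem_gridIndices.2 ⟨hy.2.1, hy.1, hy.2.2.symm⟩) (Prod.swap_injective hxy)
    rw [Prod.mk.injEq] at this ⊢
    exact this.symm
  psl := by
    rw [graph_transpose]
    exact isPSL_swapGraph _ hF.psl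
  xOrder i j := by
    rw [xList_transpose, List.pairwise_map]
    exact hF.yOrder j i
  yOrder i j := by
    rw [yList_transpose, List.pairwise_map]
    exact hF.xOrder j i
  p_side i j z hz := by
    have := hF.q_side j i z.swap (mem_map_swap.1 hz)
    have e1 : F.transpose.vb i j 7 = (F.v j i 7).swap := by simp [vb, v, transpose]
    have e2 : F.transpose.vb i j 3 = (F.v j i 3).swap := by simp [vb, v, transpose]
    -- Exchanging coordinates reverses the orientation, but the ends of the segment trade places
    -- too, so the sign survives.
    rw [e1, e2, ← Prod.swap_swap z, cross_swap_swap, ← cross_swap]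
    exact this
  q_side i j z hz := by
    have := hF.p_side j i z.swap (mem_map_swap.1 hz)
    have e1 : F.transpose.v i j 7 = (F.vb j i 7).swap := by simp [vb, v, transpose]
    have e2 : F.transpose.v i j 3 = (F.vb j i 3).swap := by simp [vb, v, transpose]
    rw [e1, e2, ← Prod.swap_swap z, cross_swap_swap, ← cross_swap]
    exact this
  vertical_hull i hi k hk := isHullEdge_swap (fun z => by
    simp only [Set.mem_ofPred_eq, mem_verts_transpose]; rfl) (hF.horizontal_hull i hi k hk)
  horizontal_hull j hj k hk := isHullEdge_swap (fun z => by
    simp only [Set.mem_ofPred_eq, mem_verts_transpose]; rfl) (hF.vertical_hull j hj k hk)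
  cone z hz hzc := by
    have := hF.cone z.swap ((mem_verts_transpose z).1 hz) (fun h => hzc (by
      rw [← Prod.swap_swap z, h]; rfl))
    exact ⟨this.2, this.1⟩

/-! ### Degree sums -/

/-- The edges with right end b correspond to the west neighbours of b; `hS` ensures that restricting
to S loses none of them. -/
lemma card_fiber_edgesIn {V S : Finset Pt} (G : SimpleGraph V) {b : Pt} (hbS : b ∈ S)
    (hb : b ∈ V) (hS : ∀ a ∈ V, a.1 < b.1 → a ∈ S) :
    ((edgesIn S (lift G)).filter (fun e => e.2 = b)).card = cardinalDegree G .west ⟨b, hb⟩ := by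
  unfold cardinalDegree
  have hinj : Function.Injective (fun u : V => ((u : Pt), b)) := fun u v h =>
    Subtype.ext (Prod.mk.inj h).1
  rw [← Set.ncard_image_of_injective _ hinj, ← Set.ncard_coe_finset]
  congr 1
  ext ⟨x, y⟩
  simp only [Finset.coe_filter, mem_edgesIn, Set.mem_ofPred_eq, Set.mem_image, Prod.mk.injEq,
    LiesIn]
  constructor
  · rintro ⟨⟨h1, h2, h3, h4⟩, rfl⟩
    obtain ⟨hx, hy, hxy⟩ := lift_adj.1 h3
    exact ⟨⟨x, hx⟩, ⟨hxy.symm, h4⟩, rfl, rfl⟩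
  · rintro ⟨u, ⟨h1, h2⟩, rfl, rfl⟩
    exact ⟨⟨hS _ u.2 h2, hbS, (lift_adj_coe u ⟨b, hb⟩).2 h1.symm, h2⟩, rfl⟩

/-- The set is closed under passing to west neighbours. This is how a signature controls the number
of edges inside it. -/
lemma card_edgesIn_west (i : ℕ) (G : SimpleGraph F.verts) :
    (edgesIn (F.west i) (lift G)).card =
      ∑ b ∈ (F.west i).attach, cardinalDegree G .west ⟨b, (mem_west.1 b.2).1⟩ := by
  rw [Finset.card_eq_sum_card_fiberwise (f := Prod.snd) (t := F.west i)
    (fun e he => (mem_edgesIn.1 he).2.1), ← Finset.sum_attach]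
  refine Finset.sum_congr rfl fun b _ => ?_
  exact card_fiber_edgesIn G b.2 (mem_west.1 b.2).1 fun a ha hab =>
    mem_west.2 ⟨ha, hab.le.trans (mem_west.1 b.2).2⟩

/-! ### Counting the edges west of a vertical path -/

/-- The vertices of a cell. -/
noncomputable def cellVerts (F : Frame w h) (i : Fin w) (j : Fin h) : Finset Pt := by
  classical exact (F.xList i j).toFinset

lemma mem_cellVerts {i : Fin w} {j : Fin h} {z : Pt} :
    z ∈ F.cellVerts i j ↔ z ∈ F.xList i j := by
  simp [cellVerts]

/-- The number of interior vertices of a cell. -/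
def interior (F : Frame w h) (i : Fin w) (j : Fin h) : ℕ :=
  (F.p i j).toFinset.card + (F.q i j).toFinset.card

/-- The cells of the first `i` columns. -/
def cellsWest (w h i : ℕ) : Finset (Fin w × Fin h) :=
  Finset.univ.filter (fun x => (x.1 : ℕ) < i)

lemma card_cellsWest {i : ℕ} (hi : i ≤ w) : (cellsWest w h i).card = i * h := by
  have : cellsWest w h i = (Finset.univ.filter (fun x : Fin w => (x : ℕ) < i)) ×ˢ Finset.univ := by
    ext ⟨a, b⟩; simp [cellsWest]
  rw [this, Finset.card_product, Finset.card_univ, Fintype.card_fin, Fin.card_filter_val_lt,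
    min_eq_right hi]

/-- Summands: the cone vertex, i + 1 vertical paths with 4h + 1 vertices each, three further
vertices on each of the i (h + 1) horizontal cell sides, and the interior vertices. -/
lemma card_west_le (hF : F.IsFrameGraph) (i : ℕ) :
    (F.west i).card ≤ 7 * (i * h) + 4 * h + 4 * i + 2 +
      ∑ x ∈ cellsWest w h i, F.interior x.1 x.2 := by
  classical
  set A := (Finset.range (i + 1) ×ˢ Finset.range (4 * h + 1)).image
    (fun x => F.P (4 * x.1) x.2) with hA
  set B := ((Finset.range i ×ˢ Finset.range 3) ×ˢ Finset.range (h + 1)).image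
    (fun x => F.P (4 * x.1.1 + (x.1.2 + 1)) (4 * x.2)) with hB
  set C := (cellsWest w h i).biUnion (fun x => (F.p x.1 x.2).toFinset ∪ (F.q x.1 x.2).toFinset)
    with hC
  have hsub : F.west i ⊆ {F.c} ∪ A ∪ B ∪ C := by
    intro z hz
    simp only [Finset.mem_union, Finset.mem_singleton]
    rcases west_cases hF hz with h0 | ⟨i', hi', hii, k, hk, rfl⟩ | ⟨j, hj, k, hk, hki, rfl⟩ |
      ⟨i', j, hii, hz'⟩
    · exact Or.inl (Or.inl (Or.inl h0))
    · refine Or.inl (Or.inl (Or.inr (Finset.mem_image.2 ⟨(i', k), ?_, rfl⟩)))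
      simp only [Finset.mem_product, Finset.mem_range]; omega
    · by_cases h4 : 4 ∣ k
      · obtain ⟨i', rfl⟩ := h4
        refine Or.inl (Or.inl (Or.inr (Finset.mem_image.2 ⟨(i', 4 * j), ?_, rfl⟩)))
        simp only [Finset.mem_product, Finset.mem_range]; omega
      · refine Or.inl (Or.inr (Finset.mem_image.2 ⟨((k / 4, k % 4 - 1), j), ?_, ?_⟩))
        · simp only [Finset.mem_product, Finset.mem_range]; omega
        · simp only
          congr 1
          omega
    · refine Or.inr (Finset.mem_biUnion.2 ⟨(i', j), by simp [cellsWest, hii], ?_⟩)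
      simpa using hz'
  have hcard := Finset.card_le_card hsub
  have u1 := Finset.card_union_le ({F.c} ∪ A ∪ B) C
  have u2 := Finset.card_union_le ({F.c} ∪ A) B
  have u3 := Finset.card_union_le {F.c} A
  have cA : A.card ≤ (i + 1) * (4 * h + 1) := by
    refine Finset.card_image_le.trans ?_
    simp
  have cB : B.card ≤ i * 3 * (h + 1) := by
    refine Finset.card_image_le.trans ?_
    simp
  have cC : C.card ≤ ∑ x ∈ cellsWest w h i, F.interior x.1 x.2 :=
    Finset.card_biUnion_le.trans (Finset.sum_le_sum fun x _ => Finset.card_union_le _ _)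
  rw [Finset.card_singleton] at u3
  have : 1 + (i + 1) * (4 * h + 1) + i * 3 * (h + 1) = 7 * (i * h) + 4 * h + 4 * i + 2 := by ring
  omega

end Frame

/-! ### Counting frame edges and cell edges -/

namespace Frame

variable {w h : ℕ} {F : Frame w h}

lemma grid_inj (hF : F.IsFrameGraph) {a b a' b' : ℕ} (ha : a ≤ 4 * w) (hb : b ≤ 4 * h)
    (hab : 4 ∣ a ∨ 4 ∣ b) (ha' : a' ≤ 4 * w) (hb' : b' ≤ 4 * h) (hab' : 4 ∣ a' ∨ 4 ∣ b')
    (e : F.P a b = F.P a' b') : a = a' ∧ b = b' := by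
  have := hF.inj (a, b) (mem_gridIndices.2 ⟨ha, hb, hab⟩) (a', b')
    (mem_gridIndices.2 ⟨ha', hb', hab'⟩) e
  exact Prod.mk.inj this

/-- The edges of the frame graph west of the vertical path `i`: vertical, horizontal, and from the
cone vertex. -/
def frameEdge (F : Frame w h) (i : ℕ) :
    (Fin (i + 1) × Fin (4 * h)) ⊕ (Fin (h + 1) × Fin (4 * i)) ⊕ Fin (4 * h + 1) ⊕ Fin (4 * i) →
      Sym2 Pt
  | .inl x => s(F.P (4 * x.1) x.2, F.P (4 * x.1) (x.2 + 1))
  | .inr (.inl x) => s(F.P x.2 (4 * x.1), F.P (x.2 + 1) (4 * x.1))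
  | .inr (.inr (.inl k)) => s(F.c, F.P 0 k)
  -- The shift avoids counting the edge to the south-west corner of the grid twice.
  | .inr (.inr (.inr k)) => s(F.c, F.P (k + 1) 0)

lemma frameEdge_injective (hF : F.IsFrameGraph) {i : ℕ} (hi : i ≤ w) :
    Function.Injective (F.frameEdge i) := by
  have I := @grid_inj w h F hF
  have C := @grid_ne_c w h F hF
  have e4 : ∀ n, 4 ∣ 4 * n := fun n => ⟨n, rfl⟩
  rintro (⟨⟨a, ha⟩, ⟨k, hk⟩⟩ | ⟨⟨a, ha⟩, ⟨k, hk⟩⟩ | ⟨k, hk⟩ | ⟨k, hk⟩)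
    (⟨⟨b, hb⟩, ⟨l, hl⟩⟩ | ⟨⟨b, hb⟩, ⟨l, hl⟩⟩ | ⟨l, hl⟩ | ⟨l, hl⟩) e <;>
  simp only [frameEdge, Sym2.eq_iff] at e <;>
  simp only [Sum.inl.injEq, Sum.inr.injEq, Prod.mk.injEq, Fin.mk.injEq, reduceCtorEq] <;>
  rcases e with ⟨e1, e2⟩ | ⟨e1, e2⟩ <;>
  first
  | (have h1 := I (by omega) (by omega) (by omega) (by omega) (by omega) (by omega) e1
     have h2 := I (by omega) (by omega) (by omega) (by omega) (by omega) (by omega) e2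
     omega)
  | exact absurd e1 (C (by omega) (by omega) (by omega))
  | exact absurd e1.symm (C (by omega) (by omega) (by omega))
  | exact absurd e2 (C (by omega) (by omega) (by omega))
  | (have h2 := I (by omega) (by omega) (by omega) (by omega) (by omega) (by omega) e2
     omega)

lemma frameEdge_adj (hF : F.IsFrameGraph) {i : ℕ} (hi : i ≤ w) (x) :
    ∃ a b, F.frameEdge i x = s(a, b) ∧ (lift F.graph).Adj a b ∧ a ∈ F.west i ∧ b ∈ F.west i := by
  rcases x with ⟨⟨a, ha⟩, ⟨k, hk⟩⟩ | ⟨⟨a, ha⟩, ⟨k, hk⟩⟩ | ⟨k, hk⟩ | ⟨k, hk⟩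
  · exact ⟨_, _, rfl, vert_adj hF (by omega) hk, vert_mem_west hF hi (by omega) (by omega),
      vert_mem_west hF hi (by omega) (by omega)⟩
  · exact ⟨_, _, rfl, hor_adj hF (by omega) (by omega), hor_mem_west hF hi (by omega) (by omega),
      hor_mem_west hF hi (by omega) (by omega)⟩
  · exact ⟨_, _, rfl, cone_adj_vert hF (by omega), c_mem_west hF hi,
      vert_mem_west hF (i' := 0) hi (by omega) (by omega)⟩
  · exact ⟨_, _, rfl, cone_adj_hor hF (by omega), c_mem_west hF hi,
      hor_mem_west hF (j := 0) hi (by omega) (by omega)⟩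

/-- Sets of edges in the cells that are disjoint and as large as Euler's formula predicts for
triangulations of the cells. -/
structure CellEdges (F : Frame w h) (Q : SimpleGraph F.verts)
    (D : Fin w → Fin h → Finset (Sym2 Pt)) : Prop where
  sub : ∀ i j, ∀ e ∈ D i j, e ∈ (lift Q).edgeSet
  mem : ∀ i j, ∀ e ∈ D i j, ∀ z ∈ e, z ∈ F.xList i j
  not_frame : ∀ i j, ∀ e ∈ D i j, e ∉ (lift F.graph).edgeSet
  disj : ∀ i j i' j', (i, j) ≠ (i', j') → Disjoint (D i j) (D i' j')
  -- A triangulated 16-gon has 16 - 3 = 13 diagonals, and each interior vertex adds three edges.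
  card : ∀ i j, 13 + 3 * F.interior i j ≤ (D i j).card

lemma mem_xList {i : Fin w} {j : Fin h} {z : Pt} : z ∈ F.xList i j ↔
    (∃ s, ∃ n ≤ 8, z = F.bd i j s n) ∨ z ∈ F.p i j ∨ z ∈ F.q i j := by
  constructor
  · intro hz
    simp only [xList, List.mem_append, List.mem_cons, List.not_mem_nil, or_false,
      Option.mem_toList] at hz
    have key : ∀ s n, n ≤ 8 → z = F.bd i j s n → (∃ s, ∃ n ≤ 8, z = F.bd i j s n) ∨
      z ∈ F.p i j ∨ z ∈ F.q i j := fun s n hn he => Or.inl ⟨s, n, hn, he⟩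
    rcases hz with (((h1 | h2) | h3) | h4) | h5
    · rcases h1 with h1 | h1 | h1 | h1 | h1
      · exact key false 0 (by omega) (by simpa [bd, v, vb] using h1)
      · exact key false 1 (by omega) (by simpa [bd, v, vb] using h1)
      · exact key false 2 (by omega) (by simpa [bd, v, vb] using h1)
      · exact key false 3 (by omega) (by simpa [bd, v, vb] using h1)
      · exact key false 4 (by omega) (by simpa [bd, v, vb] using h1)
    · exact Or.inr (Or.inl h2)
    · rcases h3 with h1 | h1 | h1 | h1 | h1 | h1 | h1
      · exact key true 1 (by omega) (by simpa [bd, v, vb] using h1)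
      · exact key true 2 (by omega) (by simpa [bd, v, vb] using h1)
      · exact key true 3 (by omega) (by simpa [bd, v, vb] using h1)
      · exact key true 4 (by omega) (by simpa [bd, v, vb] using h1)
      · exact key true 5 (by omega) (by simpa [bd, v, vb] using h1)
      · exact key true 6 (by omega) (by simpa [bd, v, vb] using h1)
      · exact key true 7 (by omega) (by simpa [bd, v, vb] using h1)
    · exact Or.inr (Or.inr h4)
    · rcases h5 with h1 | h1 | h1 | h1
      · exact key false 5 (by omega) (by simpa [bd, v, vb] using h1)
      · exact key false 6 (by omega) (by simpa [bd, v, vb] using h1)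
      · exact key false 7 (by omega) (by simpa [bd, v, vb] using h1)
      · exact key false 8 (by omega) (by simpa [bd, v, vb] using h1)
  · simp only [xList, List.mem_append, List.mem_cons, List.not_mem_nil, or_false,
      Option.mem_toList]
    rintro (⟨s, n, hn, rfl⟩ | hz | hz)
    · cases s <;> interval_cases n <;> simp [bd, v, vb]
    · exact Or.inl (Or.inl (Or.inl (Or.inr hz)))
    · exact Or.inl (Or.inr hz)

lemma mem_yList {i : Fin w} {j : Fin h} {z : Pt} : z ∈ F.yList i j ↔ z ∈ F.xList i j := by
  have e : F.v i j 0 = F.vb i j 0 := by simp [v, vb]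
  simp only [xList, yList, List.mem_append, List.mem_cons, List.not_mem_nil, or_false,
    Option.mem_toList]
  tauto

lemma xList_subset_west (hF : F.IsFrameGraph) {i : Fin w} {j : Fin h} {k : ℕ} (hk : k ≤ w)
    (hik : (i : ℕ) < k) {z : Pt} (hz : z ∈ F.xList i j) : z ∈ F.west k := by
  rcases mem_xList.1 hz with ⟨s, n, hn, rfl⟩ | hz
  · unfold bd
    split_ifs
    · exact hor_mem_west hF (j := j + 1) hk (by omega) (by omega)
    · exact vert_mem_west hF (i' := i + 1) hk (by omega) (by omega)
    · exact vert_mem_west hF hk (by omega) (by omega)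
    · exact hor_mem_west hF hk (by omega) (by omega)
  · exact pq_mem_west hF hk hik hz

/-- A graph with large disjoint sets of edges in the cells has the maximum number of edges west of
each vertical path. -/
lemma CellEdges.card_le (hF : F.IsFrameGraph) {Q : SimpleGraph F.verts} (hFQ : F.graph ≤ Q)
    {D : Fin w → Fin h → Finset (Sym2 Pt)} (hD : F.CellEdges Q D) {i : ℕ} (hi : i ≤ w) :
    3 * (F.west i).card ≤ (edgesIn (F.west i) (lift Q)).card + 4 * i + 4 * h + 5 := by
  classical
  set A := Finset.univ.image (F.frameEdge i) with hA
  set B := (cellsWest w h i).biUnion (fun x => D x.1 x.2) with hB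
  have cA : A.card = (i + 1) * (4 * h) + ((h + 1) * (4 * i) + (4 * h + 1 + 4 * i)) := by
    rw [hA, Finset.card_image_of_injective _ (frameEdge_injective hF hi)]
    simp
  have cB : B.card = ∑ x ∈ cellsWest w h i, (D x.1 x.2).card :=
    Finset.card_biUnion fun x _ y _ hxy => hD.disj _ _ _ _ (by simpa using hxy)
  have hAB : Disjoint A B := by
    rw [Finset.disjoint_left]
    intro e he he'
    obtain ⟨x, -, rfl⟩ := Finset.mem_image.1 he
    obtain ⟨y, -, hy⟩ := Finset.mem_biUnion.1 he'
    obtain ⟨a, b, hab, hadj, -, -⟩ := frameEdge_adj hF hi x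
    refine hD.not_frame _ _ _ hy ?_
    rw [hab]
    exact hadj
  have hsub : A ∪ B ⊆ (edgesIn (F.west i) (lift Q)).image (fun e => s(e.1, e.2)) := by
    have key : ∀ a b, (lift Q).Adj a b → a ∈ F.west i → b ∈ F.west i →
        s(a, b) ∈ (edgesIn (F.west i) (lift Q)).image (fun e => s(e.1, e.2)) := by
      intro a b hab ha hb
      rcases lt_trichotomy a.1 b.1 with hlt | heq | hlt
      · exact Finset.mem_image.2 ⟨(a, b), mem_edgesIn.2 ⟨ha, hb, hab, hlt⟩, rfl⟩
      · exact absurd (hF.psl.1.1 _ (mem_west.1 ha).1 _ (mem_west.1 hb).1 heq) hab.ne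
      · exact Finset.mem_image.2 ⟨(b, a), mem_edgesIn.2 ⟨hb, ha, hab.symm, hlt⟩, Sym2.eq_swap⟩
    intro e he
    rcases Finset.mem_union.1 he with he | he
    · obtain ⟨x, -, rfl⟩ := Finset.mem_image.1 he
      obtain ⟨a, b, hab, hadj, ha, hb⟩ := frameEdge_adj hF hi x
      rw [hab]
      exact key a b (lift_mono hFQ hadj) ha hb
    · obtain ⟨x, hx, he⟩ := Finset.mem_biUnion.1 he
      have hx' : (x.1 : ℕ) < i := by simpa [cellsWest] using hx
      induction e with
      | _ a b =>
        exact key a b (hD.sub _ _ _ he)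
          (xList_subset_west hF hi hx' (hD.mem _ _ _ he a (Sym2.mem_mk_left a b)))
          (xList_subset_west hF hi hx' (hD.mem _ _ _ he b (Sym2.mem_mk_right a b)))
  have hcard := (Finset.card_le_card hsub).trans Finset.card_image_le
  rw [Finset.card_union_of_disjoint hAB, cA, cB] at hcard
  have hsum : ∑ x ∈ cellsWest w h i, (13 + 3 * F.interior x.1 x.2) ≤
      ∑ x ∈ cellsWest w h i, (D x.1 x.2).card :=
    Finset.sum_le_sum fun x _ => hD.card _ _
  rw [Finset.sum_add_distrib, Finset.sum_const, card_cellsWest hi, ← Finset.mul_sum,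
    smul_eq_mul] at hsum
  -- There are 8ih + 8h + 8i + 1 frame edges and at least 13ih + 3n cell edges, with n interior
  -- vertices in all, against at most 7ih + 4h + 4i + 2 + n vertices. Tripling the last number
  -- leaves a difference of at most 4i + 4h + 5.
  have hw := card_west_le hF i
  have : (i + 1) * (4 * h) + ((h + 1) * (4 * i) + (4 * h + 1 + 4 * i)) =
    8 * (i * h) + 8 * h + 8 * i + 1 := by ring
  omega

lemma CellEdges.transpose {Q : SimpleGraph F.verts} {D : Fin w → Fin h → Finset (Sym2 Pt)}
    (hD : F.CellEdges Q D) : F.transpose.CellEdges (swapGraph mem_verts_transpose Q)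
      (fun i j => (D j i).map ⟨Sym2.map Prod.swap, Sym2.map.injective Prod.swap_injective⟩) := by
  have hmem : ∀ (i : Fin h) (j : Fin w) (z : Pt), z ∈ F.transpose.xList i j ↔
      z.swap ∈ F.xList j i := by
    intro i j z
    rw [xList_transpose, ← mem_yList, List.mem_map]
    constructor
    · rintro ⟨a, ha, rfl⟩; rwa [Prod.swap_swap]
    · intro hz; exact ⟨_, hz, Prod.swap_swap z⟩
  have hedge : ∀ (G : SimpleGraph F.verts) (e : Sym2 Pt), Sym2.map Prod.swap e ∈
      (lift (swapGraph mem_verts_transpose G)).edgeSet ↔ e ∈ (lift G).edgeSet := by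
    intro G e
    induction e with
    | _ a b =>
      rw [Sym2.map_mk, SimpleGraph.mem_edgeSet, SimpleGraph.mem_edgeSet]
      exact lift_swapGraph _ G
  constructor
  · intro i j e he
    obtain ⟨e', he', rfl⟩ := Finset.mem_map.1 he
    exact (hedge Q e').2 (hD.sub _ _ _ he')
  · intro i j e he z hz
    obtain ⟨e', he', rfl⟩ := Finset.mem_map.1 he
    obtain ⟨y, hy, rfl⟩ := Sym2.mem_map.1 hz
    rw [hmem, Prod.swap_swap]
    exact hD.mem _ _ _ he' y hy
  · intro i j e he
    obtain ⟨e', he', rfl⟩ := Finset.mem_map.1 he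
    rw [graph_transpose]
    exact fun h => hD.not_frame _ _ _ he' ((hedge F.graph e').1 h)
  · intro i j i' j' hne
    rw [Finset.disjoint_map]
    refine hD.disj _ _ _ _ ?_
    simp only [ne_eq, Prod.mk.injEq] at hne ⊢
    tauto
  · intro i j
    rw [Finset.card_map]
    refine le_trans (le_of_eq ?_) (hD.card j i)
    have e : ∀ o : Option Pt, (o.map Prod.swap).toFinset.card = o.toFinset.card := by
      intro o; cases o <;> rfl
    simp only [interior, Frame.transpose, e]
    ring

end Frame

namespace Frame

variable {w h : ℕ} {F : Frame w h} {i : Fin w} {j : Fin h}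

/-! ### The boundary chains of a cell -/

lemma bd_zero (i j : ℕ) (s : Bool) : F.bd i j s 0 = F.bd i j false 0 := by cases s <;> simp [bd]

lemma bd_last (i j : ℕ) (s : Bool) : F.bd i j s 8 = F.bd i j false 8 := by cases s <;> simp [bd]

lemma bd_adj (hF : F.IsFrameGraph) (i : Fin w) (j : Fin h) (s : Bool) {n : ℕ} (hn : n < 8) :
    (lift F.graph).Adj (F.bd i j s n) (F.bd i j s (n + 1)) := by
  have hi := i.2
  have hj := j.2
  have A := @hor_adj w h F hF (j + 1)
  have B := @hor_adj w h F hF j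
  have C := @vert_adj w h F hF (i + 1)
  have D := @vert_adj w h F hF i
  simp only [mul_add, mul_one] at A C
  cases s <;> interval_cases n <;> simp only [bd, Nat.reduceLeDiff, if_true, if_false,
    Nat.reduceSub, Nat.reduceAdd, Nat.add_zero, Bool.false_eq_true]
  · exact (D (k := 4 * j + 3) (by omega) (by omega)).symm
  · exact (D (k := 4 * j + 2) (by omega) (by omega)).symm
  · exact (D (k := 4 * j + 1) (by omega) (by omega)).symm
  · exact (D (k := 4 * j) (by omega) (by omega)).symm
  · exact B (k := 4 * i) (by omega) (by omega)
  · exact B (k := 4 * i + 1) (by omega) (by omega)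
  · exact B (k := 4 * i + 2) (by omega) (by omega)
  · exact B (k := 4 * i + 3) (by omega) (by omega)
  · exact A (k := 4 * i) (by omega) (by omega)
  · exact A (k := 4 * i + 1) (by omega) (by omega)
  · exact A (k := 4 * i + 2) (by omega) (by omega)
  · exact A (k := 4 * i + 3) (by omega) (by omega)
  · exact (C (k := 4 * j + 3) (by omega) (by omega)).symm
  · exact (C (k := 4 * j + 2) (by omega) (by omega)).symm
  · exact (C (k := 4 * j + 1) (by omega) (by omega)).symm
  · exact (C (k := 4 * j) (by omega) (by omega)).symm

lemma bd_mem (hF : F.IsFrameGraph) (i : Fin w) (j : Fin h) (s : Bool) {n : ℕ} (hn : n ≤ 8) :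
    F.bd i j s n ∈ F.verts := by
  have hP := plane_lift_of hF.psl.1 hF.psl.2
  rcases Nat.lt_or_ge n 8 with h8 | h8
  · exact (hP.supp _ _ (bd_adj hF i j s h8)).1
  · obtain rfl : n = 8 := by omega
    exact (hP.supp _ _ (bd_adj hF i j s (n := 7) (by omega))).2

lemma xList_subset_verts (hF : F.IsFrameGraph) {z : Pt} (hz : z ∈ F.xList i j) :
    z ∈ F.verts := by
  rcases mem_xList.1 hz with ⟨s, n, hn, rfl⟩ | hz | hz
  · exact bd_mem hF i j s hn
  · exact p_mem hz
  · exact q_mem hz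

lemma CellOrder.index_lt (O : F.CellOrder i j) {s : Bool} {m n : ℕ} {x : ℝ} (hm : m ≤ 8)
    (h1 : (F.bd i j s m).1 ≤ x) (h2 : x < (F.bd i j s n).1) : m < n := by
  by_contra hcon
  linarith [O.x_le s (not_lt.1 hcon) hm]

/-- The index of an edge of a boundary chain over a given position. -/
lemma CellOrder.index_eq (O : F.CellOrder i j) {s : Bool} {m n : ℕ} {x : ℝ} (hn : n < 8)
    (hm : m < 8) (h1 : (F.bd i j s m).1 ≤ x) (h2 : x ≤ (F.bd i j s (m + 1)).1)
    (h3 : (F.bd i j s n).1 < x) (h4 : x < (F.bd i j s (n + 1)).1) : m = n := by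
  have a1 := O.index_lt (by omega) h1 h4
  by_contra hne
  linarith [O.x_le s (show m + 1 ≤ n by omega) (by omega)]

lemma CellOrder.y_lt_ht (O : F.CellOrder i j) {z : Pt} {s : Bool} {n : ℕ} (hn : n < 8)
    (h : SW (F.bd i j s n) z) : ht (F.bd i j s n) (F.bd i j s (n + 1)) z.1 < z.2 := by
  rw [ht_eq_sl]
  have h1 := O.x_lt s n hn
  have h2 := O.y_lt s n hn
  have : sl (F.bd i j s n) (F.bd i j s (n + 1)) < 0 :=
    div_neg_of_neg_of_pos (by linarith) (by linarith)
  have := h.1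
  have := h.2
  nlinarith

/-- The west side of a cell is below the first edge of the north side. -/
lemma lower_west_lt (hF : F.IsFrameGraph) (i : Fin w) (j : Fin h) {m : ℕ} (h1 : 1 ≤ m)
    (h4 : m ≤ 4) :
    (F.bd i j false m).2 < ht (F.bd i j true 0) (F.bd i j true 1) (F.bd i j false m).1 := by
  have hP := plane_lift_of hF.psl.1 hF.psl.2
  have O := F.cellOrder hF i j
  -- Induction northwards from the south-west corner. That corner is lower than the lowest point of
  -- the first north edge, and further up the absence of crossings preserves the order.
  obtain ⟨t, rfl⟩ : ∃ t, m = 4 - t := ⟨4 - m, by omega⟩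
  induction t with
  | zero =>
    have e := ht_right (O.x_lt true 0 (by omega))
    have e' := ht_eq_sl (F.bd i j true 0) (F.bd i j true 1)
    have := O.y_lt true 0 (by omega)
    have := O.x_lt true 0 (by omega)
    have := O.x_mid
    have hs : sl (F.bd i j true 0) (F.bd i j true 1) < 0 :=
      div_neg_of_neg_of_pos (by linarith) (by linarith)
    have := O.y_mid.trans_le (O.y_le true (m := 1) (n := 7) (by omega) (by omega))
    rw [zero_add] at *
    rw [e'] at e ⊢
    simp only [tsub_zero]
    nlinarith
  | succ t ih =>
    have ih := ih (by omega) (by omega)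
    generalize hm : 4 - (t + 1) = m at *
    rw [show 4 - t = m + 1 by omega] at ih
    have a1 := O.x_lt false m (by omega)
    have a2 := O.x_le false (m := 0) (n := m) (by omega) (by omega)
    have a3 := O.x_le false (m := m + 1) (n := 4) (by omega) (by omega)
    have a4 := O.x_mid
    have a5 := O.x_lt false 0 (by omega)
    have a6 := O.x_le false (m := 1) (n := m) (by omega) (by omega)
    have a7 := O.x_lt true 0 (by omega)
    rw [zero_add] at *
    rw [← bd_zero i j true] at *
    have := hP.order (bd_adj hF i j false (n := m) (by omega)) a1
      (bd_adj hF i j true (n := 0) (by omega)) a7 (x₀ := (F.bd i j false (m + 1)).1)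
      (x := (F.bd i j false m).1) a1.le le_rfl (by linarith) (by linarith) le_rfl a1.le a2
      (by linarith) (by rw [ht_right a1]; exact ih)
    rw [ht_left] at this
    rcases this with h | ⟨-, ⟨-, h⟩ | ⟨h, -⟩⟩
    · exact h
    · rw [h] at a6; linarith
    · linarith

/-- The south side of a cell is below the last edge of the east side. -/
lemma lower_south_lt (hF : F.IsFrameGraph) (i : Fin w) (j : Fin h) {m : ℕ} (h5 : 5 ≤ m)
    (h7 : m ≤ 7) :
    (F.bd i j false m).2 < ht (F.bd i j true 7) (F.bd i j true 8) (F.bd i j false m).1 := by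
  have hP := plane_lift_of hF.psl.1 hF.psl.2
  have O := F.cellOrder hF i j
  have b1 := O.x_lt true 7 (by omega)
  have e8 := bd_last (F := F) i j true
  have step : ∀ n, 4 ≤ n → n ≤ 6 → ∀ x, (F.bd i j false n).1 ≤ x → (F.bd i j true 7).1 ≤ x →
      x ≤ (F.bd i j false (n + 1)).1 → ht (F.bd i j false n) (F.bd i j false (n + 1)) x <
      ht (F.bd i j true 7) (F.bd i j true 8) x → (F.bd i j false (n + 1)).2 <
      ht (F.bd i j true 7) (F.bd i j true 8) (F.bd i j false (n + 1)).1 := by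
    intro n h4 h6 x g1 g2 g3 g4
    have a1 := O.x_lt false n (by omega)
    have a2 := O.x_le false (m := n + 1) (n := 7) (by omega) (by omega)
    have a3 := O.x_lt false 7 (by omega)
    rw [← e8] at a3
    have := hP.order (bd_adj hF i j false (n := n) (by omega)) a1
      (bd_adj hF i j true (n := 7) (by omega)) b1 (x₀ := x)
      (x := (F.bd i j false (n + 1)).1) g1 g3 g2 (by linarith) a1.le le_rfl (by linarith)
      (by linarith) g4
    rw [ht_right a1] at this
    rcases this with h | ⟨-, ⟨h, -⟩ | ⟨-, h⟩⟩
    · exact h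
    · linarith
    · rw [h] at a2; linarith
  induction m, h5 using Nat.le_induction with
  | base =>
    -- The comparison starts at v₃: the south edge over it descends from the south-west corner,
    -- which is south-west of v₃.
    refine step 4 le_rfl (by omega) (F.bd i j true 7).1
      (O.x_mid.le.trans (O.x_le true (by omega) (by omega))) le_rfl O.x_mid'.le ?_
    rw [ht_left]
    exact O.y_lt_ht (by omega) (O.sw_upper (by omega) (by omega))
  | succ n hn ih =>
    have a1 := O.x_lt false n (by omega)
    refine step n (by omega) (by omega) (F.bd i j false n).1 le_rfl
      (O.x_mid'.le.trans (O.x_le false (by omega) (by omega))) a1.le ?_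
    rw [ht_left]
    exact ih (by omega)

/-- The vertices of a cell are between the boundary chains. -/
lemma between_vert (hF : F.IsFrameGraph) {z : Pt} (hz : z ∈ F.xList i j) :
    BetweenChains (F.bd i j) (fun _ => 8) z.1 z.2 := by
  have O := F.cellOrder hF i j
  have m4 := O.x_mid
  have m5 := O.x_mid'
  -- Vertices off the west and south sides lie over the single lower edge that descends from the
  -- south-west corner, and they are north-east of that corner.
  have hlow : SW (F.bd i j false 4) z → z.1 < (F.bd i j false 5).1 → ∀ n < 8,
      (F.bd i j false n).1 ≤ z.1 → z.1 ≤ (F.bd i j false (n + 1)).1 →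
      sg false * z.2 ≤ sg false * ht (F.bd i j false n) (F.bd i j false (n + 1)) z.1 := by
    intro hsw h5 n hn h1 h2
    obtain rfl := O.index_eq (n := 4) (by omega) hn h1 h2 hsw.1 h5
    have := O.y_lt_ht (by omega) hsw
    simp only [sg]
    norm_num
    exact this.le
  have hup : ∀ m < 8, (F.bd i j true m).1 < z.1 → z.1 < (F.bd i j true (m + 1)).1 →
      z.2 < ht (F.bd i j true m) (F.bd i j true (m + 1)) z.1 → ∀ n < 8,
      (F.bd i j true n).1 ≤ z.1 → z.1 ≤ (F.bd i j true (n + 1)).1 →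
      sg true * z.2 ≤ sg true * ht (F.bd i j true n) (F.bd i j true (n + 1)) z.1 := by
    intro m hm h1 h2 h3 n hn h4 h5
    obtain rfl := O.index_eq hm hn h4 h5 h1 h2
    simp only [sg]
    norm_num
    exact h3.le
  rcases mem_xList.1 hz with ⟨s', m, hm, rfl⟩ | hz | hz
  · have hsame : ∀ s m, m ≤ 8 → ∀ n < 8, (F.bd i j s n).1 ≤ (F.bd i j s m).1 →
        (F.bd i j s m).1 ≤ (F.bd i j s (n + 1)).1 → sg s * (F.bd i j s m).2 ≤
        sg s * ht (F.bd i j s n) (F.bd i j s (n + 1)) (F.bd i j s m).1 := by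
      intro s m hm n hn h1 h2
      have hx := O.x_lt s n hn
      have : m = n ∨ m = n + 1 := by
        by_contra hcon
        rcases Nat.lt_or_ge m n with h3 | h3
        · linarith [O.x_le s (show m + 1 ≤ n by omega) (by omega), O.x_lt s m (by omega)]
        · linarith [O.x_le s (show n + 1 + 1 ≤ m by omega) (by omega),
            O.x_lt s (n + 1) (by omega)]
      rcases this with rfl | rfl
      · rw [ht_left]
      · rw [ht_right hx]
    intro s n hn h1 h2
    by_cases hs : s = s'
    · subst hs
      exact hsame s m hm n hn h1 h2
    by_cases h0 : m = 0
    · subst h0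
      have e : F.bd i j s' 0 = F.bd i j s 0 := by rw [bd_zero, ← bd_zero _ _ s]
      rw [e] at h1 h2 ⊢
      exact hsame s 0 (by omega) n hn h1 h2
    by_cases h8 : m = 8
    · subst h8
      have e : F.bd i j s' 8 = F.bd i j s 8 := by rw [bd_last, ← bd_last _ _ s]
      rw [e] at h1 h2 ⊢
      exact hsame s 8 (by omega) n hn h1 h2
    cases s
    · obtain rfl : s' = true := by cases s' <;> simp_all
      exact hlow (O.sw_upper (by omega) (by omega))
        ((O.x_le true (by omega) (by omega)).trans_lt m5) n hn h1 h2
    · obtain rfl : s' = false := by cases s' <;> simp_all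
      have a0 := O.x_lt false 0 (by omega)
      have a7 := O.x_lt false 7 (by omega)
      rcases Nat.lt_or_ge 4 m with h4 | h4
      · refine hup 7 (by omega) (m5.trans_le (O.x_le false (by omega) (by omega))) ?_
          (lower_south_lt hF i j h4 (by omega)) n hn h1 h2
        rw [bd_last i j true]
        exact (O.x_le false (by omega) (by omega)).trans_lt a7
      · refine hup 0 (by omega) ?_ ((O.x_le false (by omega) (by omega)).trans_lt m4)
          (lower_west_lt hF i j (by omega) h4) n hn h1 h2
        rw [bd_zero i j true]
        exact a0.trans_le (O.x_le false (by omega) (by omega))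
  · have hp := O.x_p z hz
    have s1 := hF.p_side i j z hz
    have e1 : F.vb i j 7 = F.bd i j false 3 := by simp [vb, bd]
    have e2 : F.vb i j 3 = F.bd i j true 1 := by simp [vb, bd]
    have b3 := O.x_lt false 3 (by omega)
    have b0 := O.x_lt true 0 (by omega)
    have b1 := O.x_lt false 0 (by omega)
    have b2 := O.x_le false (m := 1) (n := 3) (by omega) (by omega)
    have b5 : (F.bd i j false 3).1 < (F.bd i j true 1).1 := by linarith
    have b6 := O.x_le true (m := 1) (n := 7) (by omega) (by omega)
    rw [zero_add] at *
    rw [e1, e2, cross_eq b5.ne] at s1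
    have s2 : z.2 < ht (F.bd i j false 3) (F.bd i j true 1) z.1 := by nlinarith
    -- The segment from v̄₇ to v̄₃ runs weakly below the first north edge, hence so does p.
    have s3 := ht_le_of_endpoints (a := F.bd i j false 3) (b := F.bd i j true 1)
      (c := F.bd i j true 0) (d := F.bd i j true 1) (x := (F.bd i j false 3).1)
      (y := (F.bd i j true 1).1) (t := z.1)
      (by rw [ht_left]; exact (lower_west_lt hF i j (by omega) (by omega)).le)
      (by rw [ht_right b5, ht_right b0]) (by linarith) hp.2.le
    intro s
    cases s
    · exact hlow (O.sw_p hz) (by linarith)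
    · refine hup 0 (by omega) ?_ hp.2 (s2.trans_le s3)
      rw [bd_zero i j true]
      linarith
  · have hp := O.x_q z hz
    have s1 := hF.q_side i j z hz
    have e1 : F.v i j 7 = F.bd i j false 5 := by simp [v, bd]
    have e2 : F.v i j 3 = F.bd i j true 7 := by simp [v, bd]
    have b3 := O.x_lt false 5 (by omega)
    have b0 := O.x_lt true 7 (by omega)
    have b1 := O.x_lt false 7 (by omega)
    have b2 := O.x_le false (m := 6) (n := 7) (by omega) (by omega)
    rw [e1, e2, cross_eq m5.ne] at s1
    have s2 : z.2 < ht (F.bd i j true 7) (F.bd i j false 5) z.1 := by nlinarith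
    have s3 := ht_le_of_endpoints (a := F.bd i j true 7) (b := F.bd i j false 5)
      (c := F.bd i j true 7) (d := F.bd i j true 8) (x := (F.bd i j true 7).1)
      (y := (F.bd i j false 5).1) (t := z.1)
      (by rw [ht_left, ht_left])
      (by rw [ht_right m5]; exact (lower_south_lt hF i j (by omega) (by omega)).le) hp.1.le hp.2.le
    intro s
    cases s
    · exact hlow (O.sw_q hz) hp.2
    · refine hup 7 (by omega) hp.1 ?_ (s2.trans_le s3)
      rw [bd_last i j true]
      linarith

/-- The boundary edges of a cell are between the boundary chains. -/
lemma between_edge (hF : F.IsFrameGraph) (i : Fin w) (j : Fin h) (s' : Bool) {m : ℕ} (hm : m < 8)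
    {x : ℝ} (h1 : (F.bd i j s' m).1 ≤ x) (h2 : x ≤ (F.bd i j s' (m + 1)).1) :
    BetweenChains (F.bd i j) (fun _ => 8) x (ht (F.bd i j s' m) (F.bd i j s' (m + 1)) x) := by
  have O := F.cellOrder hF i j
  have hb : ∀ s n, n ≤ 8 → BetweenChains (F.bd i j) (fun _ => 8) (F.bd i j s n).1
      (F.bd i j s n).2 := fun s n hn => between_vert hF (mem_xList.2 (Or.inl ⟨s, n, hn, rfl⟩))
  have hxm := O.x_lt s' m hm
  intro s n hn h3 h4
  have hn : n < 8 := hn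
  have hxn := O.x_lt s n hn
  by_cases hs : s = s'
  · subst hs
    rcases lt_trichotomy m n with h | h | h
    · have := O.x_le s (show m + 1 ≤ n by omega) (by omega)
      have hx : x = (F.bd i j s (m + 1)).1 := by linarith
      rw [hx] at h3 h4 ⊢
      rw [ht_right hxm]
      exact hb s (m + 1) (by omega) s n hn h3 h4
    · rw [h]
    · have := O.x_le s (show n + 1 ≤ m by omega) (by omega)
      have hx : x = (F.bd i j s m).1 := by linarith
      rw [hx] at h3 h4 ⊢
      rw [ht_left]
      exact hb s m (by omega) s n hn h3 h4
  · have hs' : s' = !s := by cases s <;> cases s' <;> simp_all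
    have g : ∀ k, k ≤ 8 → (F.bd i j s' m).1 ≤ (F.bd i j s k).1 →
        (F.bd i j s k).1 ≤ (F.bd i j s' (m + 1)).1 →
        sg s * ht (F.bd i j s' m) (F.bd i j s' (m + 1)) (F.bd i j s k).1 ≤
        sg s * (F.bd i j s k).2 := by
      intro k hk g1 g2
      have := hb s k hk s' m hm g1 g2
      have e : sg s' = - sg s := by rw [hs', sg_not]
      rw [e] at this
      linarith
    -- At each end of the common range one of the two edges ends in a vertex, where `between_vert`
    -- applies. In between, linearity suffices.
    have hlo : sg s * ht (F.bd i j s' m) (F.bd i j s' (m + 1))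
        (max (F.bd i j s' m).1 (F.bd i j s n).1) ≤
        sg s * ht (F.bd i j s n) (F.bd i j s (n + 1))
        (max (F.bd i j s' m).1 (F.bd i j s n).1) := by
      rcases max_cases (F.bd i j s' m).1 (F.bd i j s n).1 with ⟨e, hle⟩ | ⟨e, hle⟩ <;> rw [e]
      · rw [ht_left]
        exact hb s' m (by omega) s n hn hle (by linarith)
      · rw [ht_left (F.bd i j s n)]
        exact g n (by omega) hle.le (by linarith)
    have hhi : sg s * ht (F.bd i j s' m) (F.bd i j s' (m + 1))
        (min (F.bd i j s' (m + 1)).1 (F.bd i j s (n + 1)).1) ≤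
        sg s * ht (F.bd i j s n) (F.bd i j s (n + 1))
        (min (F.bd i j s' (m + 1)).1 (F.bd i j s (n + 1)).1) := by
      rcases min_cases (F.bd i j s' (m + 1)).1 (F.bd i j s (n + 1)).1 with ⟨e, hle⟩ | ⟨e, hle⟩ <;>
        rw [e]
      · rw [ht_right hxm]
        exact hb s' (m + 1) (by omega) s n hn (by linarith) hle
      · rw [ht_right hxn]
        exact g (n + 1) (by omega) (by linarith) hle.le
    exact HullChains.ht_sign_le_of_endpoints (sg_eq s) hlo hhi (max_le h1 h3) (le_min h2 h4)

/-! ### The region of a cell -/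

lemma cycle_bd (i : Fin w) (j : Fin h) {k : ℕ} (hk : k < 16) : ∃ s, ∃ n < 8,
    (F.cycle i j k = F.bd i j s n ∧ F.cycle i j (k + 1) = F.bd i j s (n + 1)) ∨
    (F.cycle i j k = F.bd i j s (n + 1) ∧ F.cycle i j (k + 1) = F.bd i j s n) := by
  rcases Nat.lt_or_ge k 4 with h4 | h4
  · refine ⟨true, 3 - k, by omega, Or.inr ?_⟩
    interval_cases k <;> simp [cycle, bd, v, vb]
  rcases Nat.lt_or_ge k 12 with h12 | h12
  · refine ⟨false, k - 4, by omega, Or.inl ?_⟩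
    interval_cases k <;> simp [cycle, bd, v, vb]
  · refine ⟨true, 19 - k, by omega, Or.inr ?_⟩
    interval_cases k <;> simp [cycle, bd, v]

lemma bd_cycle (i : Fin w) (j : Fin h) (s : Bool) {n : ℕ} (hn : n < 8) : ∃ k < 16,
    (F.cycle i j k = F.bd i j s n ∧ F.cycle i j (k + 1) = F.bd i j s (n + 1)) ∨
    (F.cycle i j k = F.bd i j s (n + 1) ∧ F.cycle i j (k + 1) = F.bd i j s n) := by
  cases s
  · refine ⟨n + 4, by omega, Or.inl ?_⟩
    interval_cases n <;> simp [cycle, bd, v, vb]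
  · rcases Nat.lt_or_ge n 4 with h4 | h4
    · refine ⟨3 - n, by omega, Or.inr ?_⟩
      interval_cases n <;> simp [cycle, bd, v, vb]
    · refine ⟨19 - n, by omega, Or.inr ?_⟩
      interval_cases n <;> simp [cycle, bd, v]

lemma mem_cellCurve {z : Pt} : z ∈ F.cellCurve i j ↔
    ∃ s, ∃ n < 8, z ∈ segment ℝ (F.bd i j s n) (F.bd i j s (n + 1)) := by
  constructor
  · rintro ⟨k, hk, hz⟩
    obtain ⟨s, n, hn, ⟨e1, e2⟩ | ⟨e1, e2⟩⟩ := cycle_bd (F := F) i j hk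
    · rw [e1, e2] at hz; exact ⟨s, n, hn, hz⟩
    · rw [e1, e2, segment_symm] at hz; exact ⟨s, n, hn, hz⟩
  · rintro ⟨s, n, hn, hz⟩
    obtain ⟨k, hk, ⟨e1, e2⟩ | ⟨e1, e2⟩⟩ := bd_cycle (F := F) i j s hn
    · exact ⟨k, hk, by rwa [e1, e2]⟩
    · exact ⟨k, hk, by rwa [e1, e2, segment_symm]⟩

/-- The curve itself lies in the strip between the chains, so its point below z bounds z from the
lower chain and its point above z from the upper one. -/
lemma between_of_mem_cellRegion (hF : F.IsFrameGraph) {z : Pt} (hz : z ∈ F.cellRegion i j) :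
    BetweenChains (F.bd i j) (fun _ => 8) z.1 z.2 := by
  have O := F.cellOrder hF i j
  have key : ∀ a ∈ F.cellCurve i j, BetweenChains (F.bd i j) (fun _ => 8) a.1 a.2 := by
    intro a ha
    obtain ⟨s, n, hn, ha⟩ := mem_cellCurve.1 ha
    obtain ⟨h1, h2, h3⟩ := (mem_segment_ht (O.x_lt s n hn)).1 ha
    rw [h3]
    exact between_edge hF i j s hn h1 h2
  obtain ⟨a, ha, b, hb, e1, e2, h1, h2⟩ := hz
  intro s n hn g1 g2
  cases s
  · have := key a ha false n hn (by rwa [e1]) (by rwa [e1])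
    rw [e1] at this
    simp only [sg] at this ⊢
    norm_num at this ⊢
    linarith
  · have := key b hb true n hn (by rwa [e2]) (by rwa [e2])
    rw [e2] at this
    simp only [sg] at this ⊢
    norm_num at this ⊢
    linarith

lemma mem_cellRegion_of_between (hF : F.IsFrameGraph) {x y : ℝ} (h0 : (F.bd i j false 0).1 ≤ x)
    (h8 : x ≤ (F.bd i j false 8).1) (hb : BetweenChains (F.bd i j) (fun _ => 8) x y) :
    (x, y) ∈ F.cellRegion i j := by
  have O := F.cellOrder hF i j
  obtain ⟨m, hm, a1, a2⟩ := exists_step (f := fun n => (F.bd i j false n).1) (N := 8) (by omega)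
    h0 h8
  rw [← bd_zero i j true] at h0
  rw [← bd_last i j true] at h8
  obtain ⟨n, hn, b1, b2⟩ := exists_step (f := fun n => (F.bd i j true n).1) (N := 8) (by omega)
    h0 h8
  refine ⟨(x, ht (F.bd i j false m) (F.bd i j false (m + 1)) x), ?_,
    (x, ht (F.bd i j true n) (F.bd i j true (n + 1)) x), ?_, rfl, rfl, ?_, ?_⟩
  · exact mem_cellCurve.2 ⟨false, m, hm, (mem_segment_ht (O.x_lt _ m hm)).2 ⟨a1, a2, rfl⟩⟩
  · exact mem_cellCurve.2 ⟨true, n, hn, (mem_segment_ht (O.x_lt _ n hn)).2 ⟨b1, b2, rfl⟩⟩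
  · have := hb false m hm a1 a2
    simp only [sg] at this
    norm_num at this
    exact this
  · have := hb true n hn b1 b2
    simp only [sg] at this
    norm_num at this
    exact this

lemma cellBoundary_adj (hF : F.IsFrameGraph) (i : Fin w) (j : Fin h) (s : Bool) {n : ℕ}
    (hn : n < 8) : (lift (F.cellBoundary i j)).Adj (F.bd i j s n) (F.bd i j s (n + 1)) := by
  have hne := (bd_adj hF i j s hn).ne
  rw [lift_adj]
  refine ⟨bd_mem hF i j s hn.le, bd_mem hF i j s hn, ?_⟩
  rw [cellBoundary, SimpleGraph.fromRel_adj]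
  refine ⟨fun e => hne (congrArg Subtype.val e), ?_⟩
  obtain ⟨k, hk, ⟨e1, e2⟩ | ⟨e1, e2⟩⟩ := bd_cycle (F := F) i j s hn
  · exact Or.inl ⟨k, hk, e1.symm, e2.symm⟩
  · exact Or.inr ⟨k, hk, e1.symm, e2.symm⟩

lemma cell_x_bounds (hF : F.IsFrameGraph) {z : Pt} (hz : z ∈ F.xList i j) :
    (F.bd i j false 0).1 ≤ z.1 ∧ z.1 ≤ (F.bd i j false 8).1 := by
  have O := F.cellOrder hF i j
  rcases mem_xList.1 hz with ⟨s, n, hn, rfl⟩ | hz | hz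
  · have h1 := O.x_le s (Nat.zero_le n) hn
    have h2 := O.x_le s hn le_rfl
    rw [bd_zero] at h1
    rw [bd_last] at h2
    exact ⟨h1, h2⟩
  · have e : F.bd i j false 0 = F.P (4 * i) (4 * j + 4) := by simp [bd]
    have e' : F.bd i j false 8 = F.P (4 * i + 4) (4 * j) := by simp [bd]
    have := pq_bounds hF (Or.inl hz)
    rw [e, e']
    exact ⟨this.1, this.2.1⟩
  · have e : F.bd i j false 0 = F.P (4 * i) (4 * j + 4) := by simp [bd]
    have e' : F.bd i j false 8 = F.P (4 * i + 4) (4 * j) := by simp [bd]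
    have := pq_bounds hF (Or.inr hz)
    rw [e, e']
    exact ⟨this.1, this.2.1⟩

/-- A triangulation of a cell is a maximal plane graph between the boundary chains. -/
lemma chainBounded_cell (hF : F.IsFrameGraph) {H : SimpleGraph F.verts}
    (hH : F.IsCellTriangulation i j H) :
    ChainBounded (F.cellVerts i j) (lift H) (F.bd i j) (fun _ => 8) := by
  have O := F.cellOrder hF i j
  have hP := plane_lift_of hF.psl.1 hH.1.1
  have hsub : ∀ z ∈ F.cellVerts i j, z ∈ F.verts := fun z hz =>
    xList_subset_verts hF (mem_cellVerts.1 hz)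
  constructor
  · refine ⟨fun a ha b hb => hP.xinj a (hsub a ha) b (hsub b hb),
      fun a ha b hb z hz => hP.nocol a (hsub a ha) b (hsub b hb) z (hsub z hz), ?_, hP.nc⟩
    intro a b hab
    obtain ⟨ha, hb, hab⟩ := lift_adj.1 hab
    have := hH.1.2.2 _ _ hab
    exact ⟨mem_cellVerts.2 this.1, mem_cellVerts.2 this.2.1⟩
  · intro s; norm_num
  · intro s n hn
    exact lift_mono hH.1.2.1 (cellBoundary_adj hF i j s hn)
  · exact fun s n hn => O.x_lt s n hn
  · intro s m hm
    rw [bd_zero]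
    exact (cell_x_bounds hF (mem_cellVerts.1 hm)).1
  · intro s m hm
    rw [bd_last]
    exact (cell_x_bounds hF (mem_cellVerts.1 hm)).2
  · exact fun m hm => between_vert hF (mem_cellVerts.1 hm)
  · intro c d hcd x h1 h2
    obtain ⟨hc, hd, hcd'⟩ := lift_adj.1 hcd
    have hlt : c.1 < d.1 :=
      lt_of_le_of_ne (h1.trans h2) fun e => hcd.ne (hF.psl.1.1 _ hc _ hd e)
    exact between_of_mem_cellRegion hF (z := (x, ht c d x))
      ((hH.1.2.2 _ _ hcd').2.2 ((mem_segment_ht hlt).2 ⟨h1, h2, rfl⟩))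
  · intro v hv k hk hvk hcr hbet
    have hv' := mem_cellVerts.1 hv
    have hk' := mem_cellVerts.1 hk
    have hreg : segment ℝ v k ⊆ F.cellRegion i j := by
      intro z hz
      obtain ⟨h1, h2, h3⟩ := (mem_segment_ht hvk).1 hz
      refine mem_cellRegion_of_between hF ((cell_x_bounds hF hv').1.trans h1)
        (h2.trans (cell_x_bounds hF hk').2) ?_
      rcases eq_or_lt_of_le h1 with h1 | h1
      · rw [h3, ← h1, ht_left]
        exact between_vert hF hv'
      rcases eq_or_lt_of_le h2 with h2 | h2
      · rw [h3, h2, ht_right hvk]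
        exact between_vert hF hk'
      · rw [h3]
        exact hbet _ h1 h2
    have hG : F.IsCellGraph i j (H ⊔ SimpleGraph.edge ⟨v, hsub v hv⟩ ⟨k, hsub k hk⟩) := by
      refine ⟨nonCrossing_sup_edge hF.psl.1 hH.1.1 hvk hcr, hH.1.2.1.trans le_sup_left, ?_⟩
      rintro a b (hab | hab)
      · exact hH.1.2.2 a b hab
      · rw [SimpleGraph.edge_adj] at hab
        rcases hab.1 with ⟨rfl, rfl⟩ | ⟨rfl, rfl⟩
        · exact ⟨hv', hk', hreg⟩
        · exact ⟨hk', hv', by rwa [segment_symm]⟩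
    refine lift_adj.2 ⟨hsub v hv, hsub k hk, hH.2 hG le_sup_left (Or.inr ?_)⟩
    rw [SimpleGraph.edge_adj]
    refine ⟨Or.inl ⟨rfl, rfl⟩, ?_⟩
    intro e
    rw [Subtype.mk.injEq] at e
    rw [e] at hvk
    exact lt_irrefl _ hvk

lemma card_cellVerts (hF : F.IsFrameGraph) (i : Fin w) (j : Fin h) :
    (F.cellVerts i j).card = 16 + F.interior i j := by
  classical
  have hnd : (F.xList i j).Nodup := (hF.xOrder i j).imp fun h e => by
    rw [e] at h; exact lt_irrefl _ h
  have : ∀ o : Option Pt, o.toList.length = o.toFinset.card := by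
    intro o; cases o <;> rfl
  unfold cellVerts
  rw [List.toFinset_card_of_nodup hnd]
  simp only [xList, List.length_append, List.length_cons, List.length_nil, this, interior]
  omega

/-- The number comes from 3 (16 + n) - 8 - 8 - 3 = 29 + 3n, with n interior vertices and two chains
of eight edges. -/
lemma card_edges_cell (hF : F.IsFrameGraph) {H : SimpleGraph F.verts}
    (hH : F.IsCellTriangulation i j H) :
    29 + 3 * F.interior i j ≤ (edgesIn (F.cellVerts i j) (lift H)).card := by
  have := (chainBounded_cell hF hH).card_le
  rw [card_cellVerts hF] at this
  omega

/-- The west side and the south side of a cell are reflex, so they have no chords. -/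
lemma not_adj_chord (hF : F.IsFrameGraph) {H : SimpleGraph F.verts}
    (hH : F.IsCellTriangulation i j H) {m m' : ℕ} (hmm : m + 2 ≤ m') (h8 : m' ≤ 8)
    (h4 : m' ≤ 4 ∨ 4 ≤ m) : ¬ (lift H).Adj (F.bd i j false m) (F.bd i j false m') := by
  intro hadj
  have O := F.cellOrder hF i j
  have hC := chainBounded_cell hF hH
  have hi := i.2
  have hj := j.2
  have x1 := O.x_lt false m (by omega)
  have x2 := O.x_lt false (m + 1) (by omega)
  have x3 := O.x_le false hmm h8
  have hmem : ∀ n ≤ 8, F.bd i j false n ∈ F.cellVerts i j := fun n hn =>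
    mem_cellVerts.2 (mem_xList.2 (Or.inl ⟨false, n, hn, rfl⟩))
  have g1 := hC.edges _ _ hadj (F.bd i j false (m + 1)).1 x1.le (by linarith) false m
    (show m < 8 by omega) x1.le le_rfl
  rw [ht_right x1] at g1
  have g2 := hC.plane.nocol _ (hmem m (by omega)) _ (hmem m' h8) _ (hmem (m + 1) (by omega))
    (by linarith) (by intro e; rw [e] at x1; exact lt_irrefl _ x1)
    (by intro e; rw [← e] at x3; linarith)
  -- The side lies on a convex hull, so m' is not above the line through m and m + 1. Hence the
  -- chord passes on or below the vertex m + 1, whereas edges of the triangulation stay above the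
  -- lower chain.
  have g3 : (F.bd i j false m').2 ≤ ht (F.bd i j false m) (F.bd i j false (m + 1))
      (F.bd i j false m').1 := by
    rcases h4 with h4 | h4
    · have hw : F.bd i j false m' ∈ F.west i := by
        simp only [bd, Bool.false_eq_true, if_false, if_pos h4]
        exact vert_mem_west hF hi.le le_rfl (by omega)
      have := vert_hull hF hi.le (k := 4 * j + (3 - m)) (by omega) hw
      have e1 : F.bd i j false m = F.P (4 * i) (4 * j + (3 - m) + 1) := by
        simp only [bd, Bool.false_eq_true, if_false, if_pos (show m ≤ 4 by omega)]
        congr 1; omega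
      have e2 : F.bd i j false (m + 1) = F.P (4 * i) (4 * j + (3 - m)) := by
        simp only [bd, Bool.false_eq_true, if_false, if_pos (show m + 1 ≤ 4 by omega)]
        congr 1; omega
      rw [← e1, ← e2] at this
      exact this
    · have hz : F.bd i j false m' = F.P (4 * i + (m' - 4)) (4 * j) := by
        simp only [bd, Bool.false_eq_true, if_false, if_neg (show ¬ m' ≤ 4 by omega)]
      have := hor_hull hF hj.le (k := 4 * i + (m - 4)) (by omega) (bd_mem hF i j false h8) (by
        rw [hz]
        exact (hor_mono hF hj.le (Nat.zero_le _) (by omega)).2)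
      have e1 : F.bd i j false m = F.P (4 * i + (m - 4)) (4 * j) := by
        rcases eq_or_lt_of_le h4 with rfl | h4
        · simp [bd]
        · simp only [bd, Bool.false_eq_true, if_false, if_neg (show ¬ m ≤ 4 by omega)]
      have e2 : F.bd i j false (m + 1) = F.P (4 * i + (m - 4) + 1) (4 * j) := by
        simp only [bd, Bool.false_eq_true, if_false, if_neg (show ¬ m + 1 ≤ 4 by omega)]
        congr 1; omega
      rw [← e1, ← e2] at this
      exact this
  have g4 := ht_le_of_endpoints (a := F.bd i j false m) (b := F.bd i j false m')
    (c := F.bd i j false m) (d := F.bd i j false (m + 1)) (x := (F.bd i j false m).1)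
    (y := (F.bd i j false m').1) (t := (F.bd i j false (m + 1)).1) (by rw [ht_left, ht_left])
    (by rw [ht_right (by linarith)]; exact g3) x1.le (by linarith)
  rw [ht_right x1] at g4
  simp only [sg] at g1
  norm_num at g1
  exact g2 (le_antisymm g4 g1)

end Frame

namespace Frame

variable {w h : ℕ} {F : Frame w h}

/-! ### Edges shared by cells -/

lemma grid_mem_west_iff (hF : F.IsFrameGraph) {a b i : ℕ} (hi : i ≤ w) (ha : a ≤ 4 * w)
    (hb : b ≤ 4 * h) (hab : 4 ∣ a ∨ 4 ∣ b) : F.P a b ∈ F.west i ↔ a ≤ 4 * i := by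
  rcases hab with ⟨i', rfl⟩ | ⟨j, rfl⟩
  · refine ⟨fun hz => ?_, fun hii => vert_mem_west hF hi (by omega) hb⟩
    by_contra hcon
    exact vert_not_mem_west hF (by omega) (by omega) hb hz
  · refine ⟨fun hz => ?_, fun hii => hor_mem_west hF hi hii (by omega)⟩
    by_contra hcon
    exact hor_not_mem_west hF (not_le.1 hcon) ha (by omega) hz

lemma grid_mem_south_iff (hF : F.IsFrameGraph) {a b j : ℕ} (hj : j ≤ h) (ha : a ≤ 4 * w)
    (hb : b ≤ 4 * h) (hab : 4 ∣ a ∨ 4 ∣ b) :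
    (F.P a b).swap ∈ F.transpose.west j ↔ b ≤ 4 * j :=
  grid_mem_west_iff (isFrameGraph_transpose hF) hj hb ha hab.symm

lemma swap_mem_pq {i : Fin w} {j : Fin h} {z : Pt} (hz : z ∈ F.p i j ∨ z ∈ F.q i j) :
    z.swap ∈ F.transpose.p j i ∨ z.swap ∈ F.transpose.q j i := by
  rw [← Prod.swap_swap z] at hz
  exact hz.symm.imp mem_map_swap.2 mem_map_swap.2

lemma swap_mem_xList {i : Fin w} {j : Fin h} {z : Pt} :
    z.swap ∈ F.transpose.xList j i ↔ z ∈ F.xList i j := by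
  rw [xList_transpose, ← mem_yList, List.mem_map_of_injective Prod.swap_injective]

/-- The indices of the boundary vertices of a cell. -/
lemma bd_eq_grid (F : Frame w h) (i : Fin w) (j : Fin h) (s : Bool) {n : ℕ} (hn : n ≤ 8) :
    ∃ a b, F.bd i j s n = F.P a b ∧ a ≤ 4 * w ∧ b ≤ 4 * h ∧ (4 ∣ a ∨ 4 ∣ b) ∧
      4 * i ≤ a ∧ a ≤ 4 * i + 4 ∧ 4 * j ≤ b ∧ b ≤ 4 * j + 4 ∧
      (a = 4 * i ∨ a = 4 * i + 4 ∨ b = 4 * j ∨ b = 4 * j + 4) := by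
  have hi := i.2
  have hj := j.2
  unfold bd
  split_ifs
  · exact ⟨_, _, rfl, by omega, by omega, by omega, by omega, by omega, by omega, by omega,
      by omega⟩
  · exact ⟨_, _, rfl, by omega, by omega, by omega, by omega, by omega, by omega, by omega,
      by omega⟩
  · exact ⟨_, _, rfl, by omega, by omega, by omega, by omega, by omega, by omega, by omega,
      by omega⟩
  · exact ⟨_, _, rfl, by omega, by omega, by omega, by omega, by omega, by omega, by omega,
      by omega⟩

lemma pq_ne_bd (hF : F.IsFrameGraph) {i : Fin w} {j : Fin h} {z : Pt}
    (hz : z ∈ F.p i j ∨ z ∈ F.q i j) {n : ℕ} (h1 : 1 ≤ n) (h7 : n ≤ 7) :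
    z ≠ F.bd i j true n := by
  rintro rfl
  have O := F.cellOrder hF i j
  rcases hz with hz | hz
  · linarith [(O.x_p _ hz).2, O.x_le true h1 (by omega)]
  · linarith [(O.x_q _ hz).1, O.x_le true h7 (by omega)]

/-- The delicate case is a grid vertex that coincides with `p` or `q`. Membership in the west and
south sets would then place its indices on the north or east side of this same cell, which the cell
order excludes. -/
lemma grid_mem_xList (hF : F.IsFrameGraph) {i : Fin w} {j : Fin h} {a b : ℕ} (ha : a ≤ 4 * w)
    (hb : b ≤ 4 * h) (hab : 4 ∣ a ∨ 4 ∣ b) (hz : F.P a b ∈ F.xList i j) :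
    4 * i ≤ a ∧ a ≤ 4 * i + 4 ∧ 4 * j ≤ b ∧ b ≤ 4 * j + 4 ∧
      (a = 4 * i ∨ a = 4 * i + 4 ∨ b = 4 * j ∨ b = 4 * j + 4) := by
  have hi := i.2
  have hj := j.2
  rcases mem_xList.1 hz with ⟨s, n, hn, e⟩ | hz
  · obtain ⟨a', b', e', ha', hb', hab', h1, h2, h3, h4, h5⟩ := bd_eq_grid F i j s hn
    obtain ⟨rfl, rfl⟩ := grid_inj hF ha hb hab ha' hb' hab' (e.trans e')
    exact ⟨h1, h2, h3, h4, h5⟩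
  · exfalso
    have hT := isFrameGraph_transpose hF
    have a1 := pq_not_mem_west hF le_rfl hz
    rw [grid_mem_west_iff hF hi.le ha hb hab] at a1
    have a2 := pq_mem_west hF (Nat.succ_le_of_lt hi) (Nat.lt_succ_self _) hz
    rw [grid_mem_west_iff hF hi ha hb hab] at a2
    have b1 := pq_not_mem_west hT le_rfl (swap_mem_pq hz)
    rw [grid_mem_south_iff hF hj.le ha hb hab] at b1
    have b2 := pq_mem_west hT (Nat.succ_le_of_lt hj) (Nat.lt_succ_self _) (swap_mem_pq hz)
    rw [grid_mem_south_iff hF hj ha hb hab] at b2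
    by_cases hb4 : b = 4 * j + 4
    · refine pq_ne_bd hF hz (n := a - 4 * i) (by omega) (by omega) ?_
      simp only [bd, if_true, if_pos (show a - 4 * i ≤ 4 by omega)]
      congr 1
      omega
    · refine pq_ne_bd hF hz (n := 4 * j + 8 - b) (by omega) (by omega) ?_
      simp only [bd, if_true, if_neg (show ¬ 4 * j + 8 - b ≤ 4 by omega)]
      congr 1 <;> omega

/-- The boundary edges of a cell. -/
noncomputable def boundaryEdges (F : Frame w h) (i : Fin w) (j : Fin h) : Finset (Sym2 Pt) := by
  classical
  exact Finset.univ.image (fun x : Bool × Fin 8 => s(F.bd i j x.1 x.2, F.bd i j x.1 (x.2 + 1)))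

lemma mem_boundaryEdges {i : Fin w} {j : Fin h} (s : Bool) {n : ℕ} (hn : n < 8) :
    s(F.bd i j s n, F.bd i j s (n + 1)) ∈ F.boundaryEdges i j := by
  classical
  exact Finset.mem_image.2 ⟨(s, ⟨n, hn⟩), Finset.mem_univ _, rfl⟩

lemma card_boundaryEdges_le (F : Frame w h) (i : Fin w) (j : Fin h) :
    (F.boundaryEdges i j).card ≤ 16 := by
  classical
  exact Finset.card_image_le.trans (by simp)

/-- An edge of the frame graph between vertices of a cell is a boundary edge of the cell. -/
lemma frame_edge_mem_boundaryEdges (hF : F.IsFrameGraph) {i : Fin w} {j : Fin h} {a b : Pt}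
    (hab : (lift F.graph).Adj a b) (ha : a ∈ F.xList i j) (hb : b ∈ F.xList i j) :
    s(a, b) ∈ F.boundaryEdges i j := by
  have hi := i.2
  have hj := j.2
  have hc : F.c ∉ F.xList i j := by
    intro hc
    have h1 := (cell_x_bounds hF hc).1
    obtain ⟨a', b', e, ha', hb', hab', -⟩ := bd_eq_grid F i j false (Nat.zero_le 8)
    have h2 := (c_sw_grid hF ha' hb' hab').1
    rw [← e] at h2
    linarith
  have bdE : ∀ (s : Bool) {n : ℕ} {x y : Pt}, n < 8 → x = F.bd i j s n → y = F.bd i j s (n + 1) →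
      s(x, y) ∈ F.boundaryEdges i j := by
    rintro s n x y hn rfl rfl
    exact mem_boundaryEdges s hn
  have key : ∀ a b : Pt, a ∈ F.xList i j → b ∈ F.xList i j →
      ((∃ i ≤ w, ∃ k < 4 * h, a = F.P (4 * i) k ∧ b = F.P (4 * i) (k + 1)) ∨
      (∃ j ≤ h, ∃ k < 4 * w, a = F.P k (4 * j) ∧ b = F.P (k + 1) (4 * j)) ∨
      (a = F.c ∧ ((∃ k ≤ 4 * h, b = F.P 0 k) ∨ (∃ k ≤ 4 * w, b = F.P k 0)))) →
      s(a, b) ∈ F.boundaryEdges i j := by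
    rintro a b ha hb (⟨i', hi', k, hk, rfl, rfl⟩ | ⟨j', hj', k, hk, rfl, rfl⟩ | ⟨rfl, -⟩)
    · have g1 := grid_mem_xList hF (by omega) (by omega) (Or.inl ⟨i', rfl⟩) ha
      have g2 := grid_mem_xList hF (by omega) (by omega) (Or.inl ⟨i', rfl⟩) hb
      rw [Sym2.eq_swap]
      rcases (show 4 * i' = 4 * i ∨ 4 * i' = 4 * i + 4 by omega) with e | e
      · refine bdE false (n := 4 * j + 3 - k) (by omega) ?_ ?_ <;>
          simp only [bd, Bool.false_eq_true, if_false] <;> split_ifs <;> congr 1 <;> omega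
      · refine bdE true (n := 4 * j + 7 - k) (by omega) ?_ ?_ <;>
          simp only [bd, if_true] <;> split_ifs <;> congr 1 <;> omega
    · have g1 := grid_mem_xList hF (by omega) (by omega) (Or.inr ⟨j', rfl⟩) ha
      have g2 := grid_mem_xList hF (by omega) (by omega) (Or.inr ⟨j', rfl⟩) hb
      rcases (show 4 * j' = 4 * j ∨ 4 * j' = 4 * j + 4 by omega) with e | e
      · refine bdE false (n := k + 4 - 4 * i) (by omega) ?_ ?_ <;>
          simp only [bd, Bool.false_eq_true, if_false] <;> split_ifs <;> congr 1 <;> omega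
      · refine bdE true (n := k - 4 * i) (by omega) ?_ ?_ <;>
          simp only [bd, if_true] <;> split_ifs <;> congr 1 <;> omega
    · exact absurd ha hc
  obtain ⟨_, _, hadj⟩ := lift_adj.1 hab
  rcases ((SimpleGraph.fromRel_adj _ _ _).1 hadj).2 with h0 | h0
  · exact key a b ha hb h0
  · rw [Sym2.eq_swap]
    exact key b a hb ha h0

lemma eq_bd_of_mem_west (hF : F.IsFrameGraph) {i : Fin w} {j : Fin h} {z : Pt}
    (hz : z ∈ F.xList i j) (hw : z ∈ F.west i) : ∃ n ≤ 4, z = F.bd i j false n := by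
  have hi := i.2
  rcases mem_xList.1 hz with ⟨s, n, hn, rfl⟩ | hz
  · obtain ⟨a, b, e, ha, hb, hab, h1, h2, h3, h4, h5⟩ := bd_eq_grid F i j s hn
    rw [e] at hw ⊢
    rw [grid_mem_west_iff hF hi.le ha hb hab] at hw
    refine ⟨4 * j + 4 - b, by omega, ?_⟩
    simp only [bd, Bool.false_eq_true, if_false, if_pos (show 4 * j + 4 - b ≤ 4 by omega)]
    congr 1 <;> omega
  · exact absurd hw (pq_not_mem_west hF le_rfl hz)

lemma eq_bd_of_mem_south (hF : F.IsFrameGraph) {i : Fin w} {j : Fin h} {z : Pt}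
    (hz : z ∈ F.xList i j) (hs : z.swap ∈ F.transpose.west j) :
    ∃ n ≤ 8, 4 ≤ n ∧ z = F.bd i j false n := by
  have hj := j.2
  rcases mem_xList.1 hz with ⟨s, n, hn, rfl⟩ | hz
  · obtain ⟨a, b, e, ha, hb, hab, h1, h2, h3, h4, h5⟩ := bd_eq_grid F i j s hn
    rw [e] at hs ⊢
    rw [grid_mem_south_iff hF hj.le ha hb hab] at hs
    refine ⟨a + 4 - 4 * i, by omega, by omega, ?_⟩
    simp only [bd, Bool.false_eq_true, if_false]
    split_ifs with h4
    · congr 1 <;> omega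
    · congr 1 <;> omega
  · exact absurd hs (pq_not_mem_west (isFrameGraph_transpose hF) le_rfl (swap_mem_pq hz))

/-- An edge of a cell triangulation along the west side or along the south side of the cell is
a boundary edge. -/
lemma mem_boundaryEdges_of_adj (hF : F.IsFrameGraph) {i : Fin w} {j : Fin h}
    {H : SimpleGraph F.verts} (hH : F.IsCellTriangulation i j H) {m m' : ℕ} (h8 : m ≤ 8)
    (h8' : m' ≤ 8) (h4 : m ≤ 4 ∧ m' ≤ 4 ∨ 4 ≤ m ∧ 4 ≤ m')
    (hadj : (lift H).Adj (F.bd i j false m) (F.bd i j false m')) :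
    s(F.bd i j false m, F.bd i j false m') ∈ F.boundaryEdges i j := by
  rcases lt_trichotomy m m' with hlt | rfl | hlt
  · rcases eq_or_lt_of_le (Nat.succ_le_of_lt hlt) with rfl | h2
    · exact mem_boundaryEdges false (by omega)
    · exact absurd hadj (not_adj_chord hF hH h2 h8' (by omega))
  · exact absurd rfl hadj.ne
  · rw [Sym2.eq_swap]
    rcases eq_or_lt_of_le (Nat.succ_le_of_lt hlt) with rfl | h2
    · exact mem_boundaryEdges false (by omega)
    · exact absurd hadj.symm (not_adj_chord hF hH h2 h8 (by omega))

/-- The edges of a graph between vertices of a cell that are not boundary edges of the cell. -/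
noncomputable def innerEdges (F : Frame w h) (i : Fin w) (j : Fin h) (H : SimpleGraph F.verts) :
    Finset (Sym2 Pt) := by
  classical
  exact (edgesIn (F.cellVerts i j) (lift H)).image (fun e => s(e.1, e.2)) \ F.boundaryEdges i j

lemma mem_innerEdges {i : Fin w} {j : Fin h} {H : SimpleGraph F.verts} {a b : Pt}
    (he : s(a, b) ∈ F.innerEdges i j H) : (lift H).Adj a b ∧ a ∈ F.xList i j ∧ b ∈ F.xList i j ∧
      s(a, b) ∉ F.boundaryEdges i j := by
  classical
  obtain ⟨h1, h2⟩ := Finset.mem_sdiff.1 he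
  obtain ⟨e, he, heq⟩ := Finset.mem_image.1 h1
  obtain ⟨g1, g2, g3, -⟩ := mem_edgesIn.1 he
  rw [mem_cellVerts] at g1 g2
  rcases Sym2.eq_iff.1 heq with ⟨rfl, rfl⟩ | ⟨rfl, rfl⟩
  · exact ⟨g3, g1, g2, h2⟩
  · exact ⟨g3.symm, g2, g1, h2⟩

lemma card_innerEdges (hF : F.IsFrameGraph) {i : Fin w} {j : Fin h} {H : SimpleGraph F.verts}
    (hH : F.IsCellTriangulation i j H) : 13 + 3 * F.interior i j ≤ (F.innerEdges i j H).card := by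
  classical
  have h1 := card_edges_cell hF hH
  have h2 := card_boundaryEdges_le F i j
  have h3 : ((edgesIn (F.cellVerts i j) (lift H)).image (fun e => s(e.1, e.2))).card =
      (edgesIn (F.cellVerts i j) (lift H)).card := by
    refine Finset.card_image_of_injOn ?_
    rintro ⟨a, b⟩ he ⟨c, d⟩ he' heq
    have g1 := (mem_edgesIn.1 (Finset.mem_coe.1 he)).2.2.2
    have g2 := (mem_edgesIn.1 (Finset.mem_coe.1 he')).2.2.2
    rcases Sym2.eq_iff.1 heq with ⟨e1, e2⟩ | ⟨e1, e2⟩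
    · exact Prod.ext e1 e2
    · simp only at e1 e2 g1 g2
      rw [e1, e2] at g1
      linarith
  have h4 := Finset.le_card_sdiff (F.boundaryEdges i j)
    ((edgesIn (F.cellVerts i j) (lift H)).image (fun e => s(e.1, e.2)))
  rw [h3] at h4
  unfold innerEdges
  omega

/-- In the more eastern (or more northern) of the two cells, both ends of a shared edge lie on the
west (or south) side. That side has no chords, so the edge is a boundary edge. -/
lemma disjoint_innerEdges_of_lt (hF : F.IsFrameGraph) {i i' : Fin w} {j j' : Fin h}
    {H H' : SimpleGraph F.verts} (hH' : F.IsCellTriangulation i' j' H')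
    (hlt : i < i' ∨ i = i' ∧ j < j') :
    Disjoint (F.innerEdges i j H) (F.innerEdges i' j' H') := by
  rw [Finset.disjoint_left]
  intro e he he'
  induction e with
  | _ a b =>
    obtain ⟨-, ha, hb, -⟩ := mem_innerEdges he
    obtain ⟨hadj, ha', hb', hnot⟩ := mem_innerEdges he'
    apply hnot
    rcases hlt with hlt | ⟨-, hlt⟩
    · obtain ⟨m, hm, rfl⟩ := eq_bd_of_mem_west hF ha' (xList_subset_west hF i'.2.le hlt ha)
      obtain ⟨m', hm', rfl⟩ := eq_bd_of_mem_west hF hb' (xList_subset_west hF i'.2.le hlt hb)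
      exact mem_boundaryEdges_of_adj hF hH' (by omega) (by omega) (Or.inl ⟨hm, hm'⟩) hadj
    · have hT := isFrameGraph_transpose hF
      obtain ⟨m, hm, hm4, rfl⟩ := eq_bd_of_mem_south hF ha'
        (xList_subset_west hT j'.2.le hlt (swap_mem_xList.2 ha))
      obtain ⟨m', hm', hm4', rfl⟩ := eq_bd_of_mem_south hF hb'
        (xList_subset_west hT j'.2.le hlt (swap_mem_xList.2 hb))
      exact mem_boundaryEdges_of_adj hF hH' hm hm' (Or.inr ⟨hm4, hm4'⟩) hadj

/-- Triangulations of the cells provide large disjoint sets of edges. -/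
lemma cellEdges_of_triangulations (hF : F.IsFrameGraph) {Q : SimpleGraph F.verts}
    {H : Fin w → Fin h → SimpleGraph F.verts} (hH : ∀ i j, F.IsCellTriangulation i j (H i j))
    (hQ : ∀ i j, H i j ≤ Q) : F.CellEdges Q (fun i j => F.innerEdges i j (H i j)) where
  sub i j e he := by
    induction e with
    | _ a b => exact lift_mono (hQ i j) (mem_innerEdges he).1
  mem i j e he z hz := by
    induction e with
    | _ a b =>
      obtain ⟨-, ha, hb, -⟩ := mem_innerEdges he
      rcases Sym2.mem_iff.1 hz with rfl | rfl
      · exact ha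
      · exact hb
  not_frame i j e he hF' := by
    induction e with
    | _ a b =>
      obtain ⟨-, ha, hb, hnot⟩ := mem_innerEdges he
      exact hnot (frame_edge_mem_boundaryEdges hF hF' ha hb)
  disj i j i' j' hne := by
    rcases lt_trichotomy i i' with hlt | rfl | hlt
    · exact disjoint_innerEdges_of_lt hF (hH i' j') (Or.inl hlt)
    · rcases lt_trichotomy j j' with hlt | rfl | hlt
      · exact disjoint_innerEdges_of_lt hF (hH i j') (Or.inr ⟨rfl, hlt⟩)
      · exact absurd rfl hne
      · exact (disjoint_innerEdges_of_lt hF (hH i j) (Or.inr ⟨rfl, hlt⟩)).symm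
    · exact (disjoint_innerEdges_of_lt hF (hH i j) (Or.inl hlt)).symm
  card i j := card_innerEdges hF (hH i j)

end Frame

namespace Frame

variable {w h : ℕ} {F : Frame w h}

/-! ### Realizations with large degrees -/

lemma vert_adj_of_degree (hF : F.IsFrameGraph) {Q T : SimpleGraph F.verts} (hT : IsPSL T)
    (hdeg : ∀ v, cardinalDegree Q .west v ≤ cardinalDegree T .west v) {i : ℕ} (hi : i ≤ w)
    (hQ : 3 * (F.west i).card ≤ (edgesIn (F.west i) (lift Q)).card + 4 * i + 4 * h + 5)
    {k : ℕ} (hk : k < 4 * h) : (lift T).Adj (F.P (4 * i) k) (F.P (4 * i) (k + 1)) := by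
  refine vert_adj_of_card hF hT hi ?_ hk
  have : (edgesIn (F.west i) (lift Q)).card ≤ (edgesIn (F.west i) (lift T)).card := by
    rw [card_edgesIn_west, card_edgesIn_west]
    exact Finset.sum_le_sum fun b _ => hdeg _
  omega

lemma hor_adj_of_degree (hF : F.IsFrameGraph) {Q T : SimpleGraph F.verts} (hT : IsPSL T)
    (hdeg : ∀ v, cardinalDegree Q .south v ≤ cardinalDegree T .south v) {j : ℕ} (hj : j ≤ h)
    (hQ : 3 * (F.transpose.west j).card ≤ (edgesIn (F.transpose.west j)
      (lift (swapGraph mem_verts_transpose Q))).card + 4 * j + 4 * w + 5)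
    {k : ℕ} (hk : k < 4 * w) : (lift T).Adj (F.P k (4 * j)) (F.P (k + 1) (4 * j)) := by
  have := vert_adj_of_degree (isFrameGraph_transpose hF) (isPSL_swapGraph mem_verts_transpose hT)
    (fun v => by rw [cardinalDegree_swapGraph, cardinalDegree_swapGraph]; exact hdeg _) hj hQ hk
  rw [lift_swapGraph] at this
  exact this

/-! ### The edges at the cone vertex -/

/-- The vertices adjacent to the cone vertex, from the north-west to the south-east corner. -/
def coneChain (F : Frame w h) (n : ℕ) : Pt :=
  if n ≤ 4 * h then F.P 0 (4 * h - n) else F.P (n - 4 * h) 0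

lemma coneChain_cases {n : ℕ} (hn : n < 4 * h + 4 * w) :
    (∃ k < 4 * h, F.coneChain n = F.P (4 * 0) (k + 1) ∧ F.coneChain (n + 1) = F.P (4 * 0) k) ∨
    (∃ k < 4 * w, F.coneChain n = F.P k (4 * 0) ∧ F.coneChain (n + 1) = F.P (k + 1) (4 * 0)) := by
  rcases Nat.lt_or_ge n (4 * h) with h1 | h1
  · refine Or.inl ⟨4 * h - n - 1, by omega, ?_, ?_⟩
    · rw [coneChain, if_pos h1.le]; congr 1; omega
    · rw [coneChain, if_pos (show n + 1 ≤ 4 * h by omega)]; congr 1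
  · refine Or.inr ⟨n - 4 * h, by omega, ?_, ?_⟩
    · rcases eq_or_lt_of_le h1 with h1 | h1
      · rw [coneChain, if_pos h1.symm.le]; congr 1 <;> omega
      · rw [coneChain, if_neg (by omega)]
    · rw [coneChain, if_neg (by omega)]; congr 1; omega

lemma coneChain_step (hF : F.IsFrameGraph) {n : ℕ} (hn : n < 4 * h + 4 * w) :
    (F.coneChain n).1 < (F.coneChain (n + 1)).1 ∧
    (F.coneChain (n + 1)).2 < (F.coneChain n).2 := by
  rcases coneChain_cases (F := F) hn with ⟨k, hk, e1, e2⟩ | ⟨k, hk, e1, e2⟩ <;> rw [e1, e2]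
  · exact vert_step hF (Nat.zero_le _) hk
  · exact hor_step hF (Nat.zero_le _) hk

lemma coneChain_mono (hF : F.IsFrameGraph) {m n : ℕ} (hmn : m ≤ n) (hn : n ≤ 4 * h + 4 * w) :
    (F.coneChain m).1 ≤ (F.coneChain n).1 ∧ (F.coneChain n).2 ≤ (F.coneChain m).2 := by
  induction n, hmn using Nat.le_induction with
  | base => exact ⟨le_rfl, le_rfl⟩
  | succ l hkl ih =>
    have h1 := coneChain_step hF (show l < 4 * h + 4 * w by omega)
    have h2 := ih (by omega)
    exact ⟨h2.1.trans h1.1.le, h1.2.le.trans h2.2⟩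

lemma vert_eq_coneChain {k : ℕ} (hk : k ≤ 4 * h) : F.P 0 k = F.coneChain (4 * h - k) := by
  rw [coneChain, if_pos (by omega)]; congr 1; omega

lemma hor_eq_coneChain {k : ℕ} : F.P k 0 = F.coneChain (4 * h + k) := by
  rcases Nat.eq_zero_or_pos k with rfl | hk
  · simp [coneChain]
  · rw [coneChain, if_neg (by omega)]; congr 1; omega

lemma coneChain_adj (hF : F.IsFrameGraph) {n : ℕ} (hn : n ≤ 4 * h + 4 * w) :
    (lift F.graph).Adj F.c (F.coneChain n) := by
  unfold coneChain
  split_ifs with h1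
  · exact cone_adj_vert hF (by omega)
  · exact cone_adj_hor hF (by omega)

/-- The vertices that are not on the cone chain are north-east of it. -/
lemma exists_coneChain_sw (hF : F.IsFrameGraph) {z : Pt} (hz : z ∈ F.verts) (hzc : z ≠ F.c) :
    ∃ n ≤ 4 * h + 4 * w, z = F.coneChain n ∨ SW (F.coneChain n) z := by
  -- Moving diagonally south-west from corner to corner ends on the cone chain.
  have corner : ∀ i j, i ≤ w → j ≤ h → ∃ n ≤ 4 * h + 4 * w,
      F.P (4 * i) (4 * j) = F.coneChain n ∨ SW (F.coneChain n) (F.P (4 * i) (4 * j)) := by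
    intro i
    induction i with
    | zero =>
      intro j _ hj
      exact ⟨4 * h - 4 * j, by omega, Or.inl (vert_eq_coneChain (by omega))⟩
    | succ i ih =>
      intro j hi hj
      rcases Nat.eq_zero_or_pos j with rfl | hj0
      · exact ⟨4 * h + 4 * (i + 1), by omega, Or.inl hor_eq_coneChain⟩
      · obtain ⟨j, rfl⟩ : ∃ j', j = j' + 1 := ⟨j - 1, by omega⟩
        have hsw := sw_of_hor hF (i := i) (j := j) (t := 4) (by omega) (by omega) (by omega) le_rfl
        obtain ⟨n, hn, e | e⟩ := ih j (by omega) (by omega)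
        · exact ⟨n, hn, Or.inr (by rw [e] at hsw; exact hsw)⟩
        · exact ⟨n, hn, Or.inr (e.trans hsw)⟩
  have fin : ∀ i j, i ≤ w → j ≤ h → SW (F.P (4 * i) (4 * j)) z → ∃ n ≤ 4 * h + 4 * w,
      z = F.coneChain n ∨ SW (F.coneChain n) z := by
    intro i j hi hj hsw
    obtain ⟨n, hn, e | e⟩ := corner i j hi hj
    · exact ⟨n, hn, Or.inr (by rwa [← e])⟩
    · exact ⟨n, hn, Or.inr (e.trans hsw)⟩
  rcases verts_cases hz with h0 | ⟨i, hi, k, hk, rfl⟩ | ⟨j, hj, k, hk, rfl⟩ | ⟨i, j, hz⟩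
  · exact absurd h0 hzc
  · rcases Nat.eq_zero_or_pos i with rfl | hi0
    · exact ⟨4 * h - k, by omega, Or.inl (vert_eq_coneChain hk)⟩
    rcases Nat.eq_zero_or_pos k with rfl | hk0
    · exact ⟨4 * h + 4 * i, by omega, Or.inl hor_eq_coneChain⟩
    obtain ⟨i, rfl⟩ : ∃ i', i = i' + 1 := ⟨i - 1, by omega⟩
    obtain ⟨j, t, ht1, ht2, rfl⟩ : ∃ j t, 1 ≤ t ∧ t ≤ 4 ∧ k = 4 * j + t :=
      ⟨(k - 1) / 4, (k - 1) % 4 + 1, by omega, by omega, by omega⟩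
    exact fin i j (by omega) (by omega) (sw_of_vert hF (by omega) (by omega) ht1 ht2)
  · rcases Nat.eq_zero_or_pos j with rfl | hj0
    · exact ⟨4 * h + k, by omega, Or.inl hor_eq_coneChain⟩
    rcases Nat.eq_zero_or_pos k with rfl | hk0
    · exact ⟨4 * h - 4 * j, by omega, Or.inl (vert_eq_coneChain (by omega))⟩
    obtain ⟨j, rfl⟩ : ∃ j', j = j' + 1 := ⟨j - 1, by omega⟩
    obtain ⟨i, t, ht1, ht2, rfl⟩ : ∃ j t, 1 ≤ t ∧ t ≤ 4 ∧ k = 4 * j + t :=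
      ⟨(k - 1) / 4, (k - 1) % 4 + 1, by omega, by omega, by omega⟩
    exact fin i j (by omega) (by omega) (sw_of_hor hF (by omega) (by omega) ht1 ht2)
  · exact fin i j i.2.le j.2.le (sw_of_pq hF hz)

/-- If a plane graph contains the cone chain, then no edge from the cone vertex crosses it. -/
lemma mem_coneChain_of_adj (hF : F.IsFrameGraph) {T : SimpleGraph F.verts} (hT : IsPSL T)
    (hchain : ∀ n < 4 * h + 4 * w, (lift T).Adj (F.coneChain n) (F.coneChain (n + 1)))
    {z : Pt} (hadj : (lift T).Adj F.c z) : ∃ n ≤ 4 * h + 4 * w, z = F.coneChain n := by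
  by_contra hcon
  push Not at hcon
  have hw := hF.w_pos
  have hP := plane_lift_of hT.1 hT.2
  obtain ⟨hc, hz⟩ := hP.supp _ _ hadj
  have hzc : z ≠ F.c := hadj.ne.symm
  have hcz := hF.cone z hz hzc
  obtain ⟨m, hm, e | hsw⟩ := exists_coneChain_sw hF hz hzc
  · exact hcon m hm e
  have hsl : 0 < sl F.c z := div_pos (by linarith) (by linarith)
  have hcx : ∀ n ≤ 4 * h + 4 * w, F.c.1 < (F.coneChain n).1 := fun n hn =>
    (hF.cone _ ((lift_adj.1 (coneChain_adj hF hn)).2.1) (coneChain_adj hF hn).ne.symm).1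
  have hW0 : F.coneChain 0 = F.P 0 (4 * h) := by simp [coneChain]
  have hWN : F.coneChain (4 * h + 4 * w) = F.P (4 * w) 0 := hor_eq_coneChain.symm
  have hb := nw_bounds hF hz hzc
  have hb' := (nw_bounds (isFrameGraph_transpose hF) ((mem_verts_transpose z.swap).2 (by
    rwa [Prod.swap_swap])) (fun e => hzc (Prod.swap_injective e))).2
  replace hb' : z.1 ≤ (F.coneChain (4 * h + 4 * w)).1 := by rw [hWN]; exact hb'
  rw [← hW0] at hb
  have hno : ∀ n ≤ 4 * h + 4 * w, ht F.c z (F.coneChain n).1 ≠ (F.coneChain n).2 := by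
    intro n hn
    exact hP.nocol _ hc _ hz _ ((lift_adj.1 (coneChain_adj hF hn)).2.1) hcz.1
      (coneChain_adj hF hn).ne.symm (hcon n hn).symm
  -- The edge cz ascends, and z is not north of the first chain vertex, so cz starts below the
  -- chain. It cannot cross the chain before reaching z.
  have hbelow : ∀ n ≤ 4 * h + 4 * w, (F.coneChain n).1 < z.1 →
      ht F.c z (F.coneChain n).1 < (F.coneChain n).2 := by
    intro n
    induction n with
    | zero =>
      intro hn hlt
      refine lt_of_le_of_ne ?_ (hno 0 hn)
      have e := ht_eq_add F.c z (F.coneChain 0).1 z.1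
      rw [ht_right hcz.1] at e
      nlinarith
    | succ n ih =>
      intro hn hlt
      have hst := (coneChain_step hF (show n < 4 * h + 4 * w by omega)).1
      have := ih (by omega) (by linarith)
      have := hP.below_chain_step (s := 1) (Or.inl rfl) (hchain n (by omega)) hst hadj
        (x := (F.coneChain n).1) le_rfl hst.le (hcx n (by omega)) hlt
        (by rw [ht_left]; linarith)
      linarith
  obtain ⟨n, hn, h1, h2⟩ := exists_step (f := fun n => (F.coneChain n).1) (by omega) hb.1 hb'
  have hst := coneChain_step hF hn
  have hn1 : (F.coneChain n).1 < z.1 := lt_of_le_of_ne h1 fun e =>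
    hcon n hn.le (hP.xinj _ hz _ (lift_adj.1 (coneChain_adj hF hn.le)).2.1 e.symm)
  have hmn : m ≤ n := by
    by_contra hlt
    have := (coneChain_mono hF (show n + 1 ≤ m by omega) hm).1
    linarith [hsw.1]
  have hlow := hbelow n hn.le hn1
  have hord := hP.order hadj hcz.1 (hchain n hn) hst.1 (x₀ := (F.coneChain n).1) (x := z.1)
    (hcx n hn.le).le hn1.le le_rfl hst.1.le hcz.1.le le_rfl h1 h2 (by rw [ht_left]; exact hlow)
  -- The chain descends, so over z it is no higher than its earlier vertex m, which is south of z.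
  -- This contradicts cz staying below the chain up to z.
  have hle : ht (F.coneChain n) (F.coneChain (n + 1)) z.1 ≤ (F.coneChain n).2 := by
    rw [ht_eq_sl]
    have : sl (F.coneChain n) (F.coneChain (n + 1)) < 0 :=
      div_neg_of_neg_of_pos (by linarith [hst.2]) (by linarith [hst.1])
    nlinarith
  rw [ht_right hcz.1] at hord
  have hmy := (coneChain_mono hF hmn hn.le).2
  have := hsw.2
  rcases hord with hord | hord
  · linarith
  · linarith [hord.1]

/-- If the degrees of a plane graph are at least those of a graph with the maximum number of edges
west of each vertical and south of each horizontal path, then it contains the frame graph. -/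
theorem graph_le_of_degree (hF : F.IsFrameGraph) {Q T : SimpleGraph F.verts} (hFQ : F.graph ≤ Q)
    (hT : IsPSL T) (hdeg : ∀ D v, cardinalDegree Q D v ≤ cardinalDegree T D v)
    (hQw : ∀ i ≤ w, 3 * (F.west i).card ≤
      (edgesIn (F.west i) (lift Q)).card + 4 * i + 4 * h + 5)
    (hQs : ∀ j ≤ h, 3 * (F.transpose.west j).card ≤ (edgesIn (F.transpose.west j)
      (lift (swapGraph mem_verts_transpose Q))).card + 4 * j + 4 * w + 5) : F.graph ≤ T := by
  have hver : ∀ i ≤ w, ∀ k < 4 * h, (lift T).Adj (F.P (4 * i) k) (F.P (4 * i) (k + 1)) :=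
    fun i hi k hk => vert_adj_of_degree hF hT (hdeg .west) hi (hQw i hi) hk
  have hhor : ∀ j ≤ h, ∀ k < 4 * w, (lift T).Adj (F.P k (4 * j)) (F.P (k + 1) (4 * j)) :=
    fun j hj k hk => hor_adj_of_degree hF hT (hdeg .south) hj (hQs j hj) hk
  have hchain : ∀ n < 4 * h + 4 * w,
      (lift T).Adj (F.coneChain n) (F.coneChain (n + 1)) := by
    intro n hn
    rcases coneChain_cases (F := F) hn with ⟨k, hk, e1, e2⟩ | ⟨k, hk, e1, e2⟩ <;> rw [e1, e2]
    · exact (hver 0 (Nat.zero_le _) k hk).symm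
    · exact hhor 0 (Nat.zero_le _) k hk
  set c : F.verts := ⟨F.c, c_mem⟩ with hc
  -- All other vertices are north of the cone vertex. Its neighbours in T lie among its frame
  -- neighbours, which are neighbours in Q; since its north-degree in T is at least that in Q, the
  -- first inclusion is an equality.
  have hsub : {u : F.verts | T.Adj c u ∧ LiesIn (u : Pt) .north (c : Pt)} ⊆
      {u : F.verts | F.graph.Adj c u ∧ LiesIn (u : Pt) .north (c : Pt)} := by
    rintro u ⟨h1, h2⟩
    refine ⟨?_, h2⟩
    obtain ⟨n, hn, e⟩ := mem_coneChain_of_adj hF hT hchain ((lift_adj_coe c u).2 h1)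
    rw [← lift_adj_coe, e]
    exact coneChain_adj hF hn
  have hFQc : {u : F.verts | F.graph.Adj c u ∧ LiesIn (u : Pt) .north (c : Pt)} ⊆
      {u : F.verts | Q.Adj c u ∧ LiesIn (u : Pt) .north (c : Pt)} :=
    fun u hu => ⟨hFQ hu.1, hu.2⟩
  have heq := Set.eq_of_subset_of_ncard_le hsub
    ((Set.ncard_le_ncard hFQc).trans (hdeg .north c))
  have hcone : ∀ n ≤ 4 * h + 4 * w, (lift T).Adj F.c (F.coneChain n) := by
    intro n hn
    obtain ⟨h1, h2, h3⟩ := lift_adj.1 (coneChain_adj hF hn)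
    have : (⟨F.coneChain n, h2⟩ : F.verts) ∈
        {u : F.verts | F.graph.Adj c u ∧ LiesIn (u : Pt) .north (c : Pt)} :=
      ⟨h3, (hF.cone _ h2 (coneChain_adj hF hn).ne.symm).2⟩
    rw [← heq] at this
    exact lift_adj.2 ⟨h1, h2, this.1⟩
  have key : ∀ a b : Pt,
      ((∃ i ≤ w, ∃ k < 4 * h, a = F.P (4 * i) k ∧ b = F.P (4 * i) (k + 1)) ∨
      (∃ j ≤ h, ∃ k < 4 * w, a = F.P k (4 * j) ∧ b = F.P (k + 1) (4 * j)) ∨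
      (a = F.c ∧ ((∃ k ≤ 4 * h, b = F.P 0 k) ∨ (∃ k ≤ 4 * w, b = F.P k 0)))) →
      (lift T).Adj a b := by
    rintro a b (⟨i, hi, k, hk, rfl, rfl⟩ | ⟨j, hj, k, hk, rfl, rfl⟩ |
      ⟨rfl, ⟨k, hk, rfl⟩ | ⟨k, hk, rfl⟩⟩)
    · exact hver i hi k hk
    · exact hhor j hj k hk
    · rw [vert_eq_coneChain hk]
      exact hcone _ (by omega)
    · rw [hor_eq_coneChain]
      exact hcone _ (by omega)
  intro u v huv
  rw [← lift_adj_coe]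
  rcases ((SimpleGraph.fromRel_adj _ _ _).1 huv).2 with h0 | h0
  · exact key _ _ h0
  · exact (key _ _ h0).symm

theorem graph_le_of_isMaximalPSL (hF : F.IsFrameGraph) {G T : SimpleGraph F.verts}
    (hG : IsMaximalPSL G) (hFG : F.graph ≤ G) (hT : IsRealization (signature G) T) :
    F.graph ≤ T := by
  refine graph_le_of_degree hF hFG hT.1 (fun D v => ?_)
    (fun i hi => card_le_of_isMaximalPSL hF hG hFG hi) (fun j hj => ?_)
  · exact (congrFun (congrFun hT.2 D) v).ge
  · refine card_le_of_isMaximalPSL (isFrameGraph_transpose hF)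
      (isMaximalPSL_swapGraph mem_verts_transpose hG) ?_ hj
    rw [graph_transpose]
    exact swapGraph_mono mem_verts_transpose hFG

/-! ### The constructed signature -/

lemma cardinalDegree_sup_le {V : Finset Pt} (G H : SimpleGraph V) (D : Direction) (v : V) :
    cardinalDegree (G ⊔ H) D v ≤ cardinalDegree G D v + cardinalDegree H D v := by
  refine le_trans (Set.ncard_le_ncard ?_) (Set.ncard_union_le _ _)
  rintro u ⟨h1 | h1, h2⟩
  · exact Or.inl ⟨h1, h2⟩
  · exact Or.inr ⟨h1, h2⟩

theorem graph_le_of_gadgets (hF : F.IsFrameGraph)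
    {U : Fin w → Fin h → EdgeColor → SimpleGraph F.verts} (hU : ∀ i j, F.IsGadget i j (U i j))
    (hbal : F.IsBalanced U) {T : SimpleGraph F.verts}
    (hT : IsRealization (F.constructedSignature U) T) : F.graph ≤ T := by
  -- The dark-dark coloring is always a triangulation, as crossings are allowed only for
  -- light-light. Planarity of Q as a whole is not needed; only its edge count and its degrees
  -- enter.
  set Q := F.filled U .black ⊔ F.filled U (.red .dark) ⊔ F.filled U (.blue .dark) with hQ
  have hFQ : F.graph ≤ Q := by
    refine le_trans ?_ (le_sup_left.trans le_sup_left)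
    exact (le_iSup (fun _ : EdgeColor.black = .black => F.graph) rfl).trans le_sup_left
  have hfill : ∀ i j k, U i j k ≤ F.filled U k := fun i j k =>
    (le_iSup₂ (f := fun i j => U i j k) i j).trans le_sup_right
  have hD := cellEdges_of_triangulations hF (Q := Q)
    (H := fun i j => F.localGraph (U i j) .dark .dark)
    (fun i j => by
      rcases (hU i j).2 .dark .dark with h1 | ⟨h1, -⟩
      · exact h1
      · exact absurd h1 (by simp))
    (fun i j => sup_le_sup (sup_le_sup (hfill i j _) (hfill i j _)) (hfill i j _))
  refine graph_le_of_degree hF hFQ hT.1 (fun D v => ?_) (fun i hi => hD.card_le hF hFQ hi)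
    (fun j hj => ?_)
  · have h1 : cardinalDegree T D v = F.constructedSignature U D v :=
      congrFun (congrFun hT.2 D) v
    -- By balance, half the number of coloured edges equals the dark red plus the dark blue degree,
    -- so the signature is the sum of the degrees of the three colour classes of Q and bounds the
    -- degree of their union.
    obtain ⟨h2, h3⟩ := hbal D v
    have h4 := cardinalDegree_sup_le (F.filled U .black ⊔ F.filled U (.red .dark))
      (F.filled U (.blue .dark)) D v
    have h5 := cardinalDegree_sup_le (F.filled U .black) (F.filled U (.red .dark)) D v
    rw [← hQ] at h4
    rw [h1]
    simp only [constructedSignature]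
    omega
  · refine hD.transpose.card_le (isFrameGraph_transpose hF) ?_ hj
    rw [graph_transpose]
    exact swapGraph_mono mem_verts_transpose hFQ

end Frame

theorem mainTheorem5 {w h : ℕ} (F : Frame w h) (hF : F.IsFrameGraph) :
    (∀ G : SimpleGraph F.verts, IsMaximalPSL G → F.graph ≤ G →
      ∀ u v : F.verts, F.graph.Adj u v → IsForced (signature G) u v) ∧
    (∀ U : Fin w → Fin h → EdgeColor → SimpleGraph F.verts,
      (∀ i j, F.IsGadget i j (U i j)) → F.IsBalanced U →
      ∀ T : SimpleGraph F.verts, IsRealization (F.constructedSignature U) T → F.graph ≤ T) :=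
  ⟨fun _ hG hFG _ _ huv _ hT => Frame.graph_le_of_isMaximalPSL hF hG hFG hT huv,
    fun _ hU hbal _ hT => Frame.graph_le_of_gadgets hF hU hbal hT⟩
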